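/- Let $T^n=S^1\times\dots\times S^1$ carry the product CW structure with $S^1=e^0\cup e^1$. A pointed CW complex $B$ is said to have the stable homotopy type of a wedge of spheres if for some $\ell\ge 0$ the reduced suspension $\Sigma^\ell B$ is homotopy equivalent to $\bigvee_j S^{n_j+\ell}$ for some family of integers $n_j\ge 0$. A group $\Gamma$ satisfies $(*)_s$ if its classifying space $B\Gamma=K(\Gamma,1)$ (a CW complex, unique up to homotopy equivalence) has the stable homotopy type of a wedge of spheres. (1) Let $n\ge 0$ and let $K=e^0\cup\bigcup_{i\in J}e_i^{n_i}$ be a (nonempty) subcomplex of $T^n$, where the $e_i^{n_i}$, $i\in J$, are the cells of $K$ of positive dimension $n_i$. Then for all sufficiently large $\ell$ the reduced suspension $\Sigma^\ell K$ is homotopy equivalent to the wedge $\bigvee_{i\in J}S^{n_i+\ell}$, with one sphere for each cell $e_i^{n_i}$. Moreover, there is a homotopy equivalence $f:\Sigma^\ell K\to\bigvee_{i\in J}S^{n_i+\ell}$ that is cellular, i.e. $f(\Sigma^\ell K^{(m)})\subseteq\bigvee_{n_i\le m}S^{n_i+\ell}$ for all $m$, and that takes each cell $\Sigma^\ell e_i^{n_i}$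 to $S^{n_i+\ell}$ in the following sense: with $\Phi_i:(D^{n_i}\times I^\ell,\partial)\to(\Sigma^\ell K^{(n_i)},\Sigma^\ell K^{(n_i-1)})$ the characteristic map of the cell, $f\circ\Phi_i$ is homotopic, as a map of pairs $(D^{n_i}\times I^\ell,\partial)\to\bigl(\bigvee_{n_j\le n_i}S^{n_j+\ell},\bigvee_{n_j<n_i}S^{n_j+\ell}\bigr)$, to a map into the summand $S^{n_i+\ell}$ of index $i$ that sends the boundary to the base point and the interior bijectively onto the complement of the base point. (2) In particular, every nonempty subcomplex of $T^n$ has the stable homotopy type of a wedge of spheres. (3) Let $G$ be a finite simplicial graph with vertex set $V$ and let $A_G=\langle V\mid [s,t]=1 \text{ whenever } \{s,t\} \text{ is an edge of } G\rangle$ be its right-angled Artin group. The Salvetti complex of $A_G$, i.e. the subcomplex of the torus $T^V$ that is the union of the coordinate tori $T^\sigma\subseteq T^V$ over all sets $\sigma\subseteq V$ that span a complete subgraph of $G$, is a classifying space of $A_G$, and $A_G$ satisfies $(*)_s$. -/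

import Mathlib

open Set Metric Topology

universe u v

noncomputable section

/-! ### The torus with its product cell structure -/

/-- The torus `T^ι = ∏_{i ∈ ι} S¹`, with `S¹ = ℝ / ℤ`; for `ι = Fin n` it is `T^n`. -/
abbrev Torus (ι : Type u) : Type u := ι → UnitAddCircle

namespace Torus

variable {ι : Type u}

/-- With `S¹ = e⁰ ∪ e¹`, `e⁰ = {0}`, the cells of dimension `m` of the product structure are the
products of `e¹` over a set `τ` of `m` coordinates and of `e⁰` over the other coordinates. -/
abbrev Cell (ι : Type u) (m : ℕ) : Type u := {τ : Finset ι // τ.card = m}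

/-- The characteristic map of the cell `τ`, on `[-1, 1]^m`: on each coordinate in `τ` it is the
characteristic map `t ↦ (t + 1) / 2 mod 1` of `e¹`. -/
def charFun {m : ℕ} (τ : Cell ι m) (y : Fin m → ℝ) : Torus ι :=
  open Classical in
  fun i => if h : i ∈ τ.1 then (((y (τ.1.equivFinOfCardEq τ.2 ⟨i, h⟩) + 1) / 2 : ℝ) : UnitAddCircle)
    else 0

/-- The inverse of the characteristic map on the open cell. -/
def charInv {m : ℕ} (τ : Cell ι m) (x : Torus ι) : Fin m → ℝ :=
  fun k => 2 * (AddCircle.equivIco (1 : ℝ) 0 (x ((τ.1.equivFinOfCardEq τ.2).symm k)) : ℝ) - 1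

/-- The open cell of `τ`. -/
def openCellSet (τ : Finset ι) : Set (Torus ι) := {x | ∀ i, x i ≠ 0 ↔ i ∈ τ}

lemma coe_ne_zero {t : ℝ} (h0 : 0 < t) (h1 : t < 1) : (t : UnitAddCircle) ≠ 0 := by
  have h := (AddCircle.openPartialHomeomorphCoe (1 : ℝ) 0).map_source
    (x := t) (by simpa using ⟨h0, h1⟩)
  simpa using h

lemma coe_eq_zero_of_abs_one {t : ℝ} (h : |t| = 1) : (((t + 1) / 2 : ℝ) : UnitAddCircle) = 0 := by
  rcases eq_or_eq_neg_of_abs_eq h with h | h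
  · subst h
    norm_num
  · subst h
    norm_num

lemma equivIco_mem_Ioo {x : UnitAddCircle} (hx : x ≠ 0) :
    (AddCircle.equivIco (1 : ℝ) 0 x : ℝ) ∈ Ioo (0 : ℝ) 1 := by
  have h := (AddCircle.openPartialHomeomorphCoe (1 : ℝ) 0).map_target (x := x) (by simpa using hx)
  simpa using h

lemma mem_ball_iff {m : ℕ} {y : Fin m → ℝ} :
    y ∈ ball (0 : Fin m → ℝ) 1 ↔ ∀ k, |y k| < 1 := by
  rw [mem_ball_zero_iff, pi_norm_lt_iff one_pos]
  rfl

lemma charFun_mem {m : ℕ} (τ : Cell ι m) {y : Fin m → ℝ} (hy : y ∈ ball (0 : Fin m → ℝ) 1) :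
    charFun τ y ∈ openCellSet τ.1 := by
  intro i
  rw [mem_ball_iff] at hy
  by_cases h : i ∈ τ.1
  · have := abs_lt.1 (hy (τ.1.equivFinOfCardEq τ.2 ⟨i, h⟩))
    simp only [charFun, h, dif_pos, iff_true]
    exact coe_ne_zero (by linarith) (by linarith)
  · simp [charFun, h]

lemma charInv_mem {m : ℕ} (τ : Cell ι m) {x : Torus ι} (hx : x ∈ openCellSet τ.1) :
    charInv τ x ∈ ball (0 : Fin m → ℝ) 1 := by
  rw [mem_ball_iff]
  intro k
  have := equivIco_mem_Ioo ((hx ((τ.1.equivFinOfCardEq τ.2).symm k)).2 (by simp))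
  rw [abs_lt]
  constructor <;> simp only [charInv] <;> linarith [this.1, this.2]

lemma charInv_charFun {m : ℕ} (τ : Cell ι m) {y : Fin m → ℝ} (hy : y ∈ ball (0 : Fin m → ℝ) 1) :
    charInv τ (charFun τ y) = y := by
  rw [mem_ball_iff] at hy
  ext k
  have h := abs_lt.1 (hy k)
  simp only [charInv, charFun, Finset.coe_mem, dif_pos, Subtype.coe_eta, Equiv.apply_symm_apply]
  rw [AddCircle.equivIco_coe_of_mem]
  · ring
  · constructor <;> linarith

lemma charFun_charInv {m : ℕ} (τ : Cell ι m) {x : Torus ι} (hx : x ∈ openCellSet τ.1) :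
    charFun τ (charInv τ x) = x := by
  ext i
  by_cases h : i ∈ τ.1
  · simp only [charInv, charFun, h, dif_pos, Equiv.symm_apply_apply]
    rw [show ∀ t : ℝ, (2 * t - 1 + 1) / 2 = t from fun t => by ring]
    exact AddCircle.coe_equivIco
  · have : x i = 0 := by
      by_contra h'
      exact h ((hx i).1 h')
    simp [charFun, h, this]

/-- The characteristic map of a cell as a partial bijection. -/
def charMap {m : ℕ} (τ : Cell ι m) : PartialEquiv (Fin m → ℝ) (Torus ι) where
  toFun := charFun τ
  invFun := charInv τ
  source := ball 0 1
  target := openCellSet τ.1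
  map_source' _ := charFun_mem τ
  map_target' _ := charInv_mem τ
  left_inv' _ := charInv_charFun τ
  right_inv' _ := charFun_charInv τ

lemma charMap_image_ball {m : ℕ} (τ : Cell ι m) :
    charMap τ '' ball 0 1 = openCellSet τ.1 :=
  (charMap τ).image_source_eq_target

lemma continuous_charFun {m : ℕ} (τ : Cell ι m) : Continuous (charFun τ) := by
  refine continuous_pi fun i => ?_
  by_cases h : i ∈ τ.1
  · simp only [charFun, h, dif_pos]
    exact (AddCircle.continuous_mk' (1 : ℝ)).comp (by fun_prop)
  · simp only [charFun, h, dif_neg, not_false_eq_true]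
    fun_prop

lemma continuousOn_charInv {m : ℕ} (τ : Cell ι m) :
    ContinuousOn (charInv τ) (openCellSet τ.1) := by
  refine continuousOn_pi.2 fun k => ?_
  have h1 : ContinuousOn (fun x : UnitAddCircle => (AddCircle.equivIco (1 : ℝ) 0 x : ℝ)) {0}ᶜ := by
    intro x hx
    exact (continuousAt_subtype_val.comp
      (AddCircle.continuousAt_equivIco (1 : ℝ) 0 (by simpa using hx))).continuousWithinAt
  have h2 : ContinuousOn (fun x : Torus ι => (AddCircle.equivIco (1 : ℝ) 0
      (x ((τ.1.equivFinOfCardEq τ.2).symm k)) : ℝ)) (openCellSet τ.1) :=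
    h1.comp (continuous_apply _).continuousOn fun x hx => (hx _).2 (by simp)
  simp only [charInv]
  fun_prop

lemma mem_own_cell [Fintype ι] (x : Torus ι) :
    open Classical in x ∈ openCellSet (Finset.univ.filter fun i => x i ≠ 0) := by
  intro i
  simp

/-- The product CW structure on the torus, where `S¹ = e⁰ ∪ e¹`. -/
instance instCWComplex [Fintype ι] : CWComplex (univ : Set (Torus ι)) :=
  CWComplex.mkFinite univ (cell := Cell ι) (map := fun _ τ => charMap τ)
    (eventually_isEmpty_cell := by
      filter_upwards [Filter.eventually_gt_atTop (Fintype.card ι)] with m hm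
      refine ⟨fun τ => ?_⟩
      have := τ.1.card_le_univ
      rw [τ.2] at this
      omega)
    (finite_cell := fun _ => inferInstance)
    (source_eq := fun _ _ => rfl)
    (continuousOn := fun _ τ => (continuous_charFun τ).continuousOn)
    (continuousOn_symm := fun _ τ => continuousOn_charInv τ)
    (pairwiseDisjoint' := by
      rintro ⟨m, τ⟩ - ⟨m', ρ⟩ - hne
      simp only [Function.onFun, charMap_image_ball]
      rw [Set.disjoint_left]
      intro x hx hx'
      apply hne
      have h : τ.1 = ρ.1 := by
        ext i
        rw [← hx i, ← hx' i]
      obtain ⟨τ, rfl⟩ := τ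
      obtain ⟨ρ, rfl⟩ := ρ
      simp only at h
      subst h
      rfl)
    (mapsTo_iff_image_subset := by
      classical
      intro m τ y hy
      set x := charMap τ y with hx
      have hsub : (Finset.univ.filter fun i => x i ≠ 0) ⊂ τ.1 := by
        rw [Finset.ssubset_iff_of_subset]
        · rw [mem_sphere_zero_iff_norm] at hy
          have hex : ∃ k, |y k| = 1 := by
            by_contra hcon
            push Not at hcon
            have hb : y ∈ ball (0 : Fin m → ℝ) 1 := by
              rw [mem_ball_iff]
              intro k
              have : |y k| ≤ 1 := by
                have := norm_le_pi_norm y k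
                rwa [hy] at this
              exact lt_of_le_of_ne this (hcon k)
            rw [mem_ball_zero_iff] at hb
            exact absurd hy hb.ne
          obtain ⟨k, hk⟩ := hex
          refine ⟨(τ.1.equivFinOfCardEq τ.2).symm k, by simp, ?_⟩
          simp only [Finset.mem_filter, Finset.mem_univ, true_and, not_not, hx]
          change charFun τ y _ = 0
          simp only [charFun, Finset.coe_mem, dif_pos, Subtype.coe_eta, Equiv.apply_symm_apply]
          exact coe_eq_zero_of_abs_one hk
        · intro i hi
          by_contra h
          simp only [Finset.mem_filter, Finset.mem_univ, true_and] at hi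
          apply hi
          change charFun τ y i = 0
          simp [charFun, h]
      simp only [mem_iUnion]
      refine ⟨(Finset.univ.filter fun i => x i ≠ 0).card, ?_, ⟨_, rfl⟩, ?_⟩
      · have h := Finset.card_lt_card hsub
        rwa [τ.2] at h
      · apply image_mono ball_subset_closedBall
        rw [charMap_image_ball]
        exact mem_own_cell x)
    (union' := by
      classical
      refine eq_univ_of_forall fun x => ?_
      simp only [mem_iUnion]
      refine ⟨(Finset.univ.filter fun i => x i ≠ 0).card, ⟨_, rfl⟩, ?_⟩
      apply image_mono ball_subset_closedBall
      rw [charMap_image_ball]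
      exact mem_own_cell x)

end Torus

/-! ### Wedges of spheres and reduced suspensions -/

/-- The relation on `X` that identifies all points of `A` with each other. -/
def collapseSetoid {X : Type u} (A : Set X) : Setoid X where
  r x y := x = y ∨ (x ∈ A ∧ y ∈ A)
  iseqv :=
    { refl := fun _ => Or.inl rfl
      symm := by
        rintro x y (h | h)
        · exact Or.inl h.symm
        · exact Or.inr ⟨h.2, h.1⟩
      trans := by
        rintro x y z (rfl | h) (rfl | h')
        · exact Or.inl rfl
        · exact Or.inr h'
        · exact Or.inr h
        · exact Or.inr ⟨h.1, h'.2⟩ }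

/-- The quotient space `X / A`, for nonempty `A`. -/
abbrev Collapse {X : Type u} (A : Set X) : Type u := Quotient (collapseSetoid A)

/-- The standard sphere `S^d ⊆ ℝ^(d+1)`. -/
abbrev StdSphere (d : ℕ) : Type := sphere (0 : EuclideanSpace ℝ (Fin (d + 1))) 1

/-- The base point of `S^d`. -/
def StdSphere.base (d : ℕ) : StdSphere d := ⟨EuclideanSpace.single 0 1, by simp⟩

/-- The wedge `⋁_{j ∈ J} S^{d j}`, obtained from the disjoint union of a point and the spheres by
identifying all the base points with the point (so that it is a point if `J` is empty). -/
abbrev SphereWedge {J : Type u} (d : J → ℕ) : Type u :=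
  Collapse (insert (Sum.inl PUnit.unit) (range fun j => Sum.inr ⟨j, StdSphere.base (d j)⟩) :
    Set (PUnit.{u + 1} ⊕ Σ j, StdSphere (d j)))

namespace SphereWedge

variable {J : Type u} {d : J → ℕ}

/-- The base point of the wedge. -/
def base : SphereWedge d := Quotient.mk _ (Sum.inl PUnit.unit)

/-- The inclusion of a sphere into the wedge. -/
def incl (j : J) (s : StdSphere (d j)) : SphereWedge d := Quotient.mk _ (Sum.inr ⟨j, s⟩)

/-- The sub-wedge of the spheres whose index satisfies `P`. -/
def sub (P : J → Prop) : Set (SphereWedge d) :=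
  insert base {w | ∃ j, P j ∧ w ∈ range (incl j)}

end SphereWedge

/-- The reduced `ℓ`-fold suspension `Σ^ℓ X = X ∧ S^ℓ` of the space `X` with base point `x₀`, in the
form `X × I^ℓ / (X × ∂I^ℓ ∪ {x₀} × I^ℓ)`. -/
abbrev ReducedSuspension (ℓ : ℕ) (X : Type u) [TopologicalSpace X] (x₀ : X) : Type u :=
  Collapse {p : X × (Fin ℓ → unitInterval) | p.1 = x₀ ∨ p.2 ∈ Cube.boundary (Fin ℓ)}

/-- The point of `Σ^ℓ X` given by `x` and the suspension coordinates `t`. -/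
def ReducedSuspension.mk {ℓ : ℕ} {X : Type u} [TopologicalSpace X] {x₀ : X} (x : X)
    (t : Fin ℓ → unitInterval) : ReducedSuspension ℓ X x₀ :=
  Quotient.mk _ (x, t)

/-- Stably a wedge of spheres: some reduced suspension `Σ^ℓ X` is homotopy equivalent to
`⋁_j S^{n_j + ℓ} = Σ^ℓ (⋁_j S^{n_j})`. This always implies that the suspension spectrum of `X` is a
wedge of sphere spectra, and for a finite complex `X` it is equivalent to it. -/
def IsStablyWedgeOfSpheres (X : Type u) [TopologicalSpace X] (x₀ : X) : Prop :=
  ∃ (J : Type u) (n : J → ℕ) (ℓ : ℕ),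
    Nonempty (ContinuousMap.HomotopyEquiv (ReducedSuspension ℓ X x₀)
      (SphereWedge fun j => n j + ℓ))

/-! ### Suspended cells -/

section Cells

variable {X : Type u} [TopologicalSpace X]

/-- The cells of positive dimension of a CW complex. If the complex has only one `0`-cell `e⁰`, these
are the cells `e_i^{n_i}` other than `e⁰`. -/
abbrev PosCell (C : Set X) [CWComplex C] : Type u :=
  {i : Σ m : ℕ, RelCWComplex.cell C m // 0 < i.1}

/-- The dimension `n_i` of the cell. -/
abbrev PosCell.dim {C : Set X} [CWComplex C] (i : PosCell C) : ℕ := i.1.1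

/-- The domain `D^m × I^ℓ` of the characteristic map of the `ℓ`-fold suspension of an `m`-cell. (As
in the definition of CW complexes used here, `D^m` is the unit ball for the maximum norm.) -/
abbrev SuspDisk (m ℓ : ℕ) : Type := closedBall (0 : Fin m → ℝ) 1 × (Fin ℓ → unitInterval)

/-- The boundary of `D^m × I^ℓ`. -/
def SuspDisk.boundary (m ℓ : ℕ) : Set (SuspDisk m ℓ) :=
  {p | (p.1 : Fin m → ℝ) ∈ sphere (0 : Fin m → ℝ) 1 ∨ p.2 ∈ Cube.boundary (Fin ℓ)}

variable {C : Set X} [CWComplex C] {b : C} {ℓ : ℕ}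

/-- The characteristic map `D^{n_i} × I^ℓ → Σ^ℓ C` of the cell `Σ^ℓ e_i` of `Σ^ℓ C`. -/
def PosCell.suspChar (b : C) (ℓ : ℕ) (i : PosCell C) (p : SuspDisk i.dim ℓ) :
    ReducedSuspension ℓ C b :=
  ReducedSuspension.mk ⟨RelCWComplex.map i.1.1 i.1.2 p.1,
    RelCWComplex.closedCell_subset_complex i.1.1 i.1.2 (mem_image_of_mem _ p.1.2)⟩ p.2

/-- The map `f : Σ^ℓ C → ⋁_i S^{n_i + ℓ}` is cellular: it takes the `(m + ℓ)`-skeleton `Σ^ℓ C^{(m)}`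
into the `(m + ℓ)`-skeleton, the wedge of the spheres with `n_i ≤ m`. -/
def IsCellularToWedge [T2Space X]
    (f : C(ReducedSuspension ℓ C b, SphereWedge fun i : PosCell C => i.dim + ℓ)) : Prop :=
  ∀ (m : ℕ) (x : C) (t : Fin ℓ → unitInterval), (x : X) ∈ RelCWComplex.skeleton C (m : ℕ∞) →
    f (ReducedSuspension.mk x t) ∈ SphereWedge.sub fun i : PosCell C => i.dim ≤ m

/-- The map `f` takes each cell `Σ^ℓ e_i` to the sphere `S^{n_i + ℓ}`: as a map of pairs from
`(D^{n_i} × I^ℓ, ∂)` to the wedge of the spheres of dimension at most `n_i + ℓ` relative to the wedge of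
the spheres of smaller dimension, the restriction of `f` to the cell is homotopic to a map that wraps
the cell once around `S^{n_i + ℓ}`, i.e. that takes the boundary to the base point and the interior
bijectively onto the complement of the base point in `S^{n_i + ℓ}`. -/
def TakesCellsToSpheres
    (f : C(ReducedSuspension ℓ C b, SphereWedge fun i : PosCell C => i.dim + ℓ)) : Prop :=
  ∀ i : PosCell C,
    ∃ (h : C(SuspDisk i.dim ℓ, StdSphere (i.dim + ℓ)))
      (H : C(unitInterval × SuspDisk i.dim ℓ, SphereWedge fun i : PosCell C => i.dim + ℓ)),
      (∀ p ∈ SuspDisk.boundary i.dim ℓ, h p = StdSphere.base (i.dim + ℓ)) ∧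
      BijOn h (SuspDisk.boundary i.dim ℓ)ᶜ {StdSphere.base (i.dim + ℓ)}ᶜ ∧
      (∀ p, H (0, p) = f (i.suspChar b ℓ p)) ∧
      (∀ p, H (1, p) = SphereWedge.incl i (h p)) ∧
      (∀ t p, H (t, p) ∈ SphereWedge.sub fun j : PosCell C => j.dim ≤ i.dim) ∧
      (∀ t, ∀ p ∈ SuspDisk.boundary i.dim ℓ,
        H (t, p) ∈ SphereWedge.sub fun j : PosCell C => j.dim < i.dim)

end Cells

/-! ### Classifying spaces and the condition `(*)_s` -/

/-- The CW complex `C` is a classifying space `BΓ = K(Γ, 1)` of the discrete group `Γ`. -/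
structure IsClassifyingSpace (Γ : Type v) [Group Γ] {X : Type u} [TopologicalSpace X] [T2Space X]
    (C : Set X) [CWComplex C] : Prop where
  pathConnected : PathConnectedSpace C
  fundamentalGroup : ∀ x : C, Nonempty (FundamentalGroup C x ≃* Γ)
  aspherical : ∀ (k : ℕ) (x : C), 2 ≤ k → Subsingleton (HomotopyGroup.Pi k C x)

/-- The condition `(*)_s` on a group: its classifying space, which is unique up to homotopy
equivalence, is stably a wedge of spheres. -/
def StarS (Γ : Type u) [Group Γ] : Prop :=
  ∃ (X : Type u) (_ : TopologicalSpace X) (_ : T2Space X) (C : Set X) (_ : CWComplex C) (b : C),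
    IsClassifyingSpace Γ C ∧ IsStablyWedgeOfSpheres C b

/-! ### Right-angled Artin groups and Salvetti complexes -/

/-- The right-angled Artin group `A_G = ⟨V | [s, t] = 1 whenever s, t are adjacent⟩`. -/
abbrev RAAG {V : Type u} (G : SimpleGraph V) : Type u :=
  PresentedGroup {r : FreeGroup V | ∃ s t, G.Adj s t ∧ r = 
    FreeGroup.of s * FreeGroup.of t * (FreeGroup.of s)⁻¹ * (FreeGroup.of t)⁻¹}

/-- The Salvetti complex of `A_G` as a subcomplex of the torus `T^V`: the union of the coordinate
tori `T^τ ⊆ T^V` over the sets `τ` of vertices that span a complete subgraph. -/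
def salvetti {V : Type u} [Fintype V] (G : SimpleGraph V) :
    CWComplex.Subcomplex (univ : Set (Torus V)) where
  carrier := ⋃ τ ∈ {τ : Finset V | G.IsClique τ}, {x | ∀ i ∉ τ, x i = 0}
  I m := {τ : Torus.Cell V m | G.IsClique (τ.1 : Set V)}
  closed' := by
    refine (Set.toFinite _).isClosed_biUnion fun τ _ => ?_
    simp only [ofPred_forall]
    exact isClosed_iInter fun i => isClosed_iInter fun _ =>
      isClosed_eq (continuous_apply i) continuous_const
  union' := by
    classical
    rw [empty_union]
    have hcell : ∀ (m : ℕ) (τ : Torus.Cell V m),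
        RelCWComplex.openCell (C := (univ : Set (Torus V))) m τ = Torus.openCellSet τ.1 :=
      fun m τ => Torus.charMap_image_ball τ
    ext x
    simp only [mem_iUnion, mem_ofPred_eq, exists_prop]
    constructor
    · rintro ⟨m, ⟨τ, hτ⟩, hx⟩
      rw [hcell] at hx
      refine ⟨τ.1, hτ, fun i hi => ?_⟩
      by_contra h
      exact hi ((hx i).1 h)
    · rintro ⟨τ, hτ, hx⟩
      refine ⟨_, ⟨⟨Finset.univ.filter fun i => x i ≠ 0, rfl⟩, ?_⟩, ?_⟩
      · refine SimpleGraph.IsClique.subset ?_ hτ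
        intro i hi
        by_contra h
        simp at hi
        exact hi (hx i h)
      · rw [hcell]
        exact Torus.mem_own_cell x

end

/-!
A subcomplex `K` of the torus `T^V` is given by a family of subsets of `V`, the sets of coordinates
of its cells, that is closed under passing to subsets. Two things are proved about it: its
suspensions are wedges of spheres, and, if the family consists of the cliques of a graph `G`, it is a
classifying space of the right-angled Artin group of `G`.

*Splitting of the suspension.* The map `f` from `Σ^ℓ K` to the wedge is written down explicitly: a
coordinate torus of dimension `m` collapses, after `ℓ` suspensions, to `S^(m + ℓ)`
(`torusToSphere`), and `f` is the concatenation, along one suspension coordinate, of these collapses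
for all cells of positive dimension (`CellIndexing.wedgeLoop`). A collapse of the cell `τ` is trivial
at all points with a vanishing coordinate in `τ`, so that `f` is visibly cellular. On the cell `τ`,
up to smaller spheres, `f` is the collapse of `τ`, performed in a slab of the cube `I^ℓ`; expanding
the slab to the whole cube gives the required homotopy.

That `f` is a homotopy equivalence for `ℓ ≥ 2` follows from the Yoneda principle. Pointed maps from
`Σ^ℓ K` to `Z` up to homotopy form the group `π_ℓ` of the space of pointed maps `K → Z`, and pointed
maps `S^(m + ℓ) → Z` form `π_ℓ` of the space of maps of the `m`-torus to `Z` relative to its proper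
coordinate subtori. Since maps from a coordinate torus extend over `K` by projection, the latter
groups map to the former one, and composition with `f` amounts to multiplying the images. So it
suffices that `π_ℓ` of the mapping space of a pair `(K, K₀)` is the product of the contributions of
the cells of `K` outside `K₀` (`cellHom_prod_bijective`). This is proved by induction on the number of
these cells. If there are at least two, some coordinate `v` belongs to one of them but not to another.
Restriction to the subcomplex `K'` of the cells that avoid `v` is a fibration with fibre the mapping
space of `(K, K₀ ∪ K')`, and setting the coordinate `v` to `0` is a retraction of `K` to `K'`, which
gives a section (`splitFibration`). Hence `π_ℓ` splits as a product (`SplitFibration`).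

*The Salvetti complex.* Its universal cover is modelled by the space of greedy itineraries
(`IsItinerary`). An itinerary describes a motion in `ℝ^V` from the origin, in time steps, in which
commuting coordinates move simultaneously and every coordinate moves as early as it is allowed to; it
is a continuous version of the normal form of an element of the group. The space of itineraries is
contractible, since an itinerary can be stopped early (`Itinerary.contractibleSpace`). The endpoint
map is a covering of the preimage of the Salvetti complex in `ℝ^V`
(`Itinerary.isCoveringMap_endpoint`): near an integral point `v`, an itinerary is rounded to an
integral one that ends at `v`, and is recovered from it by appending a short move. Maps of cubes to
the Salvetti complex therefore lift to the space of itineraries, which gives asphericity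
(`subsingleton_pi_salvetti`). The elements of the fundamental group correspond to the integral
itineraries. Appending a full step to an integral itinerary multiplies the group element that it
spells by a generator (`Spells.appendMove`) and corresponds to the lift of the loop around a
coordinate circle (`LiftsTo.append`), so that the fundamental group is the right-angled Artin group
(`bijective_raagToFundamentalGroup`).
-/


noncomputable section

/-! ### Greedy itineraries -/

/-- A real number is an integer. -/
def IsInt (x : ℝ) : Prop := ∃ z : ℤ, (z : ℝ) = x

namespace IsInt

lemma zero : IsInt 0 := ⟨0, by simp⟩

lemma intCast (z : ℤ) : IsInt z := ⟨z, rfl⟩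

lemma add {x y : ℝ} (hx : IsInt x) (hy : IsInt y) : IsInt (x + y) := by
  obtain ⟨a, rfl⟩ := hx
  obtain ⟨b, rfl⟩ := hy
  exact ⟨a + b, by simp⟩

lemma sub {x y : ℝ} (hx : IsInt x) (hy : IsInt y) : IsInt (x - y) := by
  obtain ⟨a, rfl⟩ := hx
  obtain ⟨b, rfl⟩ := hy
  exact ⟨a - b, by simp⟩

lemma sum {κ : Type*} {s : Finset κ} {f : κ → ℝ} (h : ∀ k ∈ s, IsInt (f k)) :
    IsInt (∑ k ∈ s, f k) := by
  classical
  induction s using Finset.induction_on with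
  | empty => simpa using zero
  | insert a s ha ih =>
    rw [Finset.sum_insert ha]
    exact (h _ (by simp)).add (ih fun k hk => h k (by simp [hk]))

lemma eq_zero {x : ℝ} (hx : IsInt x) (h : |x| < 1) : x = 0 := by
  obtain ⟨z, rfl⟩ := hx
  have : |z| < 1 := by exact_mod_cast h
  rw [Int.abs_lt_one_iff] at this
  simp [this]

lemma eq_of_abs_sub_lt {x y : ℝ} (hx : IsInt x) (hy : IsInt y) (h : |x - y| < 1) : x = y :=
  sub_eq_zero.1 ((hx.sub hy).eq_zero h)

lemma one_le_abs {x : ℝ} (hx : IsInt x) (h : x ≠ 0) : 1 ≤ |x| := by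
  by_contra h'
  exact h (hx.eq_zero (not_le.1 h'))

lemma of_abs_eq_one {x : ℝ} (h : |x| = 1) : IsInt x := by
  rcases eq_or_eq_neg_of_abs_eq h with rfl | rfl
  · exact ⟨1, by simp⟩
  · exact ⟨-1, by simp⟩

lemma abs_le_one {x : ℝ} (hx : IsInt x) (h : |x| < 2) : |x| ≤ 1 := by
  obtain ⟨z, rfl⟩ := hx
  have h' : |z| < 2 := by exact_mod_cast h
  have : |z| ≤ 1 := by omega
  exact_mod_cast this

end IsInt

variable {V : Type u}

/-- A greedy itinerary in the cube complex of a right-angled Artin group, with unit time steps: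
in the time interval `[k, k + 1]` the coordinate `i` moves by `c k i` (at unit speed, then it stops).
Coordinates that move simultaneously commute; a coordinate `i` moves in step `k + 1` only if it
was kept from doing so before, by a coordinate `j` that does not commute with it (`j = i` included,
then moving in the same direction) and moves in step `k`; and `j` must have made a full step if a
coordinate not commuting with it moves later. Note that `¬ G.Adj i j` includes the case `i = j`. -/
structure IsItinerary (G : SimpleGraph V) (c : ℕ → V → ℝ) : Prop where
  bound : ∀ k i, |c k i| ≤ 1
  clique : ∀ k i j, c k i ≠ 0 → c k j ≠ 0 → i ≠ j → G.Adj i j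
  greedy : ∀ k i, c (k + 1) i ≠ 0 →
    ∃ j, ¬ G.Adj i j ∧ c k j ≠ 0 ∧ (j = i → 0 < c k i * c (k + 1) i)
  full : ∀ l m i j, l < m → c m i ≠ 0 → ¬ G.Adj i j → c l j ≠ 0 → |c l j| = 1
  finite : ∃ N, ∀ k, N ≤ k → ∀ i, c k i = 0

/-- The space of greedy itineraries, with the topology of pointwise convergence; it is the universal
cover of the Salvetti complex. -/
abbrev Itinerary (G : SimpleGraph V) : Type u := {c : ℕ → V → ℝ // IsItinerary G c}

/-- The total displacement of an itinerary; the sum is finite by `IsItinerary.finite`. -/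
def displacement (c : ℕ → V → ℝ) (i : V) : ℝ := ∑ᶠ k, c k i

lemma displacement_eq_sum {c : ℕ → V → ℝ} {N : ℕ} {i : V} (h : ∀ k, N ≤ k → c k i = 0) :
    displacement c i = ∑ k ∈ Finset.range N, c k i := by
  refine finsum_eq_sum_of_support_subset _ fun k hk => ?_
  by_contra h'
  exact hk (h k (by simpa using h'))

namespace IsItinerary

variable {G : SimpleGraph V} {c : ℕ → V → ℝ}

lemma zero : IsItinerary G (0 : ℕ → V → ℝ) where
  bound _ _ := by simp
  clique _ _ _ h := absurd rfl h
  greedy _ _ h := absurd rfl h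
  full _ _ _ _ _ h := absurd rfl h
  finite := ⟨0, fun _ _ _ => rfl⟩

/-- After a step without full moves nothing moves. -/
lemma eq_zero_of_lt (h : IsItinerary G c) {N : ℕ} (hN : ∀ i, |c N i| < 1) :
    ∀ k, N < k → ∀ i, c k i = 0 := by
  intro k hk
  obtain ⟨m, rfl⟩ := Nat.exists_eq_add_of_lt hk
  clear hk
  induction m with
  | zero =>
    intro i
    by_contra hi
    obtain ⟨j, hj, hj0, -⟩ := h.greedy _ i hi
    exact (hN j).ne (h.full _ _ i j (by omega) hi hj hj0)
  | succ m ih =>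
    intro i
    by_contra hi
    obtain ⟨j, hj, hj0, -⟩ := h.greedy _ i hi
    exact hj0 (ih j)

/-- A coordinate has at most one fractional move. -/
lemma isInt_of_ne (h : IsItinerary G c) {k l : ℕ} {i : V} (hk : ¬ IsInt (c k i)) (hl : l ≠ k) :
    IsInt (c l i) := by
  by_contra hl'
  have h0 : ∀ m, ¬ IsInt (c m i) → c m i ≠ 0 := fun m hm h0 => hm (h0 ▸ IsInt.zero)
  rcases lt_or_gt_of_ne hl with hlt | hlt
  · exact hl' (IsInt.of_abs_eq_one (h.full _ _ i i hlt (h0 _ hk) (G.loopless.irrefl i) (h0 _ hl')))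
  · exact hk (IsInt.of_abs_eq_one (h.full _ _ i i hlt (h0 _ hl') (G.loopless.irrefl i) (h0 _ hk)))

lemma isInt_displacement_sub (h : IsItinerary G c) {k : ℕ} {i : V} (hk : ¬ IsInt (c k i)) :
    IsInt (displacement c i - c k i) := by
  obtain ⟨N, hN⟩ := h.finite
  rw [displacement_eq_sum fun k hk => hN k hk i]
  have hkN : k ∈ Finset.range N := by
    rw [Finset.mem_range]
    by_contra h'
    exact hk ((hN k (not_lt.1 h') i).symm ▸ IsInt.zero)
  rw [← Finset.sum_erase_eq_sub hkN]
  exact IsInt.sum fun l hl => h.isInt_of_ne hk (Finset.ne_of_mem_erase hl)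

lemma isInt_displacement (h : IsItinerary G c) {i : V} (hk : ∀ k, IsInt (c k i)) :
    IsInt (displacement c i) := by
  obtain ⟨N, hN⟩ := h.finite
  rw [displacement_eq_sum fun k hk => hN k hk i]
  exact IsInt.sum fun l _ => hk l

lemma exists_not_isInt (h : IsItinerary G c) {i : V} (hi : ¬ IsInt (displacement c i)) :
    ∃ k, ¬ IsInt (c k i) := by
  by_contra! h'
  exact hi (h.isInt_displacement h')

/-- The coordinates of the displacement that are not integers commute. -/
lemma adj_of_displacement (h : IsItinerary G c) {i j : V} (hi : ¬ IsInt (displacement c i))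
    (hj : ¬ IsInt (displacement c j)) (hij : i ≠ j) : G.Adj i j := by
  obtain ⟨k, hk⟩ := h.exists_not_isInt hi
  obtain ⟨l, hl⟩ := h.exists_not_isInt hj
  have hk0 : c k i ≠ 0 := fun h0 => hk (h0 ▸ IsInt.zero)
  have hl0 : c l j ≠ 0 := fun h0 => hl (h0 ▸ IsInt.zero)
  by_contra hadj
  rcases lt_trichotomy k l with hlt | rfl | hlt
  · exact hk (IsInt.of_abs_eq_one (h.full _ _ j i hlt hl0 (fun h' => hadj h'.symm) hk0))
  · exact hadj (h.clique _ _ _ hk0 hl0 hij)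
  · exact hl (IsInt.of_abs_eq_one (h.full _ _ i j hlt hk0 hadj hl0))

end IsItinerary

/-! ### Appending a move to an itinerary -/

/-- The first time from which on no coordinate that does not commute with `i` moves. -/
def waitTime (G : SimpleGraph V) (c : ℕ → V → ℝ) (i : V) : ℕ :=
  sInf {k | ∀ l, k ≤ l → ∀ j, ¬ G.Adj i j → c l j = 0}

/-- The time step to which a move of the coordinate `i` by `r`, appended to an itinerary of full
steps, belongs: it cancels a preceding step of `i` in the opposite direction if it can. -/
def appendTime (G : SimpleGraph V) (c : ℕ → V → ℝ) (i : V) (r : ℝ) : ℕ :=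
  open Classical in
  if 0 < waitTime G c i ∧ c (waitTime G c i - 1) i * r < 0 then waitTime G c i - 1
    else waitTime G c i

/-- The itinerary `c` of full steps followed by the moves of commuting coordinates `i` by `δ i`. -/
def appendMove (G : SimpleGraph V) (c : ℕ → V → ℝ) (δ : V → ℝ) (k : ℕ) (i : V) : ℝ :=
  c k i + if k = appendTime G c i (δ i) then δ i else 0

section Append

variable {G : SimpleGraph V} {c : ℕ → V → ℝ} {δ : V → ℝ}

lemma waitTime_spec (h : IsItinerary G c) {i j : V} {l : ℕ} (hl : waitTime G c i ≤ l)
    (hj : ¬ G.Adj i j) : c l j = 0 := by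
  have hne : {k | ∀ l, k ≤ l → ∀ j, ¬ G.Adj i j → c l j = 0}.Nonempty := by
    obtain ⟨N, hN⟩ := h.finite
    exact ⟨N, fun l hl j _ => hN l hl j⟩
  exact Nat.sInf_mem hne l hl j hj

lemma lt_waitTime (h : IsItinerary G c) {i j : V} {l : ℕ} (hj : ¬ G.Adj i j) (h0 : c l j ≠ 0) :
    l < waitTime G c i := by
  by_contra h'
  exact h0 (waitTime_spec h (not_lt.1 h') hj)

lemma exists_of_succ_eq_waitTime (h : IsItinerary G c) {i : V} {k : ℕ}
    (hk : k + 1 = waitTime G c i) : ∃ j, ¬ G.Adj i j ∧ c k j ≠ 0 := by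
  by_contra! hcon
  have hmem : k ∈ {k | ∀ l, k ≤ l → ∀ j, ¬ G.Adj i j → c l j = 0} := by
    intro l hl j hj
    rcases hl.eq_or_lt with rfl | hlt
    · exact hcon j hj
    · exact waitTime_spec h (by omega) hj
  have := Nat.sInf_le hmem
  rw [waitTime] at hk
  omega

lemma waitTime_le {i : V} (k : ℕ) (hk : ∀ l, k ≤ l → ∀ j, ¬ G.Adj i j → c l j = 0) :
    waitTime G c i ≤ k := Nat.sInf_le hk

lemma waitTime_eq_succ (h : IsItinerary G c) {i j : V} {k : ℕ}
    (hk : ∀ l, k < l → ∀ j, ¬ G.Adj i j → c l j = 0) (hj : ¬ G.Adj i j) (h0 : c k j ≠ 0) :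
    waitTime G c i = k + 1 :=
  le_antisymm (waitTime_le _ fun l hl => hk l hl) (lt_waitTime h hj h0)

/-- Either the appended move cancels a step, or it comes after all moves it has to wait for. -/
lemma appendTime_cases (G : SimpleGraph V) (c : ℕ → V → ℝ) (i : V) (r : ℝ) :
    (appendTime G c i r + 1 = waitTime G c i ∧ c (appendTime G c i r) i * r < 0) ∨
    (appendTime G c i r = waitTime G c i ∧
      ∀ k, k + 1 = waitTime G c i → ¬ c k i * r < 0) := by
  by_cases hc : 0 < waitTime G c i ∧ c (waitTime G c i - 1) i * r < 0
  · left
    rw [appendTime, if_pos hc]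
    exact ⟨by omega, hc.2⟩
  · right
    rw [appendTime, if_neg hc]
    refine ⟨rfl, fun k hk hlt => hc ⟨by omega, ?_⟩⟩
    rwa [← hk, Nat.add_sub_cancel]

lemma appendTime_of_cancel {i : V} {r : ℝ} {k : ℕ} (hk : k + 1 = waitTime G c i)
    (hr : c k i * r < 0) : appendTime G c i r = k := by
  rcases appendTime_cases G c i r with h | h
  · omega
  · exact absurd hr (h.2 k hk)

lemma appendTime_of_wait {i : V} {r : ℝ} (hr : ∀ k, k + 1 = waitTime G c i → ¬ c k i * r < 0) :
    appendTime G c i r = waitTime G c i := by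
  rcases appendTime_cases G c i r with h | h
  · exact absurd h.2 (hr _ h.1)
  · exact h.1

lemma appendMove_of_ne {k : ℕ} {i : V} (h : k ≠ appendTime G c i (δ i)) :
    appendMove G c δ k i = c k i := by
  simp [appendMove, h]

lemma appendMove_self (i : V) :
    appendMove G c δ (appendTime G c i (δ i)) i = c (appendTime G c i (δ i)) i + δ i := by
  simp [appendMove]

lemma appendMove_of_eq_zero {k : ℕ} {i : V} (h : δ i = 0) : appendMove G c δ k i = c k i := by
  simp [appendMove, h]

/-- At the time of an appended move, no other coordinate that does not commute with it moves. -/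
lemma adj_of_appendTime (h : IsItinerary G c) {i j : V} {r : ℝ} (hij : i ≠ j)
    (h0 : c (appendTime G c i r) j ≠ 0) : G.Adj i j := by
  rcases appendTime_cases G c i r with h' | h'
  · refine h.clique _ i j (fun h0 => ?_) h0 hij
    rw [h0, zero_mul] at h'
    exact h'.2.false
  · by_contra hadj
    exact h0 (waitTime_spec h h'.1.ge hadj)

lemma eq_zero_of_appendTime_lt (h : IsItinerary G c) {i j : V} {r : ℝ} {l : ℕ}
    (hl : appendTime G c i r < l) (hj : ¬ G.Adj i j) : c l j = 0 := by
  refine waitTime_spec h ?_ hj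
  rcases appendTime_cases G c i r with h' | h' <;> omega

/-- The greedy rule is kept, as each appended move is assigned to the first step in which it can be
made. -/
theorem IsItinerary.appendMove (h : IsItinerary G c) (hc : ∀ k i, IsInt (c k i))
    (hδ : ∀ i, |δ i| ≤ 1) (hclique : ∀ i j, δ i ≠ 0 → δ j ≠ 0 → i ≠ j → G.Adj i j) :
    IsItinerary G (appendMove G c δ) := by
  -- a changed entry: either it is a full step that is partially taken back, or it was zero
  have hcases : ∀ k i, _root_.appendMove G c δ k i = c k i ∨
      (k = appendTime G c i (δ i) ∧ δ i ≠ 0 ∧ _root_.appendMove G c δ k i = c k i + δ i ∧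
        ((k + 1 = waitTime G c i ∧ c k i * δ i < 0) ∨ (k = waitTime G c i ∧ c k i = 0 ∧
          ∀ k, k + 1 = waitTime G c i → ¬ c k i * δ i < 0))) := by
    intro k i
    by_cases h0 : δ i = 0
    · exact Or.inl (appendMove_of_eq_zero h0)
    by_cases hk : k = appendTime G c i (δ i)
    · refine Or.inr ⟨hk, h0, by rw [hk, appendMove_self], ?_⟩
      rcases appendTime_cases G c i (δ i) with h' | h'
      · exact Or.inl (by rwa [hk])
      · exact Or.inr ⟨hk.trans h'.1, waitTime_spec h (hk.trans h'.1).ge (G.loopless.irrefl i), h'.2⟩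
    · exact Or.inl (appendMove_of_ne hk)
  have hsign : ∀ a b : ℝ, IsInt a → |a| ≤ 1 → |b| ≤ 1 → a * b < 0 → |a + b| ≤ 1 ∧
      (∀ t, 0 < t * a → a + b ≠ 0 → 0 < t * (a + b)) := by
    intro a b ha ha1 hb hab
    have ha0 : a ≠ 0 := by
      rintro rfl
      simp at hab
    rcases eq_or_eq_neg_of_abs_eq (le_antisymm ha1 (ha.one_le_abs ha0)) with rfl | rfl
    · have hb' := (abs_le.1 hb).1
      have hbn : b < 0 := by linarith
      refine ⟨abs_le.2 ⟨by linarith, by linarith⟩, fun t ht hne => ?_⟩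
      have : 0 < 1 + b := lt_of_le_of_ne (by linarith) (Ne.symm hne)
      rw [mul_one] at ht
      positivity
    · have hb' := (abs_le.1 hb).2
      have hbp : 0 < b := by linarith
      refine ⟨abs_le.2 ⟨by linarith, by linarith⟩, fun t ht hne => ?_⟩
      have : -1 + b < 0 := lt_of_le_of_ne (by linarith) hne
      have ht' : t < 0 := by linarith
      exact mul_pos_of_neg_of_neg ht' this
  -- if a coordinate moves later, then the steps it waited for are unchanged
  have hunch : ∀ k m i j, k < m → c m i ≠ 0 → ¬ G.Adj i j → c k j ≠ 0 →
      _root_.appendMove G c δ k j = c k j := by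
    intro k m i j hkm hm hij hkj
    rcases hcases k j with h' | ⟨-, -, -, h' | h'⟩
    · exact h'
    · have := lt_waitTime h (i := j) (j := i) (l := m) (fun h' => hij h'.symm) hm
      omega
    · exact absurd h'.2.1 hkj
  constructor
  · intro k i
    rcases hcases k i with h' | ⟨-, -, h', h'' | h''⟩
    · rw [h']
      exact h.bound k i
    · rw [h']
      exact (hsign _ _ (hc k i) (h.bound k i) (hδ i) h''.2).1
    · rw [h', h''.2.1, zero_add]
      exact hδ i
  · intro k i j hi hj hij
    by_contra hadj
    have key : ∀ i j, i ≠ j → ¬ G.Adj i j → c k i = 0 → _root_.appendMove G c δ k i ≠ 0 →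
        _root_.appendMove G c δ k j = 0 := by
      intro i j hij hadj h0 hi
      rcases hcases k i with h' | ⟨hk, hδi, -, -⟩
      · rw [h', h0] at hi
        exact absurd rfl hi
      by_contra hj
      rcases hcases k j with h' | ⟨-, hδj, -, -⟩
      · rw [h', hk] at hj
        exact hadj (adj_of_appendTime h hij hj)
      · exact hadj (hclique i j hδi hδj hij)
    by_cases hi0 : c k i = 0
    · exact hj (key i j hij hadj hi0 hi)
    by_cases hj0 : c k j = 0
    · exact hi (key j i hij.symm (fun h' => hadj h'.symm) hj0 hj)
    exact hadj (h.clique k i j hi0 hj0 hij)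
  · intro k i hi
    by_cases h0 : c (k + 1) i = 0
    · rcases hcases (k + 1) i with h' | ⟨hk, hδi, heq, h' | h'⟩
      · exact absurd (h'.trans h0) hi
      · rw [h0] at h'
        simp at h'
      obtain ⟨j, hj, hj0⟩ := exists_of_succ_eq_waitTime h h'.1
      have hun : _root_.appendMove G c δ k j = c k j := by
        rcases hcases k j with h'' | ⟨hk', hδj, -, -⟩
        · exact h''
        · by_cases hij : i = j
          · subst hij
            omega
          · exact absurd (hclique i j hδi hδj hij) hj
      refine ⟨j, hj, by rwa [hun], ?_⟩
      rintro rfl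
      rw [hun, heq, h0, zero_add]
      exact lt_of_le_of_ne (not_lt.1 (h'.2.2 k h'.1)) (mul_ne_zero hj0 hδi).symm
    · obtain ⟨j, hj, hj0, hs⟩ := h.greedy k i h0
      refine ⟨j, hj, by rwa [hunch k _ i j k.lt_succ_self h0 hj hj0], fun hji => ?_⟩
      have hs := hs hji
      subst hji
      rw [hunch k _ j j k.lt_succ_self h0 hj hj0]
      rcases hcases (k + 1) j with h' | ⟨-, -, h', h'' | h''⟩
      · rwa [h']
      · rw [h'] at hi ⊢
        exact (hsign _ _ (hc _ _) (h.bound _ _) (hδ j) h''.2).2 _ hs hi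
      · exact absurd h''.2.1 h0
  · intro l m i j hlm hm hij hl
    by_cases h0 : c m i = 0
    · rcases hcases m i with h' | ⟨hk, hδi, -, h' | h'⟩
      · exact absurd (h'.trans h0) hm
      · rw [h0] at h'
        simp at h'
      have hun : _root_.appendMove G c δ l j = c l j := by
        rcases hcases l j with h'' | ⟨hk', hδj, -, -⟩
        · exact h''
        · by_cases hij' : i = j
          · subst hij'
            omega
          · exact absurd (hclique i j hδi hδj hij') hij
      rw [hun] at hl ⊢
      exact le_antisymm (h.bound l j) ((hc l j).one_le_abs hl)
    · have hun : _root_.appendMove G c δ l j = c l j := by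
        rcases hcases l j with h'' | ⟨hk', hδj, -, h'' | h''⟩
        · exact h''
        · have := lt_waitTime h (i := j) (j := i) (l := m) (fun h' => hij h'.symm) h0
          omega
        · have := lt_waitTime h (i := j) (j := i) (l := m) (fun h' => hij h'.symm) h0
          omega
      rw [hun] at hl ⊢
      exact le_antisymm (h.bound l j) ((hc l j).one_le_abs hl)
  · obtain ⟨N, hN⟩ := h.finite
    refine ⟨N + 1, fun k hk i => ?_⟩
    rcases hcases k i with h' | ⟨hk', -, -, h' | h'⟩
    · rw [h', hN k (by omega)]
    · rw [hN k (by omega)] at h'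
      simp at h'
    · have := waitTime_le (G := G) (c := c) (i := i) N fun l hl j _ => hN l hl j
      omega

lemma displacement_appendMove (h : IsItinerary G c) (i : V) :
    displacement (appendMove G c δ) i = displacement c i + δ i := by
  obtain ⟨N, hN⟩ := h.finite
  set M := max N (appendTime G c i (δ i) + 1)
  have hM : ∀ k, M ≤ k → c k i = 0 := fun k hk => hN k (le_trans (le_max_left _ _) hk) i
  have hlt : appendTime G c i (δ i) < M := lt_of_lt_of_le (Nat.lt_succ_self _) (le_max_right _ _)
  have hM' : ∀ k, M ≤ k → appendMove G c δ k i = 0 := fun k hk => by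
    rw [appendMove_of_ne (by omega), hM k hk]
  rw [displacement_eq_sum hM, displacement_eq_sum hM']
  simp only [appendMove, Finset.sum_add_distrib]
  congr 1
  rw [Finset.sum_ite_eq']
  simp [hlt]

/-- The time of an appended move depends on its sign, but where the sign changes the move vanishes. -/
lemma continuous_appendMove {A : Type*} [TopologicalSpace A] {f : A → V → ℝ} (hf : Continuous f) :
    Continuous fun a => appendMove G c (f a) := by
  refine continuous_pi fun k => continuous_pi fun i => ?_
  have hfi : Continuous fun a => f a i := (continuous_apply i).comp hf
  -- the entry is `c k i` plus the positive, the negative, the whole or no part of `f a i`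
  have hpos : ∃ P : ℝ → ℝ, Continuous P ∧ ∀ r, (if k = appendTime G c i r then r else 0) = P r := by
    have hap : ∀ r, appendTime G c i r = if 0 < waitTime G c i ∧ c (waitTime G c i - 1) i * r < 0
        then waitTime G c i - 1 else waitTime G c i := fun r => by
      rw [appendTime]
    rcases Nat.eq_zero_or_pos (waitTime G c i) with hw | hw
    · simp only [hw, lt_irrefl, false_and, if_false] at hap
      by_cases hk : k = 0
      · exact ⟨id, continuous_id, fun r => by simp [hap, hk]⟩
      · exact ⟨fun _ => 0, continuous_const, fun r => by simp [hap, hk]⟩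
    · simp only [hw, true_and] at hap
      set a := c (waitTime G c i - 1) i with ha
      -- the function that keeps `r` when it has the sign opposite to that of `a`
      obtain ⟨Q, hQ, hQr⟩ : ∃ Q : ℝ → ℝ, Continuous Q ∧ ∀ r, Q r = if a * r < 0 then r else 0 := by
        rcases lt_trichotomy a 0 with h0 | h0 | h0
        · refine ⟨fun r => max r 0, by fun_prop, fun r => ?_⟩
          rcases lt_trichotomy r 0 with hr | hr | hr
          · rw [if_neg (not_lt.2 (mul_pos_of_neg_of_neg h0 hr).le)]
            exact max_eq_right hr.le
          · simp [hr]
          · rw [if_pos (mul_neg_of_neg_of_pos h0 hr)]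
            exact max_eq_left hr.le
        · exact ⟨fun _ => 0, continuous_const, fun r => by simp [h0]⟩
        · refine ⟨fun r => min r 0, by fun_prop, fun r => ?_⟩
          rcases lt_trichotomy r 0 with hr | hr | hr
          · rw [if_pos (mul_neg_of_pos_of_neg h0 hr)]
            exact min_eq_left hr.le
          · simp [hr]
          · rw [if_neg (not_lt.2 (mul_pos h0 hr).le)]
            exact min_eq_right hr.le
      by_cases hk : k = waitTime G c i
      · refine ⟨fun r => r - Q r, by fun_prop, fun r => ?_⟩
        change _ = r - Q r
        rw [hap, hQr]
        by_cases hr : a * r < 0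
        · rw [if_pos hr, if_pos hr, if_neg (by omega), sub_self]
        · rw [if_neg hr, if_neg hr, if_pos hk, sub_zero]
      · by_cases hk' : k = waitTime G c i - 1
        · refine ⟨Q, hQ, fun r => ?_⟩
          rw [hap, hQr]
          by_cases hr : a * r < 0
          · rw [if_pos hr, if_pos hr, if_pos hk']
          · rw [if_neg hr, if_neg hr, if_neg hk]
        · refine ⟨fun _ => 0, continuous_const, fun r => ?_⟩
          rw [hap]
          by_cases hr : a * r < 0
          · rw [if_pos hr, if_neg hk']
          · rw [if_neg hr, if_neg hk]
  obtain ⟨P, hP, hPr⟩ := hpos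
  simp only [appendMove, hPr]
  exact continuous_const.add (hP.comp hfi)

end Append

/-! ### Itineraries cover the flat complex -/

/-- An itinerary with displacement near the integral point `v` is made integral by changing the
fractional moves such that the displacement becomes `v`. -/
def roundTo {V : Type u} (c : ℕ → V → ℝ) (v : V → ℝ) (k : ℕ) (i : V) : ℝ :=
  open Classical in if IsInt (c k i) then c k i else c k i + (v i - displacement c i)

section Round

variable {V : Type u} {G : SimpleGraph V} {c : ℕ → V → ℝ} {v : V → ℝ}

lemma roundTo_of_isInt {k : ℕ} {i : V} (h : IsInt (c k i)) : roundTo c v k i = c k i := if_pos h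

lemma roundTo_of_not_isInt {k : ℕ} {i : V} (h : ¬ IsInt (c k i)) :
    roundTo c v k i = c k i + (v i - displacement c i) := if_neg h

lemma roundTo_of_eq_zero {k : ℕ} {i : V} (h : c k i = 0) : roundTo c v k i = 0 := by
  rw [roundTo_of_isInt (h ▸ IsInt.zero), h]

lemma isInt_roundTo (h : IsItinerary G c) (hv : ∀ i, IsInt (v i)) (k : ℕ) (i : V) :
    IsInt (roundTo c v k i) := by
  by_cases hk : IsInt (c k i)
  · rwa [roundTo_of_isInt hk]
  · rw [roundTo_of_not_isInt hk]
    have := (hv i).sub (h.isInt_displacement_sub hk)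
    convert this using 1
    ring

lemma abs_roundTo_le (h : IsItinerary G c) (hv : ∀ i, IsInt (v i))
    (hcv : ∀ i, |displacement c i - v i| < 1) (k : ℕ) (i : V) : |roundTo c v k i| ≤ 1 := by
  by_cases hk : IsInt (c k i)
  · rw [roundTo_of_isInt hk]
    exact h.bound k i
  · refine (isInt_roundTo h hv k i).abs_le_one ?_
    rw [roundTo_of_not_isInt hk]
    have h1 := abs_lt.1 (hcv i)
    have h2 := abs_le.1 (h.bound k i)
    exact abs_lt.2 ⟨by linarith, by linarith⟩

/-- Rounding keeps the direction of a move, unless it deletes the move. -/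
lemma roundTo_pos (h : IsItinerary G c) (hv : ∀ i, IsInt (v i))
    (hcv : ∀ i, |displacement c i - v i| < 1) {k : ℕ} {i : V} {t : ℝ} (ht : 0 < t * c k i)
    (h0 : roundTo c v k i ≠ 0) : 0 < t * roundTo c v k i := by
  by_cases hk : IsInt (c k i)
  · rwa [roundTo_of_isInt hk]
  · have h3 := (isInt_roundTo h hv k i).one_le_abs h0
    rw [roundTo_of_not_isInt hk] at h3 ⊢
    have h1 := abs_lt.1 (hcv i)
    have h2 := abs_le.1 (h.bound k i)
    rcases pos_and_pos_or_neg_and_neg_of_mul_pos ht with ⟨ht, hc⟩ | ⟨ht, hc⟩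
    · refine mul_pos ht ?_
      rcases le_abs.1 h3 with h4 | h4 <;> linarith
    · refine mul_pos_of_neg_of_neg ht ?_
      rcases le_abs.1 h3 with h4 | h4 <;> linarith

theorem IsItinerary.roundTo (h : IsItinerary G c) (hv : ∀ i, IsInt (v i))
    (hcv : ∀ i, |displacement c i - v i| < 1) : IsItinerary G (roundTo c v) := by
  have hne : ∀ {k i}, _root_.roundTo c v k i ≠ 0 → c k i ≠ 0 := fun h' h0 =>
    h' (roundTo_of_eq_zero h0)
  constructor
  · exact abs_roundTo_le h hv hcv
  · exact fun k i j hi hj hij => h.clique k i j (hne hi) (hne hj) hij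
  · intro k i hi
    obtain ⟨j, hj, hj0, hs⟩ := h.greedy k i (hne hi)
    have hfull := IsInt.of_abs_eq_one (h.full _ _ _ _ k.lt_succ_self (hne hi) hj hj0)
    refine ⟨j, hj, by rwa [roundTo_of_isInt hfull], ?_⟩
    rintro rfl
    rw [roundTo_of_isInt hfull]
    exact roundTo_pos h hv hcv (hs rfl) hi
  · intro l m i j _ _ _ hl
    exact le_antisymm (abs_roundTo_le h hv hcv l j) ((isInt_roundTo h hv l j).one_le_abs hl)
  · obtain ⟨N, hN⟩ := h.finite
    exact ⟨N, fun k hk i => roundTo_of_eq_zero (hN k hk i)⟩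

lemma displacement_roundTo (h : IsItinerary G c) (hv : ∀ i, IsInt (v i))
    (hcv : ∀ i, |displacement c i - v i| < 1) : displacement (roundTo c v) = v := by
  ext i
  obtain ⟨N, hN⟩ := h.finite
  rw [displacement_eq_sum fun k hk => roundTo_of_eq_zero (hN k hk i)]
  by_cases hi : ∀ k, IsInt (c k i)
  · rw [← (h.isInt_displacement hi).eq_of_abs_sub_lt (hv i) (hcv i),
      displacement_eq_sum fun k hk => hN k hk i]
    exact Finset.sum_congr rfl fun k _ => roundTo_of_isInt (hi k)
  · push Not at hi
    obtain ⟨k, hk⟩ := hi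
    have hkN : k ∈ Finset.range N := by
      rw [Finset.mem_range]
      by_contra h'
      exact hk ((hN k (not_lt.1 h') i).symm ▸ IsInt.zero)
    have hsum := displacement_eq_sum (c := c) fun k hk => hN k hk i
    rw [← Finset.add_sum_erase _ _ hkN] at hsum ⊢
    rw [roundTo_of_not_isInt hk, hsum, Finset.sum_congr rfl fun l hl =>
      roundTo_of_isInt (h.isInt_of_ne hk (Finset.ne_of_mem_erase hl))]
    ring

/-- An itinerary is recovered from its rounding: appending the missing displacement restores the
fractional moves. -/
lemma appendMove_roundTo (h : IsItinerary G c) (hv : ∀ i, IsInt (v i))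
    (hcv : ∀ i, |displacement c i - v i| < 1) :
    appendMove G (roundTo c v) (displacement c - v) = c := by
  have hr := h.roundTo hv hcv
  ext k i
  by_cases hi : ∀ k, IsInt (c k i)
  · have : (displacement c - v) i = 0 :=
      sub_eq_zero.2 ((h.isInt_displacement hi).eq_of_abs_sub_lt (hv i) (hcv i))
    rw [appendMove_of_eq_zero this, roundTo_of_isInt (hi k)]
  push Not at hi
  obtain ⟨m, hm⟩ := hi
  set δ : ℝ := (displacement c - v) i with hδ
  have hmδ : roundTo c v m i = c m i - δ := by
    rw [roundTo_of_not_isInt hm, hδ, Pi.sub_apply]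
    ring
  have hm0 : c m i ≠ 0 := fun h0 => hm (h0 ▸ IsInt.zero)
  have hm1 : |c m i| < 1 := lt_of_le_of_ne (h.bound m i) fun h1 => hm (IsInt.of_abs_eq_one h1)
  have hlater : ∀ l, m < l → ∀ j, ¬ G.Adj i j → c l j = 0 := by
    intro l hl j hj
    by_contra h0
    exact hm1.ne (h.full m l j i hl h0 (fun h' => hj h'.symm) hm0)
  -- the fractional move of `i` is restored at the time when it was made
  have htime : appendTime G (roundTo c v) i δ = m := by
    by_cases h0 : roundTo c v m i = 0
    · have hwait : waitTime G (roundTo c v) i = m := by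
        refine le_antisymm (waitTime_le _ fun l hl j hj => ?_) ?_
        · rcases hl.eq_or_lt with rfl | hl
          · by_cases hij : i = j
            · rwa [← hij]
            · refine roundTo_of_eq_zero ?_
              by_contra hj0
              exact hj (h.clique _ i j hm0 hj0 hij)
          · exact roundTo_of_eq_zero (hlater l hl j hj)
        · cases m with
          | zero => exact Nat.zero_le _
          | succ m =>
            obtain ⟨j, hj, hj0, -⟩ := h.greedy m i hm0
            refine lt_waitTime hr hj ?_
            rwa [roundTo_of_isInt (IsInt.of_abs_eq_one (h.full _ _ _ _ m.lt_succ_self hm0 hj hj0))]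
      rw [appendTime_of_wait, hwait]
      intro k hk hneg
      rw [hwait] at hk
      subst hk
      have hki : roundTo c v k i ≠ 0 := fun h' => by simp [h'] at hneg
      have hki' : c k i ≠ 0 := fun h' => hki (roundTo_of_eq_zero h')
      obtain ⟨j, hj, hj0, hs⟩ := h.greedy k i hm0
      by_cases hij : j = i
      · subst hij
        rw [roundTo_of_isInt (IsInt.of_abs_eq_one (h.full _ _ _ _ k.lt_succ_self hm0 hj hj0))] at hneg
        have : δ = c (k + 1) j := by linarith
        rw [this] at hneg
        exact absurd (hs rfl) hneg.le.not_gt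
      · exact hj (h.clique k i j hki' hj0 (Ne.symm hij))
    · refine appendTime_of_cancel (waitTime_eq_succ hr
        (fun l hl j hj => roundTo_of_eq_zero (hlater l hl j hj)) (G.loopless.irrefl i) h0).symm ?_
      have h1 : |roundTo c v m i| = 1 :=
        le_antisymm (abs_roundTo_le h hv hcv m i) ((isInt_roundTo h hv m i).one_le_abs h0)
      have hδ' : δ = c m i - roundTo c v m i := by linarith
      have h2 : roundTo c v m i * roundTo c v m i = 1 := by
        rw [← abs_mul_abs_self, h1, one_mul]
      have h3 : |roundTo c v m i * c m i| < 1 := by rwa [abs_mul, h1, one_mul]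
      rw [hδ', mul_sub, h2]
      linarith [(abs_lt.1 h3).2]
  by_cases hk : k = m
  · rw [appendMove, ← hδ, htime, if_pos hk, hk, hmδ]
    ring
  · rw [appendMove_of_ne (by rwa [← hδ, htime]), roundTo_of_isInt (h.isInt_of_ne hm hk)]

/-- Rounding undoes the appending of fractional moves. -/
lemma roundTo_appendMove {δ : V → ℝ} (h : IsItinerary G c) (hc : ∀ k i, IsInt (c k i))
    (hδ : ∀ i, |δ i| < 1) : roundTo (appendMove G c δ) (displacement c) = c := by
  ext k i
  by_cases hk : k = appendTime G c i (δ i) ∧ δ i ≠ 0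
  · obtain ⟨hk, h0⟩ := hk
    have heq : appendMove G c δ k i = c k i + δ i := by rw [hk, appendMove_self]
    rw [roundTo_of_not_isInt, displacement_appendMove h, heq]
    · ring
    · intro h'
      rw [heq] at h'
      have := h'.sub (hc k i)
      rw [add_sub_cancel_left] at this
      exact h0 (this.eq_zero (hδ i))
  · have heq : appendMove G c δ k i = c k i := by
      by_cases h0 : δ i = 0
      · exact appendMove_of_eq_zero h0
      · exact appendMove_of_ne fun h' => hk ⟨h', h0⟩
    rw [roundTo_of_isInt (heq ▸ hc k i), heq]

end Round

section Topology

variable {V : Type u} (G : SimpleGraph V)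

/-- The preimage in `ℝ^V` of the Salvetti complex. -/
abbrev FlatComplex : Type u :=
  {x : V → ℝ // ∀ i j, ¬ IsInt (x i) → ¬ IsInt (x j) → i ≠ j → G.Adj i j}

variable {G}

lemma Itinerary.continuous_entry (k : ℕ) (i : V) : Continuous fun c : Itinerary G => c.1 k i :=
  (continuous_apply i).comp ((continuous_apply k).comp continuous_subtype_val)

/-- The lengths of itineraries are locally bounded. -/
lemma Itinerary.exists_eventually_eq_zero [Fintype V] (c : Itinerary G) :
    ∃ N, ∀ᶠ c' : Itinerary G in 𝓝 c, ∀ k, N ≤ k → ∀ i, c'.1 k i = 0 := by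
  obtain ⟨N, hN⟩ := c.2.finite
  refine ⟨N + 1, ?_⟩
  have : ∀ᶠ c' : Itinerary G in 𝓝 c, ∀ i, |c'.1 N i| < 1 := by
    rw [Filter.eventually_all]
    intro i
    refine (continuous_abs.comp (Itinerary.continuous_entry N i)).continuousAt.eventually_lt
      continuousAt_const ?_
    simp [hN N le_rfl i]
  filter_upwards [this] with c' hc' k hk i
  exact c'.2.eq_zero_of_lt hc' k hk i

lemma Itinerary.continuous_displacement [Fintype V] :
    Continuous fun c : Itinerary G => displacement c.1 := by
  refine continuous_iff_continuousAt.2 fun c => ?_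
  obtain ⟨N, hN⟩ := c.exists_eventually_eq_zero
  have h : ContinuousAt (fun c : Itinerary G => fun i => ∑ k ∈ Finset.range N, c.1 k i) c := by
    refine Continuous.continuousAt ?_
    exact continuous_pi fun i => continuous_finsetSum _ fun k _ => Itinerary.continuous_entry k i
  refine h.congr ?_
  filter_upwards [hN] with c' hc'
  ext i
  exact (displacement_eq_sum fun k hk => hc' k hk i).symm

/-- The initial itinerary, which stays at the origin. -/
def Itinerary.start : Itinerary G := ⟨0, IsItinerary.zero⟩

lemma Itinerary.displacement_start (i : V) :
    displacement (Itinerary.start (G := G)).1 i = 0 := by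
  exact (displacement_eq_sum (c := (Itinerary.start (G := G)).1) (N := 0) fun _ _ => rfl).trans
    (Finset.sum_range_zero _)

/-- The endpoint of an itinerary. -/
def Itinerary.endpoint (c : Itinerary G) : FlatComplex G :=
  ⟨displacement c.1, fun _ _ => c.2.adj_of_displacement⟩

lemma Itinerary.continuous_endpoint [Fintype V] : Continuous (Itinerary.endpoint (G := G)) :=
  Itinerary.continuous_displacement.subtype_mk _

/-- Rounding is locally constant. -/
lemma Itinerary.eventually_roundTo_eq [Fintype V] (c : Itinerary G) {v : V → ℝ} (hv : ∀ i, IsInt (v i))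
    (hcv : ∀ i, |displacement c.1 i - v i| < 1) :
    ∀ᶠ c' : Itinerary G in 𝓝 c, roundTo c'.1 v = roundTo c.1 v := by
  obtain ⟨N, hN⟩ := c.exists_eventually_eq_zero
  have hdisp : ∀ i, Continuous fun c' : Itinerary G => displacement c'.1 i := fun i =>
    (continuous_apply i).comp Itinerary.continuous_displacement
  have hentry : ∀ k i, ∀ᶠ c' : Itinerary G in 𝓝 c, roundTo c'.1 v k i = roundTo c.1 v k i := by
    intro k i
    have h1 : ∀ᶠ c' : Itinerary G in 𝓝 c, |c'.1 k i - c.1 k i| < 1 / 2 := by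
      refine (((Itinerary.continuous_entry k i).sub continuous_const).abs).continuousAt.eventually_lt
        continuousAt_const ?_
      simp
    have h2 : ∀ᶠ c' : Itinerary G in 𝓝 c, |displacement c'.1 i - displacement c.1 i| < 1 / 2 := by
      refine (((hdisp i).sub continuous_const).abs).continuousAt.eventually_lt
        continuousAt_const ?_
      simp
    -- a fractional entry stays fractional nearby
    have h3 : ∀ m, ¬ IsInt (c.1 m i) → ∀ᶠ c' : Itinerary G in 𝓝 c, ¬ IsInt (c'.1 m i) := by
      intro m hm
      have hm0 : 0 < |c.1 m i| := abs_pos.2 fun h0 => hm (h0 ▸ IsInt.zero)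
      have hm1 : |c.1 m i| < 1 := lt_of_le_of_ne (c.2.bound m i) fun h' =>
        hm (IsInt.of_abs_eq_one h')
      have hcont := (continuous_abs.comp (Itinerary.continuous_entry (G := G) m i)).continuousAt
        (x := c)
      filter_upwards [hcont.eventually_lt continuousAt_const hm1,
        continuousAt_const.eventually_lt hcont hm0] with c' hc1 hc0 hint
      exact (abs_pos.1 hc0) (hint.eq_zero hc1)
    by_cases hk : IsInt (c.1 k i)
    · by_cases hall : ∀ m, IsInt (c.1 m i)
      · have hdv := (c.2.isInt_displacement hall).eq_of_abs_sub_lt (hv i) (hcv i)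
        filter_upwards [h1, h2] with c' h1 h2
        by_cases hk' : IsInt (c'.1 k i)
        · rw [roundTo_of_isInt hk, roundTo_of_isInt hk']
          exact hk'.eq_of_abs_sub_lt hk (by linarith)
        · refine (isInt_roundTo c'.2 hv k i).eq_of_abs_sub_lt (isInt_roundTo c.2 hv k i) ?_
          rw [roundTo_of_isInt hk, roundTo_of_not_isInt hk', ← hdv]
          have h1 := abs_lt.1 h1
          have h2 := abs_lt.1 h2
          exact abs_lt.2 ⟨by linarith, by linarith⟩
      · push Not at hall
        obtain ⟨m, hm⟩ := hall
        filter_upwards [h1, h3 m hm] with c' h1 h3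
        have hkm : k ≠ m := fun h' => hm (h' ▸ hk)
        have hk' := c'.2.isInt_of_ne h3 hkm
        rw [roundTo_of_isInt hk, roundTo_of_isInt hk']
        exact hk'.eq_of_abs_sub_lt hk (by linarith)
    · filter_upwards [h1, h2, h3 k hk] with c' h1 h2 hk'
      refine (isInt_roundTo c'.2 hv k i).eq_of_abs_sub_lt (isInt_roundTo c.2 hv k i) ?_
      rw [roundTo_of_not_isInt hk, roundTo_of_not_isInt hk']
      have h1 := abs_lt.1 h1
      have h2 := abs_lt.1 h2
      exact abs_lt.2 ⟨by linarith, by linarith⟩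
  have hfin : ∀ᶠ c' : Itinerary G in 𝓝 c, ∀ k ∈ Finset.range N, ∀ i,
      roundTo c'.1 v k i = roundTo c.1 v k i := by
    rw [Filter.eventually_all_finset]
    intro k _
    rw [Filter.eventually_all]
    exact hentry k
  filter_upwards [hfin, hN] with c' hc' hc'N
  ext k i
  by_cases hk : k < N
  · exact hc' k (Finset.mem_range.2 hk) i
  · rw [roundTo_of_eq_zero (hc'N k (not_lt.1 hk) i),
      roundTo_of_eq_zero (hN.self_of_nhds k (not_lt.1 hk) i)]

/-- Over the open star of an integral point `v`, the space of itineraries is the product of the star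
with the discrete set of integral itineraries that end at `v`, by rounding and appending moves. -/
theorem Itinerary.isCoveringMap_endpoint [Fintype V] : IsCoveringMap (Itinerary.endpoint (G := G)) := by
  intro x
  -- the open star of an integral vertex near `x` is evenly covered
  let v : V → ℝ := fun i => (⌊x.1 i⌋ : ℝ)
  have hv : ∀ i, IsInt (v i) := fun i => IsInt.intCast _
  let I : Type u := {c : Itinerary G // (∀ k i, IsInt (c.1 k i)) ∧ displacement c.1 = v}
  let _ : TopologicalSpace I := ⊥
  have _ : DiscreteTopology I := ⟨rfl⟩
  let U : Set (FlatComplex G) := {y | ∀ i, |y.1 i - v i| < 1}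
  have hU : IsOpen U := by
    have : U = ⋂ i, {y : FlatComplex G | |y.1 i - v i| < 1} := by
      ext y
      simp [U]
    rw [this]
    refine isOpen_iInter_of_finite fun i => isOpen_lt ?_ continuous_const
    exact (((continuous_apply i).comp continuous_subtype_val).sub continuous_const).abs
  refine IsEvenlyCovered.to_isEvenlyCovered_preimage (I := I)
    ⟨inferInstance, U, fun i => ?_, hU, hU.preimage Itinerary.continuous_endpoint, ?_⟩
  · have h1 := Int.floor_le (x.1 i)
    have h2 := Int.lt_floor_add_one (x.1 i)
    exact abs_lt.2 ⟨by linarith, by linarith⟩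
  have hclique : ∀ y : FlatComplex G, ∀ i j, (y.1 - v) i ≠ 0 → (y.1 - v) j ≠ 0 → y ∈ U →
      i ≠ j → G.Adj i j := by
    intro y i j hi hj hy hij
    refine y.2 i j (fun h' => ?_) (fun h' => ?_) hij
    · exact hi ((h'.sub (hv i)).eq_zero (hy i))
    · exact hj ((h'.sub (hv j)).eq_zero (hy j))
  let H : Itinerary.endpoint (G := G) ⁻¹' U ≃ₜ U × I :=
    { toFun c := ⟨⟨c.1.endpoint, c.2⟩, ⟨⟨roundTo c.1.1 v, c.1.2.roundTo hv c.2⟩,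
        isInt_roundTo c.1.2 hv, displacement_roundTo c.1.2 hv c.2⟩⟩
      invFun p := ⟨⟨appendMove G p.2.1.1 (p.1.1.1 - v), p.2.1.2.appendMove p.2.2.1
        (fun i => (p.1.2 i).le) fun i j hi hj => hclique p.1.1 i j hi hj p.1.2⟩, by
          intro i
          change |displacement (appendMove G p.2.1.1 (p.1.1.1 - v)) i - v i| < 1
          rw [displacement_appendMove p.2.1.2, p.2.2.2]
          have := p.1.2 i
          simpa using this⟩
      left_inv c := Subtype.ext (Subtype.ext (appendMove_roundTo c.1.2 hv c.2))
      right_inv p := by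
        refine Prod.ext (Subtype.ext (Subtype.ext ?_)) (Subtype.ext (Subtype.ext ?_))
        · ext i
          change displacement (appendMove G p.2.1.1 (p.1.1.1 - v)) i = _
          rw [displacement_appendMove p.2.1.2, p.2.2.2]
          simp
        · have := roundTo_appendMove (δ := p.1.1.1 - v) p.2.1.2 p.2.2.1 p.1.2
          rwa [p.2.2.2] at this
      continuous_toFun := by
        refine ((Itinerary.continuous_endpoint.comp continuous_subtype_val).subtype_mk _).prodMk ?_
        refine continuous_iff_continuousAt.2 fun c => ?_
        have h := Itinerary.eventually_roundTo_eq c.1 hv c.2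
        have h' : ∀ᶠ c' in 𝓝 c, roundTo (c'.1.1) v = roundTo c.1.1 v :=
          (continuous_subtype_val.tendsto c).eventually h
        refine (continuousAt_const (y := (⟨⟨roundTo c.1.1 v, c.1.2.roundTo hv c.2⟩,
          isInt_roundTo c.1.2 hv, displacement_roundTo c.1.2 hv c.2⟩ : I))).congr ?_
        filter_upwards [h'] with c' hc'
        exact Subtype.ext (Subtype.ext hc'.symm)
      continuous_invFun := by
        refine Continuous.subtype_mk (Continuous.subtype_mk ?_ _) _
        refine continuous_prod_of_discrete_right.2 fun c => ?_
        refine continuous_appendMove (c := c.1.1) (f := fun y : U => y.1.1 - v) ?_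
        exact (continuous_subtype_val.comp continuous_subtype_val).sub continuous_const }
  exact ⟨H, fun _ => rfl⟩

/-! ### Contracting the space of itineraries -/

/-- The length of the part of the time interval `[k, k + 1]` that is left after truncation; time is
reparametrized such that step `k` is made during `[1 - 2⁻ᵏ, 1 - 2⁻ᵏ⁻¹]`. -/
def truncLength (s : unitInterval) (k : ℕ) : ℝ :=
  max 0 (min 1 (((s : ℝ) - (1 - (1 / 2) ^ k)) * 2 ^ (k + 1)))

lemma truncLength_nonneg (s : unitInterval) (k : ℕ) : 0 ≤ truncLength s k := le_max_left _ _

lemma truncLength_le_one (s : unitInterval) (k : ℕ) : truncLength s k ≤ 1 :=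
  max_le zero_le_one (min_le_left _ _)

lemma truncLength_zero (k : ℕ) : truncLength 0 k = 0 := by
  have h1 : (1 / 2 : ℝ) ^ k ≤ 1 := pow_le_one₀ (by norm_num) (by norm_num)
  have : (((0 : unitInterval) : ℝ) - (1 - (1 / 2) ^ k)) * 2 ^ (k + 1) ≤ 0 :=
    mul_nonpos_of_nonpos_of_nonneg (by simp at h1 ⊢; linarith) (by positivity)
  rw [truncLength, max_eq_left]
  exact (min_le_right _ _).trans this

lemma truncLength_one (k : ℕ) : truncLength 1 k = 1 := by
  have : (((1 : unitInterval) : ℝ) - (1 - (1 / 2) ^ k)) * 2 ^ (k + 1) = 2 := by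
    rw [Set.Icc.coe_one, sub_sub_cancel, pow_succ, ← mul_assoc, ← mul_pow]
    norm_num
  rw [truncLength, this]
  norm_num

lemma truncLength_eq_one {s : unitInterval} {l m : ℕ} (hlm : l < m) (h : truncLength s m ≠ 0) :
    truncLength s l = 1 := by
  have h1 : 1 - (1 / 2 : ℝ) ^ m < s := by
    by_contra h'
    apply h
    rw [truncLength, max_eq_left]
    refine (min_le_right _ _).trans (mul_nonpos_of_nonpos_of_nonneg ?_ (by positivity))
    linarith
  have h2 : (1 / 2 : ℝ) ^ m ≤ (1 / 2) ^ (l + 1) :=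
    pow_le_pow_of_le_one (by norm_num) (by norm_num) hlm
  have h3 : (1 / 2 : ℝ) ^ (l + 1) * 2 ^ (l + 1) = 1 := by
    rw [← mul_pow]
    norm_num
  have h4 : (1 / 2 : ℝ) ^ (l + 1) ≤ s - (1 - (1 / 2) ^ l) := by
    have : (1 / 2 : ℝ) ^ l = 2 * (1 / 2) ^ (l + 1) := by rw [pow_succ]; ring
    linarith
  have h5 : 1 ≤ (s - (1 - (1 / 2 : ℝ) ^ l)) * 2 ^ (l + 1) := by
    exact h3.symm.le.trans (mul_le_mul_of_nonneg_right h4 (by positivity))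
  rw [truncLength, min_eq_left h5, max_eq_right zero_le_one]

lemma continuous_truncLength (k : ℕ) : Continuous fun s => truncLength s k := by
  unfold truncLength
  fun_prop

/-- An itinerary, stopped early. -/
def truncate {V : Type u} (c : ℕ → V → ℝ) (s : unitInterval) (k : ℕ) (i : V) : ℝ :=
  max (-truncLength s k) (min (truncLength s k) (c k i))

lemma truncate_of_eq_one {c : ℕ → V → ℝ} (h : IsItinerary G c) {s : unitInterval} {k : ℕ} {i : V}
    (hs : truncLength s k = 1) : truncate c s k i = c k i := by
  have := abs_le.1 (h.bound k i)
  rw [truncate, hs, min_eq_right this.2, max_eq_right this.1]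

lemma truncate_of_eq_zero {c : ℕ → V → ℝ} {s : unitInterval} {k : ℕ} {i : V}
    (h : c k i = 0) : truncate c s k i = 0 := by
  have := truncLength_nonneg s k
  rw [truncate, h, min_eq_right this, max_eq_right (by linarith)]

lemma truncLength_ne_zero {c : ℕ → V → ℝ} {s : unitInterval} {k : ℕ} {i : V}
    (h : truncate c s k i ≠ 0) : truncLength s k ≠ 0 := by
  intro h0
  apply h
  rw [truncate, h0, neg_zero]
  exact max_eq_left (min_le_left _ _)

theorem IsItinerary.truncate {c : ℕ → V → ℝ} (h : IsItinerary G c) (s : unitInterval) :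
    IsItinerary G (truncate c s) := by
  have hne : ∀ {k i}, _root_.truncate c s k i ≠ 0 → c k i ≠ 0 := fun h' h0 =>
    h' (truncate_of_eq_zero h0)
  constructor
  · intro k i
    have h0 := truncLength_nonneg s k
    have h1 := truncLength_le_one s k
    refine abs_le.2 ⟨(neg_le_neg h1).trans (le_max_left _ _), max_le (by linarith) ?_⟩
    exact (min_le_left _ _).trans h1
  · exact fun k i j hi hj hij => h.clique k i j (hne hi) (hne hj) hij
  · intro k i hi
    obtain ⟨j, hj, hj0, hs⟩ := h.greedy k i (hne hi)
    have h1 := truncLength_eq_one k.lt_succ_self (truncLength_ne_zero hi)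
    refine ⟨j, hj, by rwa [truncate_of_eq_one h h1], ?_⟩
    rintro rfl
    rw [truncate_of_eq_one h h1]
    have h0 : 0 < truncLength s (k + 1) :=
      lt_of_le_of_ne (truncLength_nonneg s _) (truncLength_ne_zero hi).symm
    rcases pos_and_pos_or_neg_and_neg_of_mul_pos (hs rfl) with ⟨ha, hb⟩ | ⟨ha, hb⟩
    · exact mul_pos ha (lt_max_of_lt_right (lt_min h0 hb))
    · exact mul_pos_of_neg_of_neg ha (max_lt (by linarith) (min_lt_of_right_lt hb))
  · intro l m i j hlm hm hij hl
    rw [truncate_of_eq_one h (truncLength_eq_one hlm (truncLength_ne_zero hm))]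
    exact h.full l m i j hlm (hne hm) hij (hne hl)
  · obtain ⟨N, hN⟩ := h.finite
    exact ⟨N, fun k hk i => truncate_of_eq_zero (hN k hk i)⟩

instance Itinerary.contractibleSpace : ContractibleSpace (Itinerary G) := by
  rw [contractible_iff_id_nullhomotopic]
  refine ⟨⟨0, IsItinerary.zero⟩, ⟨ContinuousMap.Homotopy.symm
    { toFun := fun p => ⟨truncate p.2.1 p.1, p.2.2.truncate p.1⟩
      continuous_toFun := ?_
      map_zero_left := ?_
      map_one_left := ?_ }⟩⟩
  · refine Continuous.subtype_mk (continuous_pi fun k => continuous_pi fun i => ?_) _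
    have h1 : Continuous fun p : unitInterval × Itinerary G => truncLength p.1 k :=
      (continuous_truncLength k).comp continuous_fst
    have h2 : Continuous fun p : unitInterval × Itinerary G => p.2.1 k i :=
      (Itinerary.continuous_entry k i).comp continuous_snd
    exact h1.neg.max (h1.min h2)
  · intro c
    refine Subtype.ext ?_
    ext k i
    change truncate c.1 0 k i = 0
    rw [truncate, truncLength_zero, neg_zero]
    exact max_eq_left (min_le_left _ _)
  · intro c
    refine Subtype.ext ?_
    ext k i
    exact truncate_of_eq_one c.2 (truncLength_one k)

end Topology

/-! ### Homotopy groups of contractible spaces and lifting of cubes -/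

/-- `GenLoop`s in a contractible space are null-homotopic relative to the boundary: on a shrinking
inner cube a free contraction is applied, and the collar around the inner cube is filled with the
trace of the base point. -/
lemma GenLoop.homotopic_const_of_contractible {k : ℕ} {E : Type*} [TopologicalSpace E]
    [ContractibleSpace E] {e : E} (f : GenLoop (Fin k) E e) :
    GenLoop.Homotopic f GenLoop.const := by
  obtain ⟨p, ⟨H⟩⟩ := id_nullhomotopic E
  have H0 : ∀ x, H (0, x) = x := H.apply_zero
  have H1 : ∀ x, H (1, x) = p := H.apply_one
  -- the inner cube, and a function which is `1` on it and vanishes on the boundary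
  let z : unitInterval × (Fin k → unitInterval) → Fin k → unitInterval := fun q i =>
    Set.projIcc 0 1 zero_le_one (1 / 2 + ((q.2 i : ℝ) - 1 / 2) * (1 + q.1))
  let T : (Fin k → unitInterval) → unitInterval := fun y =>
    Set.projIcc 0 1 zero_le_one (∏ i, min 1 (4 * min (y i : ℝ) (1 - y i)))
  have hz : Continuous z := by
    refine continuous_pi fun i => continuous_projIcc.comp ?_
    fun_prop
  have hT : Continuous T := by
    refine continuous_projIcc.comp ?_
    fun_prop
  have hz0 : ∀ y, z (0, y) = y := fun y => by
    ext i
    simp only [z]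
    rw [Set.Icc.coe_zero, add_zero, mul_one, add_sub_cancel, Set.projIcc_val]
  have hzb : ∀ s, ∀ y ∈ Cube.boundary (Fin k), z (s, y) ∈ Cube.boundary (Fin k) := by
    rintro s y ⟨i, hi | hi⟩
    · refine ⟨i, Or.inl (Set.projIcc_of_le_left _ ?_)⟩
      have := s.2.1
      simp only [hi, Set.Icc.coe_zero]
      linarith
    · refine ⟨i, Or.inr (Set.projIcc_of_right_le _ ?_)⟩
      have := s.2.1
      simp only [hi, Set.Icc.coe_one]
      linarith
  have hTb : ∀ y ∈ Cube.boundary (Fin k), T y = 0 := by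
    rintro y ⟨i, hi⟩
    refine Set.projIcc_of_le_left _ (le_of_eq (Finset.prod_eq_zero (Finset.mem_univ i) ?_))
    rcases hi with hi | hi <;> simp [hi]
  have hT1 : ∀ y, z (1, y) ∉ Cube.boundary (Fin k) → T y = 1 := by
    intro y hy
    refine Set.projIcc_of_right_le _ (ge_of_eq (Finset.prod_eq_one fun i _ => ?_))
    have h1 : ¬ z (1, y) i = 0 := fun h' => hy ⟨i, Or.inl h'⟩
    have h2 : ¬ z (1, y) i = 1 := fun h' => hy ⟨i, Or.inr h'⟩
    simp only [z, Set.Icc.coe_one] at h1 h2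
    refine min_eq_left ?_
    have h3 : 1 / 4 ≤ (y i : ℝ) := by
      by_contra h'
      refine h1 (Set.projIcc_of_le_left _ ?_)
      linarith
    have h4 : (y i : ℝ) ≤ 3 / 4 := by
      by_contra h'
      refine h2 (Set.projIcc_of_right_le _ ?_)
      linarith
    have := le_min h3 (show 1 / 4 ≤ 1 - (y i : ℝ) by linarith)
    linarith
  let m : GenLoop (Fin k) E e := ⟨⟨fun y => H (T y, e), by fun_prop⟩, fun y hy => by
    change H (T y, e) = e
    rw [hTb y hy, H0]⟩
  have hfb : ∀ y ∈ Cube.boundary (Fin k), f.1 y = e := f.2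
  have h1 : GenLoop.Homotopic f m := by
    refine ⟨⟨⟨⟨fun q => H (q.1 * T q.2, f.1 (z q)), by fun_prop⟩, fun y => ?_, fun y => ?_⟩, ?_⟩⟩
    · change H (0 * T y, f.1 (z (0, y))) = f.1 y
      rw [zero_mul, H0, hz0]
    · change H (1 * T y, f.1 (z (1, y))) = H (T y, e)
      rw [one_mul]
      by_cases hb : z (1, y) ∈ Cube.boundary (Fin k)
      · rw [hfb _ hb]
      · rw [hT1 y hb, H1, H1]
    · intro s y hy
      change H (s * T y, f.1 (z (s, y))) = f.1 y
      rw [hTb y hy, mul_zero, H0, hfb _ (hzb s y hy), hfb y hy]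
  have h2 : GenLoop.Homotopic m GenLoop.const := by
    refine ⟨⟨⟨⟨fun q => H (unitInterval.symm q.1 * T q.2, e), by fun_prop⟩,
      fun y => ?_, fun y => ?_⟩, ?_⟩⟩
    · change H (unitInterval.symm 0 * T y, e) = H (T y, e)
      rw [unitInterval.symm_zero, one_mul]
    · change H (unitInterval.symm 1 * T y, e) = e
      rw [unitInterval.symm_one, zero_mul, H0]
    · intro s y hy
      change H (unitInterval.symm s * T y, e) = H (T y, e)
      rw [hTb y hy, mul_zero]
  exact h1.trans h2

/-- Maps from a space with a contraction `h` that fixes the base point lift through covering maps. -/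
lemma IsCoveringMap.exists_lift {E X A : Type*} [TopologicalSpace E] [TopologicalSpace X]
    [TopologicalSpace A] {p : E → X} (cov : IsCoveringMap p) {a₀ : A} (h : C(unitInterval × A, A))
    (h0 : ∀ a, h (0, a) = a₀) (h1 : ∀ a, h (1, a) = a) (hfix : ∀ s, h (s, a₀) = a₀) (f : C(A, X))
    {e₀ : E} (he : p e₀ = f a₀) : ∃ F : C(A, E), F a₀ = e₀ ∧ ∀ a, p (F a) = f a := by
  have H_0 : ∀ a, (f.comp h) (0, a) = p ((ContinuousMap.const A e₀) a) := fun a => by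
    simp [h0, he]
  set F := cov.liftHomotopy (f.comp h) (ContinuousMap.const A e₀) H_0
  have hF : ∀ q, p (F q) = f (h q) := congrFun (cov.liftHomotopy_lifts (f.comp h) _ H_0)
  have hF0 : ∀ a, F (0, a) = e₀ := cov.liftHomotopy_zero (f.comp h) _ H_0
  refine ⟨⟨fun a => F (1, a), by fun_prop⟩, ?_, fun a => ?_⟩
  · have hcont : Continuous fun s => F (s, a₀) := by fun_prop
    have := congrFun (cov.eq_of_comp_eq hcont (continuous_const (y := e₀))
      (funext fun s => by simp [hF, hfix, he]) 0 (hF0 a₀)) 1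
    exact this
  · change p (F (1, a)) = f a
    rw [hF, h1]

/-- The contraction of a cube to its vertex `0`. -/
def cubeContraction (ι : Type*) : C(unitInterval × (ι → unitInterval), ι → unitInterval) :=
  ⟨fun q i => q.1 * q.2 i, by fun_prop⟩

/-! ### The Salvetti complex as a quotient of the space of itineraries -/

lemma coe_eq_zero_iff_isInt {x : ℝ} : (x : UnitAddCircle) = 0 ↔ IsInt x := by
  rw [AddCircle.coe_eq_zero_iff]
  simp [IsInt]

lemma mem_salvetti {V : Type u} [Fintype V] {G : SimpleGraph V} {x : Torus V} :
    x ∈ (salvetti G : Set (Torus V)) ↔ ∀ i j, x i ≠ 0 → x j ≠ 0 → i ≠ j → G.Adj i j := by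
  classical
  change x ∈ (⋃ τ ∈ {τ : Finset V | G.IsClique τ}, {x : Torus V | ∀ i ∉ τ, x i = 0}) ↔ _
  simp only [mem_iUnion, mem_ofPred_eq, exists_prop]
  constructor
  · rintro ⟨τ, hτ, hx⟩ i j hi hj hij
    refine hτ ?_ ?_ hij
    · by_contra h
      exact hi (hx i h)
    · by_contra h
      exact hj (hx j h)
  · intro h
    refine ⟨Finset.univ.filter fun i => x i ≠ 0, ?_, fun i hi => ?_⟩
    · intro i hi j hj hij
      simp only [Finset.coe_filter, Finset.mem_univ, true_and, mem_ofPred_eq] at hi hj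
      exact h i j hi hj hij
    · simpa using hi

section Salvetti

variable {V : Type u} [Fintype V] {G : SimpleGraph V}

/-- The projection of the flat complex to the Salvetti complex. -/
def FlatComplex.toSalvetti (x : FlatComplex G) : (salvetti G : Set (Torus V)) :=
  ⟨fun i => (x.1 i : UnitAddCircle), mem_salvetti.2 fun i j hi hj hij => x.2 i j
    (fun h => hi (coe_eq_zero_iff_isInt.2 h)) (fun h => hj (coe_eq_zero_iff_isInt.2 h)) hij⟩

/-- The universal covering of the Salvetti complex. -/
def Itinerary.toSalvetti (c : Itinerary G) : (salvetti G : Set (Torus V)) :=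
  c.endpoint.toSalvetti

lemma Itinerary.toSalvetti_apply (c : Itinerary G) (i : V) :
    c.toSalvetti.1 i = (displacement c.1 i : UnitAddCircle) := rfl

lemma Itinerary.continuous_toSalvetti : Continuous (Itinerary.toSalvetti (G := G)) := by
  refine Continuous.subtype_mk (continuous_pi fun i => ?_) _
  exact (AddCircle.continuous_mk' (1 : ℝ)).comp
    ((continuous_apply i).comp Itinerary.continuous_displacement)

lemma Itinerary.surjective_toSalvetti : Function.Surjective (Itinerary.toSalvetti (G := G)) := by
  intro x
  let δ : V → ℝ := fun i => (AddCircle.equivIco (1 : ℝ) 0 (x.1 i) : ℝ)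
  have hδ : ∀ i, ((δ i : ℝ) : UnitAddCircle) = x.1 i := fun i => AddCircle.coe_equivIco
  have hx : ∀ i, δ i ≠ 0 → x.1 i ≠ 0 := by
    intro i hi h0
    have h1 := (AddCircle.equivIco (1 : ℝ) 0 (x.1 i)).2
    refine hi ((coe_eq_zero_iff_isInt.1 ((hδ i).trans h0)).eq_zero ?_)
    rw [abs_of_nonneg h1.1]
    simpa using h1.2
  refine ⟨⟨appendMove G 0 δ, IsItinerary.zero.appendMove (fun _ _ => IsInt.zero) (fun i => ?_)
    fun i j hi hj => mem_salvetti.1 x.2 i j (hx i hi) (hx j hj)⟩, Subtype.ext (funext fun i => ?_)⟩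
  · have h1 := (AddCircle.equivIco (1 : ℝ) 0 (x.1 i)).2
    rw [abs_of_nonneg h1.1]
    have h2 : δ i < 0 + 1 := h1.2
    linarith
  · rw [Itinerary.toSalvetti_apply]
    change ((displacement (appendMove G 0 δ) i : ℝ) : UnitAddCircle) = x.1 i
    rw [displacement_appendMove IsItinerary.zero,
      show displacement (0 : ℕ → V → ℝ) i = 0 from Itinerary.displacement_start (G := G) i,
      zero_add, hδ]

/-- Maps from cubes to the Salvetti complex lift to the space of itineraries: they lift to `ℝ^V`
coordinate by coordinate, and the flat complex is covered by the space of itineraries. -/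
lemma Itinerary.exists_lift {A : Type*} [TopologicalSpace A] {a₀ : A}
    (h : C(unitInterval × A, A)) (h0 : ∀ a, h (0, a) = a₀) (h1 : ∀ a, h (1, a) = a)
    (hfix : ∀ s, h (s, a₀) = a₀) (f : C(A, (salvetti G : Set (Torus V)))) {e : Itinerary G}
    (he : e.toSalvetti = f a₀) :
    ∃ F : C(A, Itinerary G), F a₀ = e ∧ ∀ a, (F a).toSalvetti = f a := by
  have hlift : ∀ i, ∃ F : C(A, ℝ), F a₀ = displacement e.1 i ∧
      ∀ a, ((F a : ℝ) : UnitAddCircle) = (f a).1 i := by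
    intro i
    have hcont : Continuous fun a => (f a).1 i :=
      (continuous_apply i).comp (continuous_subtype_val.comp f.continuous)
    refine (AddCircle.isCoveringMap_coe (1 : ℝ)).exists_lift h h0 h1 hfix
      ⟨fun a => (f a).1 i, hcont⟩ ?_
    change ((displacement e.1 i : ℝ) : UnitAddCircle) = (f a₀).1 i
    rw [← he]
    rfl
  choose F hF0 hF using hlift
  let g : C(A, FlatComplex G) := ⟨fun a => ⟨fun i => F i a, fun i j hi hj =>
    mem_salvetti.1 (f a).2 i j (by rw [← hF]; exact fun h => hi (coe_eq_zero_iff_isInt.1 h))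
      (by rw [← hF]; exact fun h => hj (coe_eq_zero_iff_isInt.1 h))⟩, by fun_prop⟩
  have hg : e.endpoint = g a₀ := Subtype.ext (funext fun i => (hF0 i).symm)
  obtain ⟨F', hF'0, hF'⟩ := Itinerary.isCoveringMap_endpoint.exists_lift h h0 h1 hfix g hg
  refine ⟨F', hF'0, fun a => ?_⟩
  rw [Itinerary.toSalvetti, hF']
  exact Subtype.ext (funext fun i => hF i a)

lemma Itinerary.lift_unique {A : Type*} [TopologicalSpace A] [PreconnectedSpace A]
    {F F' : A → Itinerary G} (hF : Continuous F) (hF' : Continuous F')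
    (h : ∀ a, (F a).toSalvetti = (F' a).toSalvetti) {a₀ : A} (h₀ : F a₀ = F' a₀) : F = F' := by
  refine Itinerary.isCoveringMap_endpoint.eq_of_comp_eq hF hF' ?_ a₀ h₀
  have hcoord : ∀ i, (fun a => displacement (F a).1 i) = fun a => displacement (F' a).1 i := by
    intro i
    have hd : Continuous fun c : Itinerary G => displacement c.1 i :=
      (continuous_apply i).comp Itinerary.continuous_displacement
    refine (AddCircle.isCoveringMap_coe (1 : ℝ)).eq_of_comp_eq (hd.comp hF) (hd.comp hF')
      (funext fun a => ?_) a₀ (by simp only [h₀])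
    exact congrFun (congrArg Subtype.val (h a)) i
  exact funext fun a => Subtype.ext (funext fun i => congrFun (hcoord i) a)

/-- The Salvetti complex is aspherical: a map of a cube of dimension at least `2` that is constant on
the boundary lifts to a map to the contractible space of itineraries with the same property. -/
theorem subsingleton_pi_salvetti {k : ℕ} (hk : 2 ≤ k) (x : (salvetti G : Set (Torus V))) :
    Subsingleton (HomotopyGroup.Pi k (salvetti G : Set (Torus V)) x) := by
  obtain ⟨e, rfl⟩ := Itinerary.surjective_toSalvetti x
  have key : ∀ f : GenLoop (Fin k) (salvetti G : Set (Torus V)) e.toSalvetti,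
      GenLoop.Homotopic f GenLoop.const := by
    intro f
    have h0k : 0 < k := by omega
    have hf0 : e.toSalvetti = f.1 0 := (f.2 0 ⟨⟨0, h0k⟩, Or.inl rfl⟩).symm
    obtain ⟨F, hF0, hF⟩ := Itinerary.exists_lift (a₀ := (0 : Fin k → unitInterval))
      (cubeContraction (Fin k)) (fun a => by ext; simp [cubeContraction])
      (fun a => by ext; simp [cubeContraction]) (fun s => by ext; simp [cubeContraction]) f.1 hf0
    -- the lift is constant on the faces, and every face meets a face through the vertex `0`
    have hface : ∀ (i : Fin k) (b : unitInterval), (b = 0 ∨ b = 1) → ∀ y y',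
        F (Function.update y i b) = F (Function.update y' i b) := by
      intro i b hb y y'
      have hproj : ∀ y, (F (Function.update y i b)).toSalvetti = e.toSalvetti := fun y => by
        rw [hF]
        exact f.2 _ ⟨i, by simpa using hb⟩
      have hcont : Continuous fun y => F (Function.update y i b) := by fun_prop
      have := Itinerary.lift_unique hcont
        (continuous_const (y := F (Function.update y' i b)))
        (fun y => by rw [hproj, hproj]) (a₀ := y') rfl
      exact congrFun this y
    have hbd : ∀ y ∈ Cube.boundary (Fin k), F y = e := by
      rintro y ⟨i, hi⟩
      obtain ⟨j, hj⟩ : ∃ j : Fin k, j ≠ i := by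
        have : Nontrivial (Fin k) := Fin.nontrivial_iff_two_le.2 hk
        exact exists_ne i
      have h1 := hface i (y i) hi y 0
      have h2 := hface j 0 (Or.inl rfl) (Function.update 0 i (y i)) 0
      rw [Function.update_eq_self] at h1
      rw [Function.update_eq_self_iff.2 (by simp [hj])] at h2
      rw [h1, h2, Function.update_eq_self_iff.2 (by simp), hF0]
    obtain ⟨H⟩ := GenLoop.homotopic_const_of_contractible (e := e) ⟨F, hbd⟩
    have H' := H.compContinuousMap ⟨_, Itinerary.continuous_toSalvetti (G := G)⟩
    have hf : (⟨_, Itinerary.continuous_toSalvetti (G := G)⟩ : C(_, _)).comp F = f.1 :=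
      ContinuousMap.ext hF
    exact ⟨H'.cast hf rfl⟩
  refine ⟨?_⟩
  rintro ⟨f⟩ ⟨g⟩
  exact Quotient.sound ((key f).trans (key g).symm)

end Salvetti

/-! ### The fundamental group of the Salvetti complex -/

section Words

variable {V : Type u} (G : SimpleGraph V)

/-- The element of the right-angled Artin group given by simultaneous moves of coordinates by the
integral amounts `a i`. The order of the factors is arbitrary; the moves of a step of an itinerary
commute. -/
def moveElement [Fintype V] (a : V → ℝ) : RAAG G :=
  (Finset.univ.toList.map fun j => (PresentedGroup.of j : RAAG G) ^ round (a j)).prod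

/-- The product of the first `N` steps of an itinerary, later steps to the left, as in the
multiplication of `FundamentalGroup`. -/
def wordElement [Fintype V] (c : ℕ → V → ℝ) : ℕ → RAAG G
  | 0 => 1
  | N + 1 => moveElement G (c N) * wordElement c N

/-- The itinerary `c` spells the element `g` of the right-angled Artin group: `g` is the product of its
steps. -/
def Spells [Fintype V] (c : ℕ → V → ℝ) (g : RAAG G) : Prop :=
  ∃ N, ∀ M, N ≤ M → wordElement G c M = g

variable {G}

lemma Spells.unique [Fintype V] {c : ℕ → V → ℝ} {g g' : RAAG G} (h : Spells G c g)
    (h' : Spells G c g') : g = g' := by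
  obtain ⟨N, hN⟩ := h
  obtain ⟨N', hN'⟩ := h'
  rw [← hN _ (le_max_left N N'), ← hN' _ (le_max_right N N')]

lemma RAAG.commute_of {i j : V} (h : G.Adj i j) :
    Commute (PresentedGroup.of i : RAAG G) (PresentedGroup.of j) := by
  have h1 : (PresentedGroup.mk {r : FreeGroup V | ∃ s t, G.Adj s t ∧ r =
      FreeGroup.of s * FreeGroup.of t * (FreeGroup.of s)⁻¹ * (FreeGroup.of t)⁻¹})
      (FreeGroup.of i * FreeGroup.of j * (FreeGroup.of i)⁻¹ * (FreeGroup.of j)⁻¹) = 1 :=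
    PresentedGroup.one_of_mem ⟨i, j, h, rfl⟩
  simp only [map_mul, map_inv] at h1
  exact mul_inv_eq_iff_eq_mul.1 (mul_inv_eq_one.1 h1)

lemma List.prod_map_eq_mul_of_commute {κ M : Type*} [DecidableEq κ] [Monoid M] {l : List κ}
    (hl : l.Nodup) {i : κ} (hi : i ∈ l) {f f' : κ → M} {z : M} (h0 : f' i = z * f i)
    (h1 : ∀ j, j ≠ i → f' j = f j) (hz : ∀ j, j ≠ i → Commute z (f j)) :
    (l.map f').prod = z * (l.map f).prod := by
  induction l with
  | nil => simp at hi
  | cons a l ih =>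
    rw [List.nodup_cons] at hl
    rw [List.map_cons, List.map_cons, List.prod_cons, List.prod_cons]
    by_cases ha : a = i
    · subst ha
      rw [h0, mul_assoc]
      congr 2
      exact congrArg List.prod (List.map_congr_left fun j hj => h1 j fun h => hl.1 (h ▸ hj))
    · have hi' : i ∈ l := by
        rcases List.mem_cons.1 hi with h | h
        · exact absurd h.symm ha
        · exact h
      rw [ih hl.2 hi', h1 a ha, ← mul_assoc, ← (hz a ha).eq, mul_assoc]

lemma commute_zpow_round {a : V → ℝ} {i : V} (h : ∀ j, j ≠ i → a j ≠ 0 → G.Adj i j) (r : ℤ) {j : V}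
    (hj : j ≠ i) : Commute ((PresentedGroup.of i : RAAG G) ^ r) (PresentedGroup.of j ^ round (a j)) := by
  by_cases h0 : a j = 0
  · simp [h0]
  · exact (RAAG.commute_of (h j hj h0)).zpow_zpow _ _

lemma moveElement_add [Fintype V] {a a' : V → ℝ} {i : V} {r : ℤ} (h0 : a' i = a i + r)
    (h1 : ∀ j, j ≠ i → a' j = a j) (h : ∀ j, j ≠ i → a j ≠ 0 → G.Adj i j) :
    moveElement G a' = PresentedGroup.of i ^ r * moveElement G a := by
  classical
  refine List.prod_map_eq_mul_of_commute (Finset.nodup_toList _) (i := i) (by simp) ?_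
    (fun j hj => by rw [h1 j hj]) fun j hj => commute_zpow_round h r hj
  rw [h0, round_add_intCast, add_comm, zpow_add]

lemma commute_moveElement [Fintype V] {a : V → ℝ} {i : V} {r : ℤ} (h : ∀ j, a j ≠ 0 → G.Adj i j) :
    Commute ((PresentedGroup.of i : RAAG G) ^ r) (moveElement G a) := by
  refine Commute.list_prod_right _ _ fun x hx => ?_
  obtain ⟨j, -, rfl⟩ := List.mem_map.1 hx
  by_cases h0 : a j = 0
  · simp [h0]
  · exact (RAAG.commute_of (h j h0)).zpow_zpow _ _

/-- A move appended to an itinerary commutes with all moves that are made after the step to which it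
is assigned. -/
lemma Spells.appendMove [Fintype V] [DecidableEq V] {c : ℕ → V → ℝ} (hc : IsItinerary G c) {g : RAAG G}
    (h : Spells G c g) (i : V) (r : ℤ) :
    Spells G (appendMove G c (Pi.single i (r : ℝ))) (PresentedGroup.of i ^ r * g) := by
  set m := appendTime G c i r with hm
  have hother : ∀ k j, j ≠ i → _root_.appendMove G c (Pi.single i (r : ℝ)) k j = c k j :=
    fun k j hj => appendMove_of_eq_zero (by simp [hj])
  have hne : ∀ k, k ≠ m → _root_.appendMove G c (Pi.single i (r : ℝ)) k = c k := by
    intro k hk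
    ext j
    by_cases hj : j = i
    · subst hj
      exact appendMove_of_ne (by simpa using hk)
    · exact hother k j hj
  have hself : _root_.appendMove G c (Pi.single i (r : ℝ)) m i = c m i + r := by
    have := appendMove_self (G := G) (c := c) (δ := Pi.single i (r : ℝ)) i
    rwa [Pi.single_eq_same, ← hm] at this
  have hlow : ∀ N, N ≤ m → wordElement G (_root_.appendMove G c (Pi.single i (r : ℝ))) N =
      wordElement G c N := by
    intro N hN
    induction N with
    | zero => rfl
    | succ N ih => rw [wordElement, wordElement, ih (by omega), hne N (by omega)]
  have hhigh : ∀ N, m < N → wordElement G (_root_.appendMove G c (Pi.single i (r : ℝ))) N =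
      PresentedGroup.of i ^ r * wordElement G c N := by
    intro N hN
    induction N with
    | zero => omega
    | succ N ih =>
      rw [wordElement, wordElement]
      rcases (Nat.lt_succ_iff.1 hN).eq_or_lt with h' | h'
      · subst h'
        rw [hlow m le_rfl, moveElement_add hself (hother m)
          (fun j hj h0 => adj_of_appendTime hc hj.symm h0), mul_assoc]
      · rw [ih h', hne N h'.ne', ← mul_assoc, ← mul_assoc]
        congr 1
        refine (commute_moveElement fun j h0 => ?_).eq.symm
        by_contra hadj
        exact h0 (eq_zero_of_appendTime_lt hc h' hadj)
  obtain ⟨N, hN⟩ := h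
  refine ⟨max N (m + 1), fun M hM => ?_⟩
  rw [hhigh M (lt_of_lt_of_le (Nat.lt_succ_self m) ((le_max_right _ _).trans hM)),
    hN M ((le_max_left _ _).trans hM)]

lemma spells_zero [Fintype V] : Spells G (0 : ℕ → V → ℝ) 1 := by
  refine ⟨0, fun M _ => ?_⟩
  induction M with
  | zero => rfl
  | succ M ih =>
    rw [wordElement, ih (Nat.zero_le _), mul_one, moveElement]
    refine List.prod_eq_one fun x hx => ?_
    obtain ⟨j, -, rfl⟩ := List.mem_map.1 hx
    simp

end Words

/-- Appending a move to an itinerary in which everything commutes with it puts it at the start. -/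
lemma appendTime_eq_zero {V : Type u} {G : SimpleGraph V} {c : ℕ → V → ℝ} {i : V}
    (h : ∀ k j, c k j ≠ 0 → G.Adj i j) (r : ℝ) : appendTime G c i r = 0 := by
  have h0 : waitTime G c i = 0 := Nat.le_zero.1 (waitTime_le 0 fun l _ j hj => by
    by_contra h'
    exact hj (h l j h'))
  rw [appendTime_of_wait fun k hk => by omega, h0]

section Append

variable {V : Type u} [DecidableEq V] {G : SimpleGraph V}

/-- The itinerary of full steps `c` followed by a move of `i` by `r`. -/
def Itinerary.append (c : Itinerary G) (hc : ∀ k i, IsInt (c.1 k i)) (i : V) (r : ℝ)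
    (hr : |r| ≤ 1) : Itinerary G :=
  ⟨appendMove G c.1 (Pi.single i r), c.2.appendMove hc (fun j => by
    by_cases hj : j = i
    · subst hj
      simpa using hr
    · simp [hj]) fun j k hj hk hjk => by
    have h1 : j = i := by
      by_contra h'
      exact hj (by simp [h'])
    have h2 : k = i := by
      by_contra h'
      exact hk (by simp [h'])
    exact absurd (h1.trans h2.symm) hjk⟩

/-- Deleting a move of the last step leaves an itinerary, from which the deleted move leads back. -/
lemma Itinerary.exists_eq_append {c : Itinerary G} (hc : ∀ k i, IsInt (c.1 k i)) {m : ℕ} {i : V}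
    (hi : c.1 m i ≠ 0) (hlast : ∀ k, m < k → ∀ j, c.1 k j = 0) :
    ∃ (d : Itinerary G) (hd : ∀ k i, IsInt (d.1 k i)) (hr : |c.1 m i| ≤ 1),
      c = d.append hd i (c.1 m i) hr ∧ d.1 m i = 0 ∧
        ∀ k j, ¬ (k = m ∧ j = i) → d.1 k j = c.1 k j := by
  let d : ℕ → V → ℝ := fun k j => if k = m ∧ j = i then 0 else c.1 k j
  have hne : ∀ {k j}, d k j ≠ 0 → c.1 k j ≠ 0 := by
    intro k j h h0
    apply h
    simp only [d]
    split_ifs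
    · rfl
    · exact h0
  have hsame : ∀ {k j}, ¬ (k = m ∧ j = i) → d k j = c.1 k j := fun h => if_neg h
  have hlt : ∀ {k l j}, k < l → c.1 l j ≠ 0 → ∀ j', d k j' = c.1 k j' := by
    intro k l j hkl h0 j'
    refine hsame fun h' => ?_
    have := hlast l (by omega) j
    exact h0 this
  have hd : IsItinerary G d := by
    constructor
    · intro k j
      by_cases h : k = m ∧ j = i
      · simp [d, h]
      · rw [hsame h]
        exact c.2.bound k j
    · exact fun k j l hj hl hjl => c.2.clique k j l (hne hj) (hne hl) hjl
    · intro k j hj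
      obtain ⟨l, hl, hl0, hs⟩ := c.2.greedy k j (hne hj)
      refine ⟨l, hl, by rwa [hlt k.lt_succ_self (hne hj)], fun h => ?_⟩
      have h3 : d (k + 1) j = c.1 (k + 1) j := if_neg fun h' => hj (if_pos h')
      rw [hlt k.lt_succ_self (hne hj), h3]
      exact hs h
    · intro l k j j' hlk hk hadj hl
      rw [hlt hlk (hne hk)]
      exact c.2.full l k j j' hlk (hne hk) hadj (hne hl)
    · refine ⟨m + 1, fun k hk j => ?_⟩
      by_contra h
      exact hne h (hlast k (by omega) j)
  have hdi : d m i = 0 := if_pos ⟨rfl, rfl⟩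
  have hwait : waitTime G d i = m := by
    refine le_antisymm (waitTime_le _ fun l hl j hj => ?_) ?_
    · by_contra h0
      rcases hl.eq_or_lt with rfl | hl
      · have hij : i ≠ j := by
          rintro rfl
          exact h0 hdi
        exact hj (c.2.clique _ i j hi (hne h0) hij)
      · exact hne h0 (hlast l hl j)
    · cases m with
      | zero => exact Nat.zero_le _
      | succ m =>
        obtain ⟨j, hj, hj0, -⟩ := c.2.greedy m i hi
        exact lt_waitTime hd hj (by rwa [hlt m.lt_succ_self hi])
  have htime : appendTime G d i (c.1 m i) = m := by
    rw [appendTime_of_wait, hwait]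
    intro k hk hneg
    rw [hwait] at hk
    subst hk
    rw [hlt k.lt_succ_self hi] at hneg
    have hki : c.1 k i ≠ 0 := fun h' => by simp [h'] at hneg
    obtain ⟨j, hj, hj0, hs⟩ := c.2.greedy k i hi
    by_cases hij : j = i
    · exact hneg.not_gt (hs hij)
    · exact hj (c.2.clique k i j hki hj0 (Ne.symm hij))
  refine ⟨⟨d, hd⟩, fun k j => ?_, c.2.bound m i, Subtype.ext ?_, hdi, fun k j h => hsame h⟩
  · change IsInt (d k j)
    by_cases h : k = m ∧ j = i
    · simp only [d, if_pos h]
      exact IsInt.zero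
    · rw [hsame h]
      exact hc k j
  · ext k j
    change c.1 k j = appendMove G d (Pi.single i (c.1 m i)) k j
    by_cases hj : j = i
    · subst hj
      rw [appendMove, Pi.single_eq_same, htime]
      by_cases hk : k = m
      · subst hk
        rw [if_pos rfl, hdi, zero_add]
      · rw [if_neg hk, hsame fun h => hk h.1, add_zero]
    · rw [appendMove_of_eq_zero (by simp [hj]), hsame fun h => hj h.2]

end Append

section FundamentalGroup

variable {V : Type u} [Fintype V] {G : SimpleGraph V}

/-- The base point of the Salvetti complex. -/
def salvettiBase (G : SimpleGraph V) : (salvetti G : Set (Torus V)) :=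
  Itinerary.start.toSalvetti

/-- The element `g` of the fundamental group is represented by a loop with a lift from the initial
itinerary to the itinerary `c`. -/
def LiftsTo (g : FundamentalGroup (salvetti G : Set (Torus V)) (salvettiBase G))
    (c : Itinerary G) : Prop :=
  ∃ (γ : Path (salvettiBase G) (salvettiBase G)) (Γ : Path Itinerary.start c),
    g = FundamentalGroup.fromPath (Path.Homotopic.Quotient.mk γ) ∧ ∀ t, (Γ t).toSalvetti = γ t

lemma Itinerary.exists_path_lift {x y : (salvetti G : Set (Torus V))} (γ : Path x y)
    {c : Itinerary G} (hc : c.toSalvetti = x) :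
    ∃ (c' : Itinerary G) (Γ : Path c c'), ∀ t, (Γ t).toSalvetti = γ t := by
  obtain ⟨F, hF0, hF⟩ := Itinerary.exists_lift (A := unitInterval) (a₀ := 0)
    ⟨fun q => q.1 * q.2, by fun_prop⟩ (fun a => by simp) (fun a => by simp) (fun s => by simp)
    γ.toContinuousMap (e := c) (by simp [hc])
  exact ⟨F 1, ⟨F, hF0, rfl⟩, hF⟩

lemma exists_liftsTo (g : FundamentalGroup (salvetti G : Set (Torus V)) (salvettiBase G)) :
    ∃ c, LiftsTo g c := by
  induction g using Quotient.inductionOn with | _ γ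
  obtain ⟨c, Γ, hΓ⟩ := Itinerary.exists_path_lift γ (c := Itinerary.start) rfl
  exact ⟨c, γ, Γ, rfl, hΓ⟩

/-- The loops are homotopic, as the paths in the contractible space of itineraries are. -/
lemma LiftsTo.unique_left {g g' : FundamentalGroup (salvetti G : Set (Torus V)) (salvettiBase G)}
    {c : Itinerary G} (h : LiftsTo g c) (h' : LiftsTo g' c) : g = g' := by
  obtain ⟨γ, Γ, rfl, hΓ⟩ := h
  obtain ⟨γ', Γ', rfl, hΓ'⟩ := h'
  refine Quotient.sound ?_
  have hom := SimplyConnectedSpace.paths_homotopic Γ Γ'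
  have hmap := hom.map ⟨_, Itinerary.continuous_toSalvetti (G := G)⟩
  obtain ⟨H⟩ := hmap
  exact ⟨ContinuousMap.HomotopyRel.cast H (ContinuousMap.ext hΓ) (ContinuousMap.ext hΓ')⟩

/-- The end of the lift of a loop depends only on the homotopy class of the loop. -/
lemma LiftsTo.unique_right {g : FundamentalGroup (salvetti G : Set (Torus V)) (salvettiBase G)}
    {c c' : Itinerary G} (h : LiftsTo g c) (h' : LiftsTo g c') : c = c' := by
  obtain ⟨γ, Γ, rfl, hΓ⟩ := h
  obtain ⟨γ', Γ', hg, hΓ'⟩ := h'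
  obtain ⟨H⟩ := Quotient.exact hg
  obtain ⟨F, hF0, hF⟩ := Itinerary.exists_lift (A := unitInterval × unitInterval) (a₀ := 0)
    ⟨fun q => (q.1 * q.2.1, q.1 * q.2.2), by fun_prop⟩
    (fun a => by simp) (fun a => by simp) (fun s => by simp)
    H.toContinuousMap (e := Itinerary.start) (H.source 0).symm
  have hF : ∀ a, (F a).toSalvetti = H a := hF
  have h0 : (fun s => F (s, 0)) = fun _ => Itinerary.start := by
    refine Itinerary.lift_unique (by fun_prop) (by fun_prop) (fun s => ?_) (a₀ := 0) hF0
    rw [hF, H.source]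
    rfl
  have h1 : (fun t => F (0, t)) = Γ := by
    refine Itinerary.lift_unique (by fun_prop) (by fun_prop) (fun s => ?_) (a₀ := 0) ?_
    · rw [hF, H.apply_zero, hΓ]
      rfl
    · rw [Γ.source]
      exact hF0
  have h2 : (fun t => F (1, t)) = Γ' := by
    refine Itinerary.lift_unique (by fun_prop) (by fun_prop) (fun s => ?_) (a₀ := 0) ?_
    · rw [hF, H.apply_one, hΓ']
      rfl
    · rw [Γ'.source]
      exact congrFun h0 1
  have h3 : (fun s => F (s, 1)) = fun _ => F (0, 1) := by
    refine Itinerary.lift_unique (by fun_prop) (by fun_prop) (fun s => ?_) (a₀ := 0) rfl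
    rw [hF, hF, H.target, H.target]
  calc c = Γ 1 := Γ.target.symm
    _ = F (0, 1) := (congrFun h1 1).symm
    _ = F (1, 1) := (congrFun h3 1).symm
    _ = Γ' 1 := congrFun h2 1
    _ = c' := Γ'.target

lemma liftsTo_one : LiftsTo (G := G) 1 Itinerary.start :=
  ⟨Path.refl _, Path.refl _, rfl, fun _ => rfl⟩

/-- Itineraries that end in the base point consist of full steps. -/
lemma Itinerary.isInt_of_toSalvetti {c : Itinerary G} (h : c.toSalvetti = salvettiBase G) (k : ℕ)
    (i : V) : IsInt (c.1 k i) := by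
  by_contra hk
  have h1 : IsInt (displacement c.1 i) := by
    rw [← coe_eq_zero_iff_isInt, ← Itinerary.toSalvetti_apply, h, salvettiBase,
      Itinerary.toSalvetti_apply, Itinerary.displacement_start]
    rfl
  have h2 := h1.sub (c.2.isInt_displacement_sub hk)
  rw [sub_sub_cancel] at h2
  exact hk h2

lemma LiftsTo.toSalvetti_eq {g : FundamentalGroup (salvetti G : Set (Torus V)) (salvettiBase G)}
    {c : Itinerary G} (h : LiftsTo g c) : c.toSalvetti = salvettiBase G := by
  obtain ⟨γ, Γ, -, hΓ⟩ := h
  rw [← Γ.target, hΓ, γ.target]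

variable [DecidableEq V]

/-- The loop in the Salvetti complex that runs around the circle of the coordinate `i`. -/
def generatorLoop (G : SimpleGraph V) (i : V) : Path (salvettiBase G) (salvettiBase G) where
  toFun t := ⟨Pi.single i ((t : ℝ) : UnitAddCircle), mem_salvetti.2 fun j k hj hk hjk => by
    have h1 : j = i := by
      by_contra h'
      exact hj (by simp [h'])
    have h2 : k = i := by
      by_contra h'
      exact hk (by simp [h'])
    exact absurd (h1.trans h2.symm) hjk⟩
  continuous_toFun := by
    refine Continuous.subtype_mk ?_ _
    refine (continuous_single i).comp ((AddCircle.continuous_mk' (1 : ℝ)).comp ?_)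
    exact continuous_subtype_val
  source' := by
    refine Subtype.ext (funext fun j => ?_)
    rw [salvettiBase, Itinerary.toSalvetti_apply, Itinerary.displacement_start]
    simp
  target' := by
    refine Subtype.ext (funext fun j => ?_)
    rw [salvettiBase, Itinerary.toSalvetti_apply, Itinerary.displacement_start]
    have h1 : (((1 : ℝ)) : UnitAddCircle) = 0 := coe_eq_zero_iff_isInt.2 ⟨1, by simp⟩
    simp [h1]

/-- The class of a loop around a coordinate circle. -/
def generatorClass (G : SimpleGraph V) (i : V) :
    FundamentalGroup (salvetti G : Set (Torus V)) (salvettiBase G) :=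
  FundamentalGroup.fromPath (Path.Homotopic.Quotient.mk (generatorLoop G i))

lemma Itinerary.toSalvetti_append {c : Itinerary G} (hc : c.toSalvetti = salvettiBase G) (i : V)
    (r : ℝ) (hr : |r| ≤ 1) : ((c.append (c.isInt_of_toSalvetti hc) i r hr).toSalvetti).1 =
      Pi.single i (r : UnitAddCircle) := by
  ext j
  have h0 := congrFun (congrArg Subtype.val hc) j
  rw [Itinerary.toSalvetti_apply, salvettiBase, Itinerary.toSalvetti_apply,
    Itinerary.displacement_start] at h0
  rw [Itinerary.toSalvetti_apply]
  change ((displacement (appendMove G c.1 (Pi.single i r)) j : ℝ) : UnitAddCircle) = _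
  rw [displacement_appendMove c.2, AddCircle.coe_add, h0, AddCircle.coe_zero, zero_add]
  by_cases hj : j = i
  · subst hj
    simp
  · simp [hj]

/-- The lift of a generating loop, or of its inverse, appends a move to an itinerary. -/
lemma exists_append_path {c : Itinerary G} (hc : c.toSalvetti = salvettiBase G) (i : V) (r : ℝ)
    (hr : |r| ≤ 1) : ∃ Γ : Path c (c.append (c.isInt_of_toSalvetti hc) i r hr),
      ∀ t, ((Γ t).toSalvetti).1 = Pi.single i ((t * r : ℝ) : UnitAddCircle) := by
  have hb : ∀ t : unitInterval, |(t : ℝ) * r| ≤ 1 := fun t => by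
    rw [abs_mul, abs_of_nonneg t.2.1]
    exact mul_le_one₀ t.2.2 (abs_nonneg _) hr
  refine ⟨⟨⟨fun t => c.append (c.isInt_of_toSalvetti hc) i (t * r) (hb t), ?_⟩, ?_, ?_⟩,
    fun t => Itinerary.toSalvetti_append hc i _ (hb t)⟩
  · refine Continuous.subtype_mk (continuous_appendMove ?_) _
    exact (continuous_single i).comp (by fun_prop)
  · refine Subtype.ext ?_
    ext k j
    refine appendMove_of_eq_zero ?_
    simp
  · simp only [Set.Icc.coe_one, one_mul]

lemma LiftsTo.append {g : FundamentalGroup (salvetti G : Set (Torus V)) (salvettiBase G)}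
    {c : Itinerary G} (h : LiftsTo g c) (i : V) :
    LiftsTo (generatorClass G i * g)
      (c.append (c.isInt_of_toSalvetti h.toSalvetti_eq) i 1 (by simp)) := by
  have hc := h.toSalvetti_eq
  obtain ⟨γ, Γ, rfl, hΓ⟩ := h
  obtain ⟨Δ, hΔ⟩ := exists_append_path hc i 1 (by simp)
  refine ⟨γ.trans (generatorLoop G i), Γ.trans Δ, rfl, fun t => ?_⟩
  rw [Path.trans_apply, Path.trans_apply]
  split_ifs
  · exact hΓ _
  · refine Subtype.ext ?_
    rw [hΔ, mul_one]
    rfl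

lemma LiftsTo.append_inv {g : FundamentalGroup (salvetti G : Set (Torus V)) (salvettiBase G)}
    {c : Itinerary G} (h : LiftsTo g c) (i : V) :
    LiftsTo ((generatorClass G i)⁻¹ * g)
      (c.append (c.isInt_of_toSalvetti h.toSalvetti_eq) i (-1) (by simp)) := by
  have hc := h.toSalvetti_eq
  obtain ⟨γ, Γ, rfl, hΓ⟩ := h
  obtain ⟨Δ, hΔ⟩ := exists_append_path hc i (-1) (by simp)
  refine ⟨γ.trans (generatorLoop G i).symm, Γ.trans Δ, rfl, fun t => ?_⟩
  rw [Path.trans_apply, Path.trans_apply]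
  split_ifs
  · exact hΓ _
  · refine Subtype.ext ?_
    rw [hΔ]
    change Pi.single i _ = Pi.single i _
    congr 1
    rw [← sub_eq_zero, ← AddCircle.coe_sub, coe_eq_zero_iff_isInt]
    refine ⟨-1, ?_⟩
    simp

/-- Commuting generators can be appended in either order, with the same resulting itinerary. -/
lemma commute_generatorClass {i j : V} (h : G.Adj i j) :
    Commute (generatorClass G i) (generatorClass G j) := by
  have h1 := (liftsTo_one (G := G)).append j |>.append i
  have h2 := (liftsTo_one (G := G)).append i |>.append j
  have hone : ∀ a b : FundamentalGroup (salvetti G : Set (Torus V)) (salvettiBase G),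
      a * (b * 1) = a * b := fun a b => by rw [mul_one]
  rw [hone] at h1 h2
  refine LiftsTo.unique_left (c := _) h1 ?_
  convert h2 using 1
  have key : ∀ i j, G.Adj i j → ∀ k l, appendMove G (appendMove G (0 : ℕ → V → ℝ) (Pi.single j 1))
      (Pi.single i 1) k l = if k = 0 then (Pi.single j 1 + Pi.single i 1 : V → ℝ) l else 0 := by
    intro i j h k l
    have ha : ∀ k l, appendMove G (0 : ℕ → V → ℝ) (Pi.single j 1) k l =
        if k = 0 then (Pi.single j 1 : V → ℝ) l else 0 := by
      intro k l
      rw [appendMove, appendTime_eq_zero (c := 0) fun k j h0 => absurd rfl h0, Pi.zero_apply,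
        Pi.zero_apply, zero_add]
    have hsupp : ∀ k l, appendMove G (0 : ℕ → V → ℝ) (Pi.single j 1) k l ≠ 0 → l = j := by
      intro k l h0
      rw [ha] at h0
      by_contra hl
      simp [hl] at h0
    by_cases hl : l = i
    · subst hl
      rw [appendMove, appendTime_eq_zero fun k m h0 => by rwa [hsupp k m h0], ha]
      split_ifs <;> simp
    · rw [appendMove_of_eq_zero (by simp [hl]), ha]
      simp [hl]
  refine Subtype.ext ?_
  ext k l
  exact (key i j h k l).trans (by rw [add_comm]; exact (key j i h.symm k l).symm)

/-- The homomorphism from the right-angled Artin group to the fundamental group. -/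
def raagToFundamentalGroup (G : SimpleGraph V) :
    RAAG G →* FundamentalGroup (salvetti G : Set (Torus V)) (salvettiBase G) :=
  PresentedGroup.toGroup (f := generatorClass G) (by
    rintro _ ⟨s, t, hst, rfl⟩
    simp only [map_mul, map_inv, FreeGroup.lift_apply_of]
    rw [(commute_generatorClass hst).eq]
    group)

lemma raagToFundamentalGroup_of (i : V) :
    raagToFundamentalGroup G (PresentedGroup.of i) = generatorClass G i :=
  PresentedGroup.toGroup.of _

/-- The lift of the loop of a group element ends in an itinerary that spells the element. -/
lemma exists_liftsTo_spells (g : RAAG G) :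
    ∃ c : Itinerary G, LiftsTo (raagToFundamentalGroup G g) c ∧ Spells G c.1 g := by
  have hg : g ∈ Subgroup.closure (Set.range (PresentedGroup.of : V → RAAG G)) := by
    rw [PresentedGroup.closure_range_of]
    exact Subgroup.mem_top g
  induction hg using Subgroup.closure_induction_left with
  | one => exact ⟨Itinerary.start, by rw [map_one]; exact liftsTo_one, spells_zero⟩
  | mul_left x hx y hy ih =>
    obtain ⟨i, rfl⟩ := hx
    obtain ⟨c, hc, hs⟩ := ih
    refine ⟨_, by rw [map_mul, raagToFundamentalGroup_of]; exact hc.append i, ?_⟩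
    have := hs.appendMove c.2 i 1
    rwa [zpow_one, Int.cast_one] at this
  | inv_mul_cancel x hx y hy ih =>
    obtain ⟨i, rfl⟩ := hx
    obtain ⟨c, hc, hs⟩ := ih
    refine ⟨_, by rw [map_mul, map_inv, raagToFundamentalGroup_of]; exact hc.append_inv i, ?_⟩
    have := hs.appendMove c.2 i (-1)
    rwa [zpow_neg_one, Int.cast_neg, Int.cast_one] at this

/-- Every itinerary of full steps is the end of the lift of a product of generating loops. -/
lemma exists_liftsTo_of_isInt (n : ℕ) (c : Itinerary G) (hc : ∀ k i, IsInt (c.1 k i))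
    (hn : {p : ℕ × V | c.1 p.1 p.2 ≠ 0}.ncard = n) :
    ∃ g : RAAG G, LiftsTo (raagToFundamentalGroup G g) c := by
  have hfin : ∀ c : Itinerary G, {p : ℕ × V | c.1 p.1 p.2 ≠ 0}.Finite := by
    intro c
    obtain ⟨N, hN⟩ := c.2.finite
    refine ((Set.finite_lt_nat N).prod (Set.finite_univ (α := V))).subset fun p hp => ?_
    refine ⟨?_, trivial⟩
    by_contra h'
    exact hp (hN _ (not_lt.1 h') _)
  induction n generalizing c with
  | zero =>
    have hempty := (Set.ncard_eq_zero (hfin c)).1 hn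
    have h0 : c = Itinerary.start := by
      refine Subtype.ext ?_
      ext k i
      by_contra h'
      have hmem : (k, i) ∈ {p : ℕ × V | c.1 p.1 p.2 ≠ 0} := h'
      rw [hempty] at hmem
      exact hmem
    subst h0
    exact ⟨1, by rw [map_one]; exact liftsTo_one⟩
  | succ n ih =>
    have hne : {p : ℕ × V | c.1 p.1 p.2 ≠ 0}.Nonempty := by
      rw [← Set.ncard_pos (hfin c)]
      omega
    obtain ⟨⟨m, i⟩, hmi, hmax⟩ := Set.exists_max_image _ Prod.fst (hfin c) hne
    have hlast : ∀ k, m < k → ∀ j, c.1 k j = 0 := by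
      intro k hk j
      by_contra h'
      exact absurd (hmax (k, j) h') (not_le.2 hk)
    obtain ⟨d, hd, hr, hcd, hd0, hsame⟩ := Itinerary.exists_eq_append hc hmi hlast
    have hset : {p : ℕ × V | d.1 p.1 p.2 ≠ 0} = {p : ℕ × V | c.1 p.1 p.2 ≠ 0} \ {(m, i)} := by
      ext ⟨k, j⟩
      simp only [Set.mem_ofPred_eq, Set.mem_sdiff, Set.mem_singleton_iff, Prod.mk.injEq]
      by_cases h : k = m ∧ j = i
      · obtain ⟨rfl, rfl⟩ := h
        simp [hd0]
      · simp [h, hsame k j h]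
    have hcard : {p : ℕ × V | d.1 p.1 p.2 ≠ 0}.ncard = n := by
      rw [hset, Set.ncard_sdiff_singleton_of_mem hmi, hn]
      rfl
    obtain ⟨g, hg⟩ := ih d hd hcard
    have h1 : |c.1 m i| = 1 := le_antisymm hr ((hc m i).one_le_abs hmi)
    rcases eq_or_eq_neg_of_abs_eq h1 with h1 | h1
    · refine ⟨PresentedGroup.of i * g, ?_⟩
      rw [map_mul, raagToFundamentalGroup_of]
      simp only [h1] at hcd
      rw [hcd]
      exact hg.append i
    · refine ⟨(PresentedGroup.of i)⁻¹ * g, ?_⟩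
      rw [map_mul, map_inv, raagToFundamentalGroup_of]
      simp only [h1] at hcd
      rw [hcd]
      exact hg.append_inv i

/-- An element in the kernel is spelled by the initial itinerary, so it is trivial; and each loop lifts
to a path that ends in an itinerary of full steps, so it is a product of generating loops. -/
theorem bijective_raagToFundamentalGroup :
    Function.Bijective (raagToFundamentalGroup G) := by
  refine ⟨(injective_iff_map_eq_one _).2 fun g hg => ?_, fun γ => ?_⟩
  · obtain ⟨c, hc, hs⟩ := exists_liftsTo_spells g
    rw [hg] at hc
    have := hc.unique_right liftsTo_one
    subst this
    exact hs.unique spells_zero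
  · obtain ⟨c, hc⟩ := exists_liftsTo γ
    obtain ⟨g, hg⟩ := exists_liftsTo_of_isInt _ c (c.isInt_of_toSalvetti hc.toSalvetti_eq) rfl
    exact ⟨g, hg.unique_left hc⟩

end FundamentalGroup

theorem isClassifyingSpace_salvetti {V : Type u} [Fintype V] (G : SimpleGraph V) :
    IsClassifyingSpace (RAAG G) (salvetti G : Set (Torus V)) := by
  classical
  have hpc : PathConnectedSpace (salvetti G : Set (Torus V)) := by
    rw [pathConnectedSpace_iff_univ, ← Itinerary.surjective_toSalvetti.range_eq]
    exact isPathConnected_range Itinerary.continuous_toSalvetti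
  refine ⟨hpc, fun x => ?_, fun k x hk => subsingleton_pi_salvetti hk x⟩
  exact ⟨(FundamentalGroup.fundamentalGroupMulEquivOfPathConnected x (salvettiBase G)).trans
    (MulEquiv.ofBijective _ bijective_raagToFundamentalGroup).symm⟩

/-! ### Collapsing the boundary of a cube to get a sphere -/

/-- The cube `[-1, 1]^N`, with boundary collapsed, is mapped to the sphere by the inverse of the
stereographic projection from the base point, after the homeomorphism `z ↦ z / (1 - ‖z‖)` of the
open cube with `ℝ^N`; with denominators cleared the formula makes sense on the boundary too. -/
def cubeToSphereFun {N : ℕ} (z : Fin N → ℝ) : Fin (N + 1) → ℝ :=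
  Fin.cons ((∑ i, z i ^ 2 - (1 - ‖z‖) ^ 2) / (∑ i, z i ^ 2 + (1 - ‖z‖) ^ 2))
    fun i => 2 * (1 - ‖z‖) * z i / (∑ i, z i ^ 2 + (1 - ‖z‖) ^ 2)

lemma cubeToSphere_denom_pos {N : ℕ} (z : Fin N → ℝ) : 0 < ∑ i, z i ^ 2 + (1 - ‖z‖) ^ 2 := by
  have h1 : 0 ≤ ∑ i, z i ^ 2 := Finset.sum_nonneg fun i _ => sq_nonneg _
  by_contra hcon
  have h2 := sq_nonneg (1 - ‖z‖)
  have h3 : ∑ i, z i ^ 2 = 0 := by linarith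
  have hz : z = 0 := by
    ext i
    have := (Finset.sum_eq_zero_iff_of_nonneg fun i _ => sq_nonneg (z i)).1 h3 i (Finset.mem_univ i)
    simpa using this
  subst hz
  norm_num at hcon

/-- The map that collapses the boundary of the cube `[-1, 1]^N` to the base point of the sphere. -/
def cubeToSphere {N : ℕ} (z : Fin N → ℝ) : StdSphere N :=
  ⟨WithLp.toLp 2 (cubeToSphereFun z), by
    rw [mem_sphere_zero_iff_norm, EuclideanSpace.norm_eq, Real.sqrt_eq_one]
    have hD := cubeToSphere_denom_pos z
    simp only [Real.norm_eq_abs, sq_abs, Fin.sum_univ_succ, cubeToSphereFun, Fin.cons_zero,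
      Fin.cons_succ]
    simp only [div_pow, mul_pow, ← Finset.sum_div, ← Finset.mul_sum]
    rw [← add_div, div_eq_one_iff_eq (by positivity)]
    ring⟩

lemma cubeToSphere_zero {N : ℕ} (z : Fin N → ℝ) : (cubeToSphere z).1 0 =
    (∑ i, z i ^ 2 - (1 - ‖z‖) ^ 2) / (∑ i, z i ^ 2 + (1 - ‖z‖) ^ 2) := rfl

lemma cubeToSphere_succ {N : ℕ} (z : Fin N → ℝ) (i : Fin N) : (cubeToSphere z).1 i.succ =
    2 * (1 - ‖z‖) * z i / (∑ i, z i ^ 2 + (1 - ‖z‖) ^ 2) := rfl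

lemma continuous_cubeToSphere {N : ℕ} : Continuous (cubeToSphere (N := N)) := by
  refine Continuous.subtype_mk ((PiLp.continuous_toLp 2 _).comp (continuous_pi fun i => ?_)) _
  refine Fin.cases ?_ (fun i => ?_) i
  · simp only [cubeToSphereFun, Fin.cons_zero]
    exact Continuous.div (by fun_prop) (by fun_prop) fun z => (cubeToSphere_denom_pos z).ne'
  · simp only [cubeToSphereFun, Fin.cons_succ]
    exact Continuous.div (by fun_prop) (by fun_prop) fun z => (cubeToSphere_denom_pos z).ne'

lemma StdSphere.ext_coord {N : ℕ} {a b : StdSphere N} (h0 : a.1 0 = b.1 0)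
    (h : ∀ i : Fin N, a.1 i.succ = b.1 i.succ) : a = b := by
  refine Subtype.ext ?_
  ext i
  exact Fin.cases h0 h i

lemma StdSphere.sum_sq {N : ℕ} (a : StdSphere N) : a.1 0 ^ 2 + ∑ i : Fin N, a.1 i.succ ^ 2 = 1 := by
  have h := a.2
  rw [mem_sphere_zero_iff_norm, EuclideanSpace.norm_eq, Real.sqrt_eq_one, Fin.sum_univ_succ] at h
  simpa only [Real.norm_eq_abs, sq_abs] using h

lemma StdSphere.eq_base_iff {N : ℕ} {a : StdSphere N} : a = StdSphere.base N ↔ a.1 0 = 1 := by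
  constructor
  · rintro rfl
    simp [StdSphere.base]
  · intro h
    have hs := a.sum_sq
    rw [h] at hs
    have h0 : ∑ i : Fin N, a.1 i.succ ^ 2 = 0 := by linarith
    refine StdSphere.ext_coord (by simp [StdSphere.base, h]) fun i => ?_
    have := (Finset.sum_eq_zero_iff_of_nonneg fun i _ => sq_nonneg (a.1 (Fin.succ i))).1 h0 i
      (Finset.mem_univ i)
    simp only [StdSphere.base]
    simpa using this

lemma cubeToSphere_eq_base_iff {N : ℕ} {z : Fin N → ℝ} :
    cubeToSphere z = StdSphere.base N ↔ ‖z‖ = 1 := by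
  rw [StdSphere.eq_base_iff, cubeToSphere_zero, div_eq_one_iff_eq (cubeToSphere_denom_pos z).ne']
  constructor
  · intro h
    have : (1 - ‖z‖) ^ 2 = 0 := by linarith
    have := pow_eq_zero_iff (two_ne_zero) |>.1 this
    linarith
  · intro h
    rw [h]
    ring

/-- The stereographic projection recovers `z / (1 - ‖z‖)`. -/
lemma stereographic_cubeToSphere {N : ℕ} {z : Fin N → ℝ} (hz : ‖z‖ < 1) (i : Fin N) :
    (cubeToSphere z).1 i.succ / (1 - (cubeToSphere z).1 0) = z i / (1 - ‖z‖) := by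
  have hD := cubeToSphere_denom_pos z
  have hw : 0 < 1 - ‖z‖ := by linarith
  have h1 : 1 - (cubeToSphere z).1 0 =
      2 * (1 - ‖z‖) ^ 2 / (∑ i, z i ^ 2 + (1 - ‖z‖) ^ 2) := by
    rw [cubeToSphere_zero, eq_div_iff hD.ne', sub_mul, div_mul_cancel₀ _ hD.ne']
    ring
  rw [h1, cubeToSphere_succ, div_div_div_cancel_right₀ hD.ne', div_eq_div_iff (by positivity) hw.ne']
  ring

lemma cubeToSphere_injOn {N : ℕ} : InjOn (cubeToSphere (N := N)) (ball 0 1) := by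
  intro z hz z' hz' h
  rw [mem_ball_zero_iff] at hz hz'
  have hv : (1 / (1 - ‖z‖)) • z = (1 / (1 - ‖z'‖)) • z' := by
    ext i
    have h1 := stereographic_cubeToSphere hz i
    have h2 := stereographic_cubeToSphere hz' i
    rw [h] at h1
    simp only [Pi.smul_apply, smul_eq_mul, one_div_mul_eq_div]
    rw [← h1, h2]
  have hw : 0 < 1 - ‖z‖ := by linarith
  have hw' : 0 < 1 - ‖z'‖ := by linarith
  have hn := congrArg norm hv
  rw [norm_smul, norm_smul, Real.norm_of_nonneg (by positivity), Real.norm_of_nonneg (by positivity),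
    one_div_mul_eq_div, one_div_mul_eq_div, div_eq_div_iff hw.ne' hw'.ne'] at hn
  have hnorm : ‖z‖ = ‖z'‖ := by linarith
  rw [hnorm] at hv
  exact smul_right_injective _ (by positivity : (1 / (1 - ‖z'‖)) ≠ 0) hv

lemma cubeToSphere_surjOn {N : ℕ} :
    SurjOn (cubeToSphere (N := N)) (ball 0 1) {StdSphere.base N}ᶜ := by
  intro a ha
  have ha0 : a.1 0 ≠ 1 := fun h => ha (StdSphere.eq_base_iff.2 h)
  have hs := a.sum_sq
  have hb : 0 ≤ ∑ i : Fin N, a.1 i.succ ^ 2 := Finset.sum_nonneg fun i _ => sq_nonneg _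
  have ha1 : 0 < 1 - a.1 0 := by
    have : a.1 0 ≤ 1 := by nlinarith
    exact sub_pos.2 (lt_of_le_of_ne this ha0)
  let v : Fin N → ℝ := fun i => a.1 i.succ / (1 - a.1 0)
  have hv : 0 < 1 + ‖v‖ := by positivity
  let z : Fin N → ℝ := (1 / (1 + ‖v‖)) • v
  have hz : ‖z‖ = ‖v‖ / (1 + ‖v‖) := by
    rw [norm_smul, Real.norm_of_nonneg (by positivity), one_div_mul_eq_div]
  have hw : 1 - ‖z‖ = 1 / (1 + ‖v‖) := by
    rw [hz, eq_div_iff hv.ne', sub_mul, div_mul_cancel₀ _ hv.ne']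
    ring
  have hw0 : 0 < 1 - ‖z‖ := by
    rw [hw]
    positivity
  have hzi : ∀ i, z i = (1 - ‖z‖) * (a.1 i.succ / (1 - a.1 0)) := fun i => by
    rw [hw]
    rfl
  have hsum : ∑ i, z i ^ 2 = (1 - ‖z‖) ^ 2 * ((1 + a.1 0) / (1 - a.1 0)) := by
    have : ∀ i, z i ^ 2 = (1 - ‖z‖) ^ 2 / (1 - a.1 0) ^ 2 * a.1 i.succ ^ 2 := fun i => by
      rw [hzi i, mul_pow, div_pow]
      ring
    rw [Finset.sum_congr rfl fun i _ => this i, ← Finset.mul_sum,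
      show ∑ i : Fin N, a.1 i.succ ^ 2 = (1 + a.1 0) * (1 - a.1 0) by linarith]
    field_simp
  have hD : ∑ i, z i ^ 2 + (1 - ‖z‖) ^ 2 = (1 - ‖z‖) ^ 2 * (2 / (1 - a.1 0)) := by
    rw [hsum]
    field_simp
    ring
  refine ⟨z, ?_, StdSphere.ext_coord ?_ fun i => ?_⟩
  · rw [mem_ball_zero_iff]
    linarith
  · rw [cubeToSphere_zero, hD, hsum]
    field_simp
    ring
  · rw [cubeToSphere_succ, hD, hzi i]
    field_simp

section Cell

variable {m ℓ : ℕ}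

/-- The coordinates in `[-1, 1]^(m + ℓ)` of a point of `[-1, 1]^m × I^ℓ`. -/
def diskCoord (y : Fin m → ℝ) (t : Fin ℓ → unitInterval) : Fin (m + ℓ) → ℝ :=
  Fin.append y fun j => 2 * (t j : ℝ) - 1

lemma continuous_diskCoord :
    Continuous fun p : (Fin m → ℝ) × (Fin ℓ → unitInterval) => diskCoord p.1 p.2 := by
  refine continuous_pi fun i => ?_
  refine Fin.addCases (fun i => ?_) (fun i => ?_) i
  · simp only [diskCoord, Fin.append_left]
    fun_prop
  · simp only [diskCoord, Fin.append_right]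
    fun_prop

lemma norm_diskCoord_lt_iff {y : Fin m → ℝ} {t : Fin ℓ → unitInterval} :
    ‖diskCoord y t‖ < 1 ↔ ‖y‖ < 1 ∧ t ∉ Cube.boundary (Fin ℓ) := by
  rw [pi_norm_lt_iff one_pos, pi_norm_lt_iff one_pos, Fin.forall_fin_add]
  simp only [diskCoord, Fin.append_left, Fin.append_right, Real.norm_eq_abs]
  refine and_congr_right fun _ => ?_
  simp only [Cube.boundary, mem_ofPred_eq, not_exists, not_or]
  refine forall_congr' fun j => ?_
  rw [abs_lt]
  constructor
  · rintro ⟨h0, h1⟩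
    constructor
    · intro h
      rw [h] at h0
      norm_num at h0
    · intro h
      rw [h] at h1
      norm_num at h1
  · rintro ⟨h0, h1⟩
    have h0' := lt_of_le_of_ne (t j).2.1 fun h => h0 (Subtype.ext h.symm)
    have h1' := lt_of_le_of_ne (t j).2.2 fun h => h1 (Subtype.ext h)
    constructor <;> linarith

lemma norm_diskCoord_le {y : Fin m → ℝ} (hy : ‖y‖ ≤ 1) (t : Fin ℓ → unitInterval) :
    ‖diskCoord y t‖ ≤ 1 := by
  rw [pi_norm_le_iff_of_nonneg zero_le_one, Fin.forall_fin_add]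
  simp only [diskCoord, Fin.append_left, Fin.append_right, Real.norm_eq_abs]
  refine ⟨fun i => (norm_le_pi_norm y i).trans hy, fun j => ?_⟩
  have h0 := (t j).2.1
  have h1 := (t j).2.2
  exact abs_le.2 ⟨by linarith, by linarith⟩

/-- The collapse of the boundary of `[-1, 1]^m × I^ℓ`. -/
def diskToSphere (y : Fin m → ℝ) (t : Fin ℓ → unitInterval) : StdSphere (m + ℓ) :=
  cubeToSphere (diskCoord y t)

lemma continuous_diskToSphere :
    Continuous fun p : (Fin m → ℝ) × (Fin ℓ → unitInterval) => diskToSphere p.1 p.2 :=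
  continuous_cubeToSphere.comp continuous_diskCoord

lemma diskToSphere_eq_base_iff {y : Fin m → ℝ} (hy : ‖y‖ ≤ 1) {t : Fin ℓ → unitInterval} :
    diskToSphere y t = StdSphere.base (m + ℓ) ↔ ‖y‖ = 1 ∨ t ∈ Cube.boundary (Fin ℓ) := by
  rw [diskToSphere, cubeToSphere_eq_base_iff]
  have h1 := norm_diskCoord_le hy t
  have h2 := norm_diskCoord_lt_iff (y := y) (t := t)
  constructor
  · intro h
    by_contra! hcon
    have := h2.2 ⟨lt_of_le_of_ne hy hcon.1, hcon.2⟩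
    linarith
  · intro h
    by_contra hcon
    have := h2.1 (lt_of_le_of_ne h1 hcon)
    rcases h with h | h
    · linarith [this.1]
    · exact this.2 h

lemma diskCoord_injective {y y' : Fin m → ℝ} {t t' : Fin ℓ → unitInterval}
    (h : diskCoord y t = diskCoord y' t') : y = y' ∧ t = t' := by
  constructor
  · ext i
    have := congrFun h (Fin.castAdd ℓ i)
    simpa [diskCoord] using this
  · ext j
    have := congrFun h (Fin.natAdd m j)
    simpa [diskCoord] using this

lemma diskToSphere_injective {y y' : Fin m → ℝ} {t t' : Fin ℓ → unitInterval} (hy : ‖y‖ < 1)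
    (hy' : ‖y'‖ < 1) (ht : t ∉ Cube.boundary (Fin ℓ)) (ht' : t' ∉ Cube.boundary (Fin ℓ))
    (h : diskToSphere y t = diskToSphere y' t') : y = y' ∧ t = t' := by
  refine diskCoord_injective (cubeToSphere_injOn ?_ ?_ h)
  · exact mem_ball_zero_iff.2 (norm_diskCoord_lt_iff.2 ⟨hy, ht⟩)
  · exact mem_ball_zero_iff.2 (norm_diskCoord_lt_iff.2 ⟨hy', ht'⟩)

lemma exists_diskToSphere {a : StdSphere (m + ℓ)} (ha : a ≠ StdSphere.base (m + ℓ)) :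
    ∃ (y : Fin m → ℝ) (t : Fin ℓ → unitInterval), ‖y‖ < 1 ∧ t ∉ Cube.boundary (Fin ℓ) ∧
      diskToSphere y t = a := by
  obtain ⟨z, hz, rfl⟩ := cubeToSphere_surjOn ha
  rw [mem_ball_zero_iff] at hz
  have hz' : ∀ i, |z i| ≤ 1 := fun i => (norm_le_pi_norm z i).trans hz.le
  let y : Fin m → ℝ := fun i => z (Fin.castAdd ℓ i)
  let t : Fin ℓ → unitInterval := fun j => ⟨(z (Fin.natAdd m j) + 1) / 2, by
    have := abs_le.1 (hz' (Fin.natAdd m j))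
    constructor <;> linarith⟩
  have hyt : diskCoord y t = z := by
    ext i
    refine Fin.addCases (fun i => ?_) (fun j => ?_) i
    · simp [diskCoord, y]
    · simp only [diskCoord, Fin.append_right, t]
      ring
  have hlt := norm_diskCoord_lt_iff.1 (hyt.symm ▸ hz : ‖diskCoord y t‖ < 1)
  exact ⟨y, t, hlt.1, hlt.2, by rw [diskToSphere, hyt]⟩

/-! ### Collapsing the fat wedge of a suspended torus -/

/-- The coordinates in `[-1, 1)` of a point of the torus. -/
def torusCoord (x : Fin m → UnitAddCircle) (k : Fin m) : ℝ :=
  2 * (AddCircle.equivIco (1 : ℝ) 0 (x k) : ℝ) - 1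

lemma coe_torusCoord (x : Fin m → UnitAddCircle) (k : Fin m) :
    (((torusCoord x k + 1) / 2 : ℝ) : UnitAddCircle) = x k := by
  rw [torusCoord, show ∀ a : ℝ, (2 * a - 1 + 1) / 2 = a from fun a => by ring]
  exact AddCircle.coe_equivIco

lemma norm_torusCoord_le (x : Fin m → UnitAddCircle) : ‖torusCoord x‖ ≤ 1 := by
  rw [pi_norm_le_iff_of_nonneg zero_le_one]
  intro k
  have h := (AddCircle.equivIco (1 : ℝ) 0 (x k)).2
  have h0 := h.1
  have h1 : (AddCircle.equivIco (1 : ℝ) 0 (x k) : ℝ) < 0 + 1 := h.2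
  rw [Real.norm_eq_abs, torusCoord]
  exact abs_le.2 ⟨by linarith, by linarith⟩

lemma coe_half_eq_zero_iff {r : ℝ} (hr : |r| ≤ 1) :
    (((r + 1) / 2 : ℝ) : UnitAddCircle) = 0 ↔ |r| = 1 := by
  refine ⟨fun h => ?_, Torus.coe_eq_zero_of_abs_one⟩
  by_contra hne
  have := abs_lt.1 (lt_of_le_of_ne hr hne)
  exact Torus.coe_ne_zero (by linarith) (by linarith) h

lemma norm_eq_one_iff_exists {y : Fin m → ℝ} (hy : ‖y‖ ≤ 1) :
    ‖y‖ = 1 ↔ ∃ k, (((y k + 1) / 2 : ℝ) : UnitAddCircle) = 0 := by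
  have hk : ∀ k, |y k| ≤ 1 := fun k => (norm_le_pi_norm y k).trans hy
  simp only [coe_half_eq_zero_iff (hk _)]
  constructor
  · intro h
    by_contra! hcon
    have : ‖y‖ < 1 := (pi_norm_lt_iff one_pos).2 fun k => lt_of_le_of_ne (hk k) (hcon k)
    linarith
  · rintro ⟨k, h⟩
    exact le_antisymm hy (h ▸ norm_le_pi_norm y k)

/-- The collapse of the `ℓ`-fold suspension of the `m`-torus to the sphere `S^(m + ℓ)`. -/
def torusToSphere (x : Fin m → UnitAddCircle) (t : Fin ℓ → unitInterval) : StdSphere (m + ℓ) :=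
  diskToSphere (torusCoord x) t

lemma torusToSphere_coe {y : Fin m → ℝ} (hy : ‖y‖ ≤ 1) (t : Fin ℓ → unitInterval) :
    torusToSphere (fun k => (((y k + 1) / 2 : ℝ) : UnitAddCircle)) t = diskToSphere y t := by
  set x : Fin m → UnitAddCircle := fun k => (((y k + 1) / 2 : ℝ) : UnitAddCircle) with hx
  by_cases h1 : ‖y‖ = 1
  · have h2 : ‖torusCoord x‖ = 1 := by
      rw [norm_eq_one_iff_exists (norm_torusCoord_le x)]
      simpa only [coe_torusCoord] using (norm_eq_one_iff_exists hy).1 h1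
    rw [torusToSphere, (diskToSphere_eq_base_iff (norm_torusCoord_le x)).2 (Or.inl h2),
      (diskToSphere_eq_base_iff hy).2 (Or.inl h1)]
  · have hlt := (pi_norm_lt_iff one_pos).1 (lt_of_le_of_ne hy h1)
    have : torusCoord x = y := by
      ext k
      have := abs_lt.1 (hlt k)
      rw [torusCoord, hx, AddCircle.equivIco_coe_of_mem]
      · ring
      · constructor <;> linarith
    rw [torusToSphere, this]

lemma torusToSphere_eq_base_iff {x : Fin m → UnitAddCircle} {t : Fin ℓ → unitInterval} :
    torusToSphere x t = StdSphere.base (m + ℓ) ↔ (∃ k, x k = 0) ∨ t ∈ Cube.boundary (Fin ℓ) := by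
  rw [torusToSphere, diskToSphere_eq_base_iff (norm_torusCoord_le x),
    norm_eq_one_iff_exists (norm_torusCoord_le x)]
  simp only [coe_torusCoord]

/-- The characteristic map of the suspended torus. -/
lemma isQuotientMap_diskToTorus : IsQuotientMap
    (fun p : closedBall (0 : Fin m → ℝ) 1 × (Fin ℓ → unitInterval) =>
      ((fun k => (((p.1.1 k + 1) / 2 : ℝ) : UnitAddCircle), p.2) :
        (Fin m → UnitAddCircle) × (Fin ℓ → unitInterval))) := by
  have : CompactSpace (closedBall (0 : Fin m → ℝ) 1) :=
    isCompact_iff_compactSpace.1 (isCompact_closedBall _ _)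
  refine Topology.IsQuotientMap.of_surjective_continuous ?_ ?_
  · rintro ⟨x, t⟩
    refine ⟨(⟨torusCoord x, mem_closedBall_zero_iff.2 (norm_torusCoord_le x)⟩, t), ?_⟩
    simp only [coe_torusCoord]
  · refine Continuous.prodMk (continuous_pi fun k => ?_) continuous_snd
    refine (AddCircle.continuous_mk' (1 : ℝ)).comp ?_
    have : Continuous fun p : closedBall (0 : Fin m → ℝ) 1 × (Fin ℓ → unitInterval) => p.1.1 k :=
      (continuous_apply k).comp (continuous_subtype_val.comp continuous_fst)
    fun_prop

lemma continuous_torusToSphere : Continuous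
    fun p : (Fin m → UnitAddCircle) × (Fin ℓ → unitInterval) => torusToSphere p.1 p.2 := by
  rw [isQuotientMap_diskToTorus.continuous_iff]
  have : Continuous fun p : closedBall (0 : Fin m → ℝ) 1 × (Fin ℓ → unitInterval) =>
      diskToSphere p.1.1 p.2 :=
    (continuous_diskToSphere (m := m) (ℓ := ℓ)).comp
      (g := fun q : (Fin m → ℝ) × (Fin ℓ → unitInterval) => diskToSphere q.1 q.2)
      (f := fun p : closedBall (0 : Fin m → ℝ) 1 × (Fin ℓ → unitInterval) => (p.1.1, p.2))
      ((continuous_subtype_val.comp continuous_fst).prodMk continuous_snd)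
  refine this.congr fun p => ?_
  exact (torusToSphere_coe (mem_closedBall_zero_iff.1 p.1.2) p.2).symm

lemma torusToSphere_injective {x x' : Fin m → UnitAddCircle} {t t' : Fin ℓ → unitInterval}
    (h : torusToSphere x t = torusToSphere x' t') (hb : torusToSphere x t ≠ StdSphere.base (m + ℓ)) :
    x = x' ∧ t = t' := by
  have hb' := h ▸ hb
  have key : ∀ {x : Fin m → UnitAddCircle} {t : Fin ℓ → unitInterval},
      torusToSphere x t ≠ StdSphere.base (m + ℓ) → ‖torusCoord x‖ < 1 ∧ t ∉ Cube.boundary (Fin ℓ) := by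
    intro x t hb
    rw [torusToSphere, Ne, diskToSphere_eq_base_iff (norm_torusCoord_le x), not_or] at hb
    exact ⟨lt_of_le_of_ne (norm_torusCoord_le x) hb.1, hb.2⟩
  obtain ⟨h1, h2⟩ := diskToSphere_injective (key hb).1 (key hb').1 (key hb).2 (key hb').2 h
  refine ⟨funext fun k => ?_, h2⟩
  exact (coe_torusCoord x k).symm.trans (by rw [h1]; exact coe_torusCoord x' k)

lemma torusToSphere_surjective (hN : 0 < m + ℓ) (a : StdSphere (m + ℓ)) :
    ∃ (x : Fin m → UnitAddCircle) (t : Fin ℓ → unitInterval), torusToSphere x t = a := by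
  by_cases ha : a = StdSphere.base (m + ℓ)
  · by_cases hm : 0 < m
    · exact ⟨0, 0, (torusToSphere_eq_base_iff.2 (Or.inl ⟨⟨0, hm⟩, rfl⟩)).trans ha.symm⟩
    · have hl : 0 < ℓ := by omega
      exact ⟨0, 0, (torusToSphere_eq_base_iff.2 (Or.inr ⟨⟨0, hl⟩, Or.inl rfl⟩)).trans ha.symm⟩
  · obtain ⟨y, t, hy, -, h⟩ := exists_diskToSphere ha
    exact ⟨_, t, (torusToSphere_coe hy.le t).trans h⟩

/-- Maps that are constant on the fat wedge of the suspended torus factor through the sphere. -/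
lemma exists_sphere_lift (hN : 0 < m + ℓ) {Z : Type*} [TopologicalSpace Z] {z : Z}
    (φ : C((Fin m → UnitAddCircle) × (Fin ℓ → unitInterval), Z))
    (h0 : ∀ x t, (∃ k, x k = 0) → φ (x, t) = z)
    (h1 : ∀ x, ∀ t ∈ Cube.boundary (Fin ℓ), φ (x, t) = z) :
    ∃ b : C(StdSphere (m + ℓ), Z), b (StdSphere.base _) = z ∧
      ∀ x t, b (torusToSphere x t) = φ (x, t) := by
  have hsurj : Function.Surjective
      fun p : (Fin m → UnitAddCircle) × (Fin ℓ → unitInterval) => torusToSphere p.1 p.2 := fun a =>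
    let ⟨x, t, h⟩ := torusToSphere_surjective hN a
    ⟨(x, t), h⟩
  have hq := Topology.IsQuotientMap.of_surjective_continuous hsurj continuous_torusToSphere
  have hbase : ∀ p : (Fin m → UnitAddCircle) × (Fin ℓ → unitInterval),
      torusToSphere p.1 p.2 = StdSphere.base (m + ℓ) → φ p = z := by
    rintro ⟨x, t⟩ h
    rcases torusToSphere_eq_base_iff.1 h with h | h
    · exact h0 x t h
    · exact h1 x t h
  have hfac : Function.FactorsThrough φ
      fun p : (Fin m → UnitAddCircle) × (Fin ℓ → unitInterval) => torusToSphere p.1 p.2 := by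
    intro p p' h
    by_cases hb : torusToSphere p.1 p.2 = StdSphere.base (m + ℓ)
    · rw [hbase p hb, hbase p' (h.symm.trans hb)]
    · obtain ⟨h1, h2⟩ := torusToSphere_injective h hb
      rw [Prod.ext h1 h2]
  let b : C(StdSphere (m + ℓ), Z) :=
    Topology.IsQuotientMap.lift (f := ⟨_, continuous_torusToSphere⟩) hq φ hfac
  have hb : ∀ p : (Fin m → UnitAddCircle) × (Fin ℓ → unitInterval),
      b (torusToSphere p.1 p.2) = φ p := fun p => DFunLike.congr_fun
    (Topology.IsQuotientMap.lift_comp (f := ⟨_, continuous_torusToSphere⟩) hq φ hfac) p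
  refine ⟨b, ?_, fun x t => hb (x, t)⟩
  obtain ⟨p, hp⟩ := hsurj (StdSphere.base (m + ℓ))
  rw [← hp]
  exact (hb p).trans (hbase p hp)

-- Beyond this point both collapses are accessed through the lemmas above only.
attribute [irreducible] diskToSphere torusToSphere

end Cell

/-! ### Homotopy groups and split fibrations -/

section HomotopyGroupMap

variable {N : Type*} {X Y Z : Type*} [TopologicalSpace X] [TopologicalSpace Y] [TopologicalSpace Z]
  {x : X} {y : Y} {z : Z}

/-- The image of a `GenLoop` under a pointed map. -/
def GenLoop.map (f : C(X, Y)) (hf : f x = y) (p : GenLoop N X x) : GenLoop N Y y :=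
  ⟨f.comp p.1, fun t ht => (congrArg f (p.2 t ht)).trans hf⟩

/-- The class of a `GenLoop` in the homotopy group. -/
def HomotopyGroup.mk (p : GenLoop N X x) : HomotopyGroup N X x :=
  Quotient.mk (GenLoop.Homotopic.setoid N x) p

lemma HomotopyGroup.exists_mk (g : HomotopyGroup N X x) : ∃ p, g = HomotopyGroup.mk p :=
  let ⟨p, hp⟩ := Quotient.exists_rep g
  ⟨p, hp.symm⟩

lemma HomotopyGroup.mk_eq_mk_iff {p q : GenLoop N X x} :
    HomotopyGroup.mk p = HomotopyGroup.mk q ↔ ∃ H : C(unitInterval × (N → unitInterval), X),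
      (∀ t, H (0, t) = p t) ∧ (∀ t, H (1, t) = q t) ∧
        ∀ s, ∀ t ∈ Cube.boundary N, H (s, t) = x := by
  constructor
  · intro h
    obtain ⟨H⟩ : GenLoop.Homotopic p q := Quotient.exact h
    exact ⟨H.toContinuousMap, H.map_zero_left, H.map_one_left,
      fun s t ht => (H.eq_fst s ht).trans (p.2 t ht)⟩
  · rintro ⟨H, h0, h1, hb⟩
    refine Quotient.sound ⟨⟨⟨H, h0, h1⟩, fun s t ht => ?_⟩⟩
    exact (hb s t ht).trans (p.2 t ht).symm

variable [DecidableEq N] [Nonempty N]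

lemma HomotopyGroup.mk_mul_mk (i : N) (p q : GenLoop N X x) :
    HomotopyGroup.mk p * HomotopyGroup.mk q = HomotopyGroup.mk (GenLoop.transAt i q p) :=
  HomotopyGroup.mul_spec

lemma HomotopyGroup.mk_const :
    HomotopyGroup.mk (GenLoop.const : GenLoop N X x) = 1 := rfl

/-- The homomorphism between homotopy groups that a pointed map induces. -/
def HomotopyGroup.map (f : C(X, Y)) (hf : f x = y) : HomotopyGroup N X x →* HomotopyGroup N Y y :=
  MonoidHom.mk'
    (Quotient.map' (s₁ := GenLoop.Homotopic.setoid N x) (s₂ := GenLoop.Homotopic.setoid N y)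
      (GenLoop.map f hf) fun _ _ h => h.comp_continuousMap f)
    (by
      intro a b
      obtain ⟨p, rfl⟩ := a.exists_mk
      obtain ⟨q, rfl⟩ := b.exists_mk
      rw [HomotopyGroup.mk_mul_mk (Classical.arbitrary N)]
      change HomotopyGroup.mk _ = HomotopyGroup.mk _ * HomotopyGroup.mk _
      rw [HomotopyGroup.mk_mul_mk (Classical.arbitrary N)]
      congr 1
      ext t
      change f (GenLoop.transAt _ _ _ t) = GenLoop.transAt _ _ _ t
      simp only [GenLoop.transAt, GenLoop.coe_copy]
      split_ifs <;> rfl)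

lemma HomotopyGroup.map_mk (f : C(X, Y)) (hf : f x = y) (p : GenLoop N X x) :
    HomotopyGroup.map f hf (HomotopyGroup.mk p) = HomotopyGroup.mk (GenLoop.map f hf p) := rfl

lemma HomotopyGroup.map_map (f : C(X, Y)) (hf : f x = y) (f' : C(Y, Z)) (hf' : f' y = z)
    (g : HomotopyGroup N X x) (h : C(X, Z)) (hh : h x = z) (hc : ∀ a, f' (f a) = h a) :
    HomotopyGroup.map f' hf' (HomotopyGroup.map f hf g) = HomotopyGroup.map h hh g := by
  obtain ⟨p, rfl⟩ := g.exists_mk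
  simp only [HomotopyGroup.map_mk]
  congr 1
  ext t
  exact hc _

lemma HomotopyGroup.map_map_of_leftInverse (f : C(X, Y)) (hf : f x = y) (f' : C(Y, X))
    (hf' : f' y = x) (g : HomotopyGroup N X x) (h : ∀ a, f' (f a) = a) :
    HomotopyGroup.map f' hf' (HomotopyGroup.map f hf g) = g := by
  obtain ⟨p, rfl⟩ := g.exists_mk
  simp only [HomotopyGroup.map_mk]
  congr 1
  ext t
  exact h _

lemma HomotopyGroup.map_map_of_const (f : C(X, Y)) (hf : f x = y) (f' : C(Y, Z)) (hf' : f' y = z)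
    (g : HomotopyGroup N X x) (h : ∀ a, f' (f a) = z) :
    HomotopyGroup.map f' hf' (HomotopyGroup.map f hf g) = 1 := by
  obtain ⟨p, rfl⟩ := g.exists_mk
  rw [← HomotopyGroup.mk_const]
  simp only [HomotopyGroup.map_mk]
  congr 1
  ext t
  exact h _

end HomotopyGroupMap

/-- A pointed map `p : E → B` with the homotopy lifting property, a section `s`, and an inclusion
`i : F → E` of the fibre over the base point. Only test spaces in `Type` occur, as the homotopy groups
concern maps from cubes. -/
structure SplitFibration {E B F : Type u} [TopologicalSpace E] [TopologicalSpace B]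
    [TopologicalSpace F] (e₀ : E) (b₀ : B) (f₀ : F) where
  /-- The projection. -/
  p : C(E, B)
  /-- The section. -/
  s : C(B, E)
  /-- The inclusion of the fibre. -/
  i : C(F, E)
  p_base : p e₀ = b₀
  s_base : s b₀ = e₀
  i_base : i f₀ = e₀
  p_s : ∀ b, p (s b) = b
  p_i : ∀ a, p (i a) = b₀
  i_injective : Function.Injective i
  /-- Maps into the fibre are continuous as maps to `F`. -/
  exists_fibre_lift : ∀ {Y : Type} [TopologicalSpace Y] (a : C(Y, E)), (∀ y, p (a y) = b₀) →
    ∃ a' : C(Y, F), ∀ y, i (a' y) = a y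
  /-- Homotopies lift, and points at which both the given map and the homotopy stay in the base point
  are kept in the base point. -/
  exists_homotopy_lift : ∀ {Y : Type} [TopologicalSpace Y] (a : C(Y, E))
    (D : C(unitInterval × Y, B)), (∀ y, D (0, y) = p (a y)) →
    ∃ H : C(unitInterval × Y, E), (∀ y, H (0, y) = a y) ∧ (∀ w y, p (H (w, y)) = D (w, y)) ∧
      ∀ y, a y = e₀ → (∀ w, D (w, y) = b₀) → ∀ w, H (w, y) = e₀

namespace SplitFibration

variable {N : Type} [DecidableEq N] [Nontrivial N] {E B F : Type u} [TopologicalSpace E]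
  [TopologicalSpace B] [TopologicalSpace F] {e₀ : E} {b₀ : B} {f₀ : F}
  (S : SplitFibration e₀ b₀ f₀)

include S

/-- Lifting a null-homotopy of the image in the base moves a loop into the fibre. -/
lemma exists_map_fibre (g : HomotopyGroup N E e₀) (hg : HomotopyGroup.map S.p S.p_base g = 1) :
    ∃ c : HomotopyGroup N F f₀, g = HomotopyGroup.map S.i S.i_base c := by
  obtain ⟨γ, rfl⟩ := g.exists_mk
  rw [HomotopyGroup.map_mk, ← HomotopyGroup.mk_const, HomotopyGroup.mk_eq_mk_iff] at hg
  obtain ⟨D, hD0, hD1, hDb⟩ := hg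
  obtain ⟨H, hH0, hHp, hHb⟩ := S.exists_homotopy_lift γ.1 D hD0
  have hb : ∀ w, ∀ t ∈ Cube.boundary N, H (w, t) = e₀ := fun w t ht =>
    hHb t (γ.2 t ht) (fun w => hDb w t ht) w
  obtain ⟨c, hc⟩ := S.exists_fibre_lift (H.comp ⟨fun t => (1, t), by fun_prop⟩) fun t =>
    (hHp 1 t).trans (hD1 t)
  refine ⟨HomotopyGroup.mk ⟨c, fun t ht => S.i_injective ?_⟩, ?_⟩
  · rw [hc, S.i_base]
    exact hb 1 t ht
  · rw [HomotopyGroup.map_mk, HomotopyGroup.mk_eq_mk_iff]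
    exact ⟨H, hH0, fun t => (hc t).symm, hb⟩

/-- The homotopy group of the total space is generated by the base and the fibre. -/
lemma exists_eq_mul (g : HomotopyGroup N E e₀) :
    ∃ (b : HomotopyGroup N B b₀) (c : HomotopyGroup N F f₀),
      g = HomotopyGroup.map S.s S.s_base b * HomotopyGroup.map S.i S.i_base c := by
  set b := HomotopyGroup.map S.p S.p_base g with hb
  obtain ⟨c, hc⟩ := S.exists_map_fibre ((HomotopyGroup.map S.s S.s_base b)⁻¹ * g) (by
    rw [map_mul, map_inv, ← hb, HomotopyGroup.map_map_of_leftInverse _ _ _ _ _ S.p_s]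
    exact inv_mul_cancel b)
  exact ⟨b, c, by rw [← hc, mul_inv_cancel_left]⟩

/-- A null-homotopy in `E` of a loop in the fibre, followed by the reverse of its image under `s ∘ p`,
lies over a loop of null-homotopies that contracts; lifting the contraction moves it into the
fibre. -/
lemma map_fibre_injective (c : HomotopyGroup N F f₀)
    (hc : HomotopyGroup.map S.i S.i_base c = 1) : c = 1 := by
  obtain ⟨γ, rfl⟩ := c.exists_mk
  rw [HomotopyGroup.map_mk, ← HomotopyGroup.mk_const, HomotopyGroup.mk_eq_mk_iff] at hc
  obtain ⟨H, hH0, hH1, hHb⟩ := hc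
  replace hH0 : ∀ t, H (0, t) = S.i (γ t) := hH0
  replace hH1 : ∀ t, H (1, t) = e₀ := hH1
  -- The function that rises from `0` to `1` and falls back to `0`; its multiples contract it.
  let tent : C(unitInterval, unitInterval) :=
    ⟨fun u => Set.projIcc (0 : ℝ) 1 zero_le_one (min (2 * u) (2 - 2 * u)), by fun_prop⟩
  have tent0 : tent 0 = 0 := by
    simp only [tent, ContinuousMap.coe_mk]
    exact (projIcc_eq_left zero_lt_one).2 (by simp)
  have tent1 : tent 1 = 0 := by
    simp only [tent, ContinuousMap.coe_mk]
    exact (projIcc_eq_left zero_lt_one).2 (by norm_num)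
  have tent_half : ∀ u : unitInterval, (u : ℝ) = 1 / 2 → tent u = 1 := by
    intro u hu
    simp only [tent, ContinuousMap.coe_mk, hu]
    exact (projIcc_eq_right zero_lt_one).2 (by norm_num)
  -- The null-homotopy followed by the reverse of its image under `s ∘ p`.
  let a : C(unitInterval × (N → unitInterval), E) :=
    ⟨fun q => if (q.1 : ℝ) ≤ 1 / 2 then H (tent q.1, q.2) else S.s (S.p (H (tent q.1, q.2))), by
      refine Continuous.if_le (by fun_prop) (by fun_prop) (by fun_prop) (by fun_prop) ?_
      rintro q hq
      rw [tent_half q.1 hq, hH1, S.p_base, S.s_base]⟩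
  have ha : ∀ q, a q = if (q.1 : ℝ) ≤ 1 / 2 then H (tent q.1, q.2)
    else S.s (S.p (H (tent q.1, q.2))) := fun _ => rfl
  have hpH0 : ∀ t, S.p (H (0, t)) = b₀ := fun t => by rw [hH0, S.p_i]
  have ha0 : ∀ t, a (0, t) = S.i (γ t) := fun t => by
    rw [ha, if_pos (by simp), tent0, hH0]
  have ha1 : ∀ t, a (1, t) = e₀ := fun t => by
    rw [ha, if_neg (by norm_num), tent1, hpH0, S.s_base]
  have hab : ∀ u, ∀ t ∈ Cube.boundary N, a (u, t) = e₀ := fun u t ht => by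
    rw [ha, hHb _ t ht, S.p_base, S.s_base, ite_self]
  have hpa : ∀ q, S.p (a q) = S.p (H (tent q.1, q.2)) := fun q => by
    rw [ha]
    split_ifs
    · rfl
    · rw [S.p_s]
  let D : C(unitInterval × unitInterval × (N → unitInterval), B) :=
    ⟨fun q => S.p (H (unitInterval.symm q.1 * tent q.2.1, q.2.2)), by fun_prop⟩
  have hD : ∀ w u t, D (w, u, t) = S.p (H (unitInterval.symm w * tent u, t)) := fun _ _ _ => rfl
  obtain ⟨L, hL0, hLp, hLb⟩ := S.exists_homotopy_lift a D (by
    rintro ⟨u, t⟩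
    rw [hD, hpa, unitInterval.symm_zero, one_mul])
  have hLbd : ∀ w u, ∀ t ∈ Cube.boundary N, L (w, u, t) = e₀ := fun w u t ht =>
    hLb (u, t) (hab u t ht) (fun w => by rw [hD, hHb _ t ht, S.p_base]) w
  have hLend : ∀ w t, L (w, 1, t) = e₀ := fun w t =>
    hLb (1, t) (ha1 t) (fun w => by rw [hD, tent1, mul_zero, hpH0]) w
  obtain ⟨c₁, hc₁⟩ := S.exists_fibre_lift (L.comp ⟨fun q : unitInterval × (N → unitInterval) => (1, q.1, q.2), by fun_prop⟩) (by
    rintro ⟨u, t⟩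
    refine (hLp _ _).trans ?_
    rw [hD, unitInterval.symm_one, zero_mul, hpH0])
  obtain ⟨c₀, hc₀⟩ := S.exists_fibre_lift
    (L.comp ⟨fun q : unitInterval × (N → unitInterval) => (q.1, 0, q.2), by fun_prop⟩) (by
    rintro ⟨w, t⟩
    refine (hLp _ _).trans ?_
    rw [hD, tent0, mul_zero, hpH0])
  replace hc₁ : ∀ u t, S.i (c₁ (u, t)) = L (1, u, t) := fun u t => hc₁ (u, t)
  replace hc₀ : ∀ w t, S.i (c₀ (w, t)) = L (w, 0, t) := fun w t => hc₀ (w, t)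
  let δ : GenLoop N F f₀ := ⟨c₁.comp ⟨fun t => (0, t), by fun_prop⟩, fun t ht => S.i_injective (by
    rw [S.i_base]
    exact (hc₁ 0 t).trans (hLbd _ _ t ht))⟩
  have hδ : ∀ t, δ t = c₁ (0, t) := fun _ => rfl
  trans HomotopyGroup.mk δ
  · rw [HomotopyGroup.mk_eq_mk_iff]
    refine ⟨c₀, fun t => S.i_injective ?_, fun t => S.i_injective ?_,
      fun w t ht => S.i_injective ?_⟩
    · rw [hc₀, hL0, ha0]
    · rw [hc₀, hδ, hc₁]
    · rw [hc₀, hLbd _ _ t ht, S.i_base]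
  · rw [← HomotopyGroup.mk_const, HomotopyGroup.mk_eq_mk_iff]
    refine ⟨c₁, fun t => rfl, fun t => S.i_injective ?_, fun w t ht => S.i_injective ?_⟩
    · rw [hc₁, hLend, GenLoop.const_apply, S.i_base]
    · rw [hc₁, hLbd _ _ t ht, S.i_base]

/-- The contributions of the base and the fibre to the homotopy group are independent. -/
lemma eq_one_of_mul_eq_one {b : HomotopyGroup N B b₀} {c : HomotopyGroup N F f₀}
    (h : HomotopyGroup.map S.s S.s_base b * HomotopyGroup.map S.i S.i_base c = 1) :
    b = 1 ∧ c = 1 := by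
  have hb : b = 1 := by
    have := congrArg (HomotopyGroup.map S.p S.p_base) h
    rw [map_mul, map_one, HomotopyGroup.map_map_of_leftInverse _ _ _ _ _ S.p_s,
      HomotopyGroup.map_map_of_const _ _ _ _ _ S.p_i] at this
    simpa using this
  refine ⟨hb, S.map_fibre_injective c ?_⟩
  rwa [hb, map_one, one_mul] at h

end SplitFibration

/-! ### Mapping spaces of pairs of subcomplexes of a torus -/

/-- The number `‖s + 1/4‖ - 1/4`, clamped to `[-w/4, w/4]`. For `‖s‖ ≤ 1/4` the unclamped number is the
representative of `s` in `[-1/4, 1/4]`. -/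
def circleClamp (w : ℝ) (s : UnitAddCircle) : ℝ :=
  max (-(w / 4)) (min (w / 4) (‖s + ((1 / 4 : ℝ) : UnitAddCircle)‖ - 1 / 4))

/-- The map `S¹ → S¹` that, for `0 ≤ w ≤ 1`, collapses the arc of radius `w/4` about `0`; for `w = 0` it
is the identity. -/
def circleCollapse (w : ℝ) (s : UnitAddCircle) : UnitAddCircle :=
  s - (circleClamp w s : UnitAddCircle)

lemma continuous_circleCollapse :
    Continuous fun q : ℝ × UnitAddCircle => circleCollapse q.1 q.2 := by
  have h : Continuous fun q : ℝ × UnitAddCircle => circleClamp q.1 q.2 := by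
    unfold circleClamp
    fun_prop
  exact continuous_snd.sub ((AddCircle.continuous_mk' (1 : ℝ)).comp h)

lemma circleCollapse_zero_left (s : UnitAddCircle) : circleCollapse 0 s = s := by
  have : circleClamp 0 s = 0 := by
    simp [circleClamp]
  simp [circleCollapse, this]

lemma circleCollapse_eq_zero {w : ℝ} (h1 : w ≤ 1) {s : UnitAddCircle}
    (hs : ‖s‖ ≤ w / 4) : circleCollapse w s = 0 := by
  obtain ⟨r, rfl, hr⟩ : ∃ r : ℝ, (r : UnitAddCircle) = s ∧ |r| = ‖s‖ := by
    obtain ⟨x, rfl⟩ := QuotientAddGroup.mk_surjective s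
    refine ⟨x - round x, ?_, ?_⟩
    · rw [AddCircle.coe_sub]
      have : ((round x : ℝ) : UnitAddCircle) = 0 := (AddCircle.coe_eq_zero_iff 1).2 ⟨round x, by simp⟩
      rw [this, sub_zero]
    · exact (UnitAddCircle.norm_eq (x := x)).symm
  rw [← hr] at hs
  have hr' := abs_le.1 hs
  have hn : ‖(r : UnitAddCircle) + ((1 / 4 : ℝ) : UnitAddCircle)‖ = r + 1 / 4 := by
    rw [← AddCircle.coe_add, (AddCircle.norm_coe_eq_abs_iff 1 one_ne_zero).2,
      abs_of_nonneg (by linarith)]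
    rw [abs_one, abs_le]
    constructor <;> linarith
  have : circleClamp w (r : UnitAddCircle) = r := by
    rw [circleClamp, hn, add_sub_cancel_right, min_eq_right hr'.2, max_eq_right hr'.1]
  rw [circleCollapse, this, sub_self]

namespace Torus

variable {V : Type u} [Fintype V]

/-- The set of coordinates of a point of the torus that differ from the base point of the circle;
it indexes the open cell that contains the point. -/
def support (x : Torus V) : Finset V :=
  open Classical in Finset.univ.filter fun i => x i ≠ 0

@[simp]
lemma mem_support {x : Torus V} {i : V} : i ∈ support x ↔ x i ≠ 0 := by
  simp [support]

lemma support_subset_iff {x : Torus V} {τ : Finset V} : support x ⊆ τ ↔ ∀ i ∉ τ, x i = 0 := by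
  simp only [Finset.subset_iff, mem_support]
  exact forall_congr' fun i => not_imp_comm

/-- The subcomplex of the torus with the cells in a family of sets of coordinates that is closed
under passing to subsets. -/
def face (𝒦 : LowerSet (Finset V)) : Set (Torus V) := {x | support x ∈ 𝒦}

lemma mem_face {𝒦 : LowerSet (Finset V)} {x : Torus V} : x ∈ face 𝒦 ↔ support x ∈ 𝒦 := Iff.rfl

lemma isClosed_face (𝒦 : LowerSet (Finset V)) : IsClosed (face 𝒦) := by
  have : face 𝒦 = ⋃ τ ∈ 𝒦, ⋂ i ∈ (τ : Set V)ᶜ, {x : Torus V | x i = 0} := by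
    ext x
    simp only [mem_face, mem_iUnion, mem_iInter, exists_prop]
    constructor
    · exact fun h => ⟨_, h, support_subset_iff.1 subset_rfl⟩
    · rintro ⟨τ, hτ, h⟩
      exact 𝒦.lower (support_subset_iff.2 h) hτ
  rw [this]
  exact (Set.toFinite _).isClosed_biUnion fun τ _ => isClosed_biInter fun i _ =>
    isClosed_eq (continuous_apply i) continuous_const

instance (𝒦 : LowerSet (Finset V)) : CompactSpace (face 𝒦) :=
  isCompact_iff_compactSpace.1 (isClosed_face 𝒦).isCompact

/-- The projection of the torus onto a coordinate torus. -/
def restrictTo (τ : Finset V) (x : Torus V) : Torus V :=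
  open Classical in fun i => if i ∈ τ then x i else 0

omit [Fintype V] in
lemma restrictTo_of_mem {τ : Finset V} {i : V} (h : i ∈ τ) (x : Torus V) :
    restrictTo τ x i = x i := if_pos h

omit [Fintype V] in
lemma restrictTo_of_notMem {τ : Finset V} {i : V} (h : i ∉ τ) (x : Torus V) :
    restrictTo τ x i = 0 := if_neg h

omit [Fintype V] in
lemma continuous_restrictTo (τ : Finset V) : Continuous (restrictTo τ) := by
  refine continuous_pi fun i => ?_
  by_cases h : i ∈ τ
  · simp only [restrictTo_of_mem h]
    fun_prop
  · simp only [restrictTo_of_notMem h]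
    fun_prop

lemma support_restrictTo_subset_left (τ : Finset V) (x : Torus V) :
    support (restrictTo τ x) ⊆ τ :=
  support_subset_iff.2 fun _ hi => restrictTo_of_notMem hi x

lemma support_restrictTo_subset (τ : Finset V) (x : Torus V) :
    support (restrictTo τ x) ⊆ support x := by
  intro i hi
  rw [mem_support] at hi ⊢
  by_cases h : i ∈ τ
  · rwa [restrictTo_of_mem h] at hi
  · exact absurd (restrictTo_of_notMem h x) hi

lemma restrictTo_eq_self {τ : Finset V} {x : Torus V} (h : support x ⊆ τ) :
    restrictTo τ x = x := by
  funext i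
  by_cases hi : i ∈ τ
  · exact restrictTo_of_mem hi x
  · rw [restrictTo_of_notMem hi, support_subset_iff.1 h i hi]

end Torus

open Torus

section RelMaps

variable {V : Type u} [Fintype V] {Z : Type u} [TopologicalSpace Z]

/-- The space of maps from the subcomplex of `𝒦` to `Z` that take the subcomplex of `𝒦₀` to `z`. -/
abbrev RelMaps (𝒦 𝒦₀ : LowerSet (Finset V)) (z : Z) : Type u :=
  {φ : C(face 𝒦, Z) // ∀ x, support x.1 ∈ 𝒦₀ → φ x = z}

/-- The constant map. -/
def RelMaps.base (𝒦 𝒦₀ : LowerSet (Finset V)) (z : Z) : RelMaps 𝒦 𝒦₀ z :=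
  ⟨.const _ z, fun _ _ => rfl⟩

/-- The space of maps of a coordinate torus, relative to the union of its proper coordinate subtori.
They are encoded as maps of the whole torus that depend only on these coordinates. -/
abbrev CellMaps (τ : Finset V) (z : Z) : Type u :=
  {β : C(Torus V, Z) // (∀ x, (∃ i ∈ τ, x i = 0) → β x = z) ∧ ∀ x, β (restrictTo τ x) = β x}

/-- The constant map. -/
def CellMaps.base (τ : Finset V) (z : Z) : CellMaps τ z :=
  ⟨.const _ z, fun _ _ => rfl, fun _ => rfl⟩

variable {𝒦 𝒦₀ : LowerSet (Finset V)} {z : Z}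

lemma exists_mem_eq_zero_of_not_subset {τ : Finset V} {x : Torus V} (h : ¬τ ⊆ support x) :
    ∃ i ∈ τ, x i = 0 := by
  simpa [Finset.not_subset] using h

/-- The restriction of a map that is supported on the cell `τ` to a subcomplex. -/
def CellMaps.res (𝒦 : LowerSet (Finset V)) (z : Z) {τ : Finset V} (h : τ ∉ 𝒦₀) :
    C(CellMaps τ z, RelMaps 𝒦 𝒦₀ z) :=
  ⟨fun β => ⟨β.1.comp ⟨Subtype.val, continuous_subtype_val⟩, fun x hx => β.2.1 x.1 <|
      exists_mem_eq_zero_of_not_subset fun hτ => h (𝒦₀.lower hτ hx)⟩,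
    ((ContinuousMap.continuous_precomp _).comp continuous_subtype_val).subtype_mk _⟩

variable {N : Type} [DecidableEq N] [Nontrivial N]

/-- The contribution of the cell `τ` to the homotopy groups of the mapping space of the pair; it is
trivial by convention if `τ` belongs to `𝒦₀`. -/
def cellHom (N : Type) [DecidableEq N] [Nontrivial N] (𝒦 𝒦₀ : LowerSet (Finset V)) (z : Z)
    (τ : Finset V) :
    HomotopyGroup N (CellMaps τ z) (CellMaps.base τ z) →*
      HomotopyGroup N (RelMaps 𝒦 𝒦₀ z) (RelMaps.base 𝒦 𝒦₀ z) :=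
  open Classical in
  if h : τ ∉ 𝒦₀ then HomotopyGroup.map (CellMaps.res 𝒦 z h) rfl else 1

lemma cellHom_eq {τ : Finset V} (h : τ ∉ 𝒦₀) :
    cellHom N 𝒦 𝒦₀ z τ = HomotopyGroup.map (CellMaps.res 𝒦 z h) rfl :=
  dif_pos h

/-- The cells of `𝒦` that do not belong to `𝒦₀`. -/
def relCells (𝒦 𝒦₀ : LowerSet (Finset V)) : Finset (Finset V) :=
  open Classical in Finset.univ.filter fun τ => τ ∈ 𝒦 ∧ τ ∉ 𝒦₀

@[simp]
lemma mem_relCells {τ : Finset V} : τ ∈ relCells 𝒦 𝒦₀ ↔ τ ∈ 𝒦 ∧ τ ∉ 𝒦₀ := by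
  simp [relCells]

/-- The cells that avoid a given coordinate. -/
def avoiding (v : V) : LowerSet (Finset V) := ⟨{τ | v ∉ τ}, fun _ _ h hv h' => hv (h h')⟩

omit [Fintype V] in
lemma mem_avoiding {v : V} {τ : Finset V} : τ ∈ avoiding v ↔ v ∉ τ := Iff.rfl

/-! ### Restriction to the cells that avoid a coordinate -/

section Fibration

/-- Putting the coordinate `v` to `s`, as a map of the torus. -/
def setCoord (v : V) (s : UnitAddCircle) (x : Torus V) : Torus V :=
  open Classical in Function.update x v s

omit [Fintype V] in
lemma continuous_setCoord (v : V) :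
    Continuous fun q : UnitAddCircle × Torus V => setCoord v q.1 q.2 := by
  unfold setCoord
  fun_prop

lemma support_setCoord_subset {v : V} {s : UnitAddCircle} {x : Torus V} (h : x v = 0 → s = 0) :
    support (setCoord v s x) ⊆ support x := by
  classical
  intro i hi
  rw [mem_support, setCoord, Function.update_apply] at hi
  rw [mem_support]
  split_ifs at hi with hv
  · subst hv
    exact fun h' => hi (h h')
  · exact hi

omit [Fintype V] in
lemma setCoord_self (v : V) (x : Torus V) : setCoord v (x v) x = x := by
  classical
  exact Function.update_eq_self v x

lemma support_setCoord_zero (v : V) (x : Torus V) : v ∉ support (setCoord v 0 x) := by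
  simp [setCoord]

lemma setCoord_zero_mem {v : V} {x : Torus V} (hx : x ∈ face 𝒦) :
    setCoord v 0 x ∈ face (𝒦 ⊓ avoiding v) :=
  ⟨𝒦.lower (support_setCoord_subset fun _ => rfl) hx, support_setCoord_zero v x⟩

/-- Setting a coordinate to `0`, as a retraction of a subcomplex. -/
def zeroCoord (𝒦 : LowerSet (Finset V)) (v : V) : C(face 𝒦, face (𝒦 ⊓ avoiding v)) :=
  ⟨fun x => ⟨setCoord v 0 x.1, setCoord_zero_mem x.2⟩,
    ((continuous_setCoord v).comp (by fun_prop : Continuous fun x : face 𝒦 =>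
      ((0 : UnitAddCircle), x.1))).subtype_mk _⟩

/-- The inclusion of the subcomplex of the cells that avoid a coordinate. -/
def avoidingIncl (𝒦 : LowerSet (Finset V)) (v : V) : C(face (𝒦 ⊓ avoiding v), face 𝒦) :=
  ⟨fun x => ⟨x.1, x.2.1⟩, continuous_subtype_val.subtype_mk _⟩

lemma zeroCoord_avoidingIncl (v : V) (x : face (𝒦 ⊓ avoiding v)) :
    zeroCoord 𝒦 v (avoidingIncl 𝒦 v x) = x := by
  have hx : x.1 v = 0 := by
    simpa using mem_avoiding.1 x.2.2
  refine Subtype.ext ?_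
  change setCoord v 0 x.1 = x.1
  rw [← hx, setCoord_self]

/-- Restriction to the subcomplex of the cells that avoid the coordinate `v`. A homotopy `D` of the
restriction extends over the whole complex: at time `w` the arc of radius `w/4` about `0` in the
coordinate `v` carries the track of the homotopy, and the rest of the circle is stretched. -/
def splitFibration (𝒦 𝒦₀ : LowerSet (Finset V)) (z : Z) (v : V) :
    SplitFibration (RelMaps.base 𝒦 𝒦₀ z) (RelMaps.base (𝒦 ⊓ avoiding v) 𝒦₀ z)
      (RelMaps.base 𝒦 (𝒦₀ ⊔ avoiding v) z) where
  p := ⟨fun φ => ⟨φ.1.comp (avoidingIncl 𝒦 v), fun x hx => φ.2 _ hx⟩,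
    ((ContinuousMap.continuous_precomp _).comp continuous_subtype_val).subtype_mk _⟩
  s := ⟨fun φ => ⟨φ.1.comp (zeroCoord 𝒦 v), fun x hx => φ.2 _
      (𝒦₀.lower (support_setCoord_subset fun _ => rfl) hx)⟩,
    ((ContinuousMap.continuous_precomp _).comp continuous_subtype_val).subtype_mk _⟩
  i := ⟨fun φ => ⟨φ.1, fun x hx => φ.2 x (Or.inl hx)⟩, continuous_subtype_val.subtype_mk _⟩
  p_base := rfl
  s_base := rfl
  i_base := rfl
  p_s φ := by
    refine Subtype.ext (ContinuousMap.ext fun x => ?_)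
    exact congrArg φ.1 (zeroCoord_avoidingIncl v x)
  p_i φ := by
    refine Subtype.ext (ContinuousMap.ext fun x => ?_)
    exact φ.2 _ (Or.inr x.2.2)
  i_injective φ ψ h := Subtype.ext (congrArg (Subtype.val : RelMaps 𝒦 𝒦₀ z → _) h)
  exists_fibre_lift {Y} _ a ha := by
    refine ⟨⟨fun y => ⟨(a y).1, fun x hx => ?_⟩, (continuous_subtype_val.comp a.2).subtype_mk _⟩,
      fun y => rfl⟩
    rcases hx with hx | hx
    · exact (a y).2 x hx
    · exact ContinuousMap.congr_fun (congrArg Subtype.val (ha y)) ⟨x.1, x.2, hx⟩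
  exists_homotopy_lift {Y} _ a D hD := by
    have hD' : ∀ y x, (D (0, y)).1 x = (a y).1 (avoidingIncl 𝒦 v x) := fun y x =>
      ContinuousMap.congr_fun (congrArg Subtype.val (hD y)) x
    have hsub : ∀ (w : unitInterval) (x : Torus V),
        support (setCoord v (circleCollapse w (x v)) x) ⊆ support x := fun w x =>
      support_setCoord_subset fun h => circleCollapse_eq_zero w.2.2 (by
        rw [h, norm_zero]
        linarith [w.2.1])
    have hcont : Continuous fun x : face 𝒦 => x.1 v :=
      (continuous_apply v).comp continuous_subtype_val
    let κ : C(unitInterval × face 𝒦, face 𝒦) :=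
      ⟨fun q => ⟨setCoord v (circleCollapse q.1 (q.2.1 v)) q.2.1, 𝒦.lower (hsub q.1 q.2.1) q.2.2⟩, by
        refine Continuous.subtype_mk ?_ _
        have h1 : Continuous fun q : unitInterval × face 𝒦 => circleCollapse q.1 (q.2.1 v) :=
          continuous_circleCollapse.comp
            ((continuous_subtype_val.comp continuous_fst).prodMk (hcont.comp continuous_snd))
        exact (continuous_setCoord v).comp (h1.prodMk (by fun_prop))⟩
    let ω : C(unitInterval × face 𝒦, unitInterval) :=
      ⟨fun q => projIcc (0 : ℝ) 1 zero_le_one (q.1 - 4 * ‖q.2.1 v‖),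
        continuous_projIcc.comp ((continuous_subtype_val.comp continuous_fst).sub
          (continuous_const.mul (hcont.comp continuous_snd).norm))⟩
    let G : C((unitInterval × Y) × face 𝒦, Z) :=
      ⟨fun q => if ‖q.2.1 v‖ ≤ (q.1.1 : ℝ) / 4
        then (D (ω (q.1.1, q.2), q.1.2)).1 (zeroCoord 𝒦 v q.2)
        else (a q.1.2).1 (κ (q.1.1, q.2)), by
        refine Continuous.if_le (by fun_prop) (by fun_prop)
          (hcont.comp continuous_snd).norm (by fun_prop) ?_
        rintro ⟨⟨w, y⟩, x⟩ hw
        simp only at hw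
        have h1 : ω (w, x) = 0 := (projIcc_eq_left zero_lt_one).2 (by simp only; linarith)
        have h2 : κ (w, x) = avoidingIncl 𝒦 v (zeroCoord 𝒦 v x) := by
          refine Subtype.ext ?_
          change setCoord v _ _ = setCoord v _ _
          rw [circleCollapse_eq_zero w.2.2 hw.le]
        simp only [h1, h2, hD']⟩
    have hG : ∀ w y x, G ((w, y), x) = if ‖x.1 v‖ ≤ (w : ℝ) / 4
        then (D (ω (w, x), y)).1 (zeroCoord 𝒦 v x) else (a y).1 (κ (w, x)) := fun _ _ _ => rfl
    refine ⟨⟨fun q => ⟨G.curry q, fun x hx => ?_⟩, G.curry.2.subtype_mk _⟩, fun y => ?_,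
      fun w y => ?_, fun y h1 h2 w => ?_⟩
    · obtain ⟨w, y⟩ := q
      rw [ContinuousMap.curry_apply, hG]
      split_ifs
      · exact (D _).2 _ (𝒦₀.lower (support_setCoord_subset fun _ => rfl) hx)
      · exact (a y).2 _ (𝒦₀.lower (hsub w x.1) hx)
    · refine Subtype.ext (ContinuousMap.ext fun x => ?_)
      change G ((0, y), x) = (a y).1 x
      rw [hG]
      split_ifs with h
      · have hx : x.1 v = 0 := by simpa using h
        have h1 : ω (0, x) = 0 := (projIcc_eq_left zero_lt_one).2 (by simp [hx])
        rw [h1, hD']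
        congr 1
        refine Subtype.ext ?_
        change setCoord v 0 x.1 = x.1
        rw [← hx, setCoord_self]
      · congr 1
        refine Subtype.ext ?_
        change setCoord v (circleCollapse ((0 : unitInterval) : ℝ) (x.1 v)) x.1 = x.1
        rw [Icc.coe_zero, circleCollapse_zero_left, setCoord_self]
    · refine Subtype.ext (ContinuousMap.ext fun x => ?_)
      change G ((w, y), avoidingIncl 𝒦 v x) = (D (w, y)).1 x
      have hx : x.1 v = 0 := by
        simpa using mem_avoiding.1 x.2.2
      have hω : ω (w, avoidingIncl 𝒦 v x) = w := by
        change projIcc (0 : ℝ) 1 zero_le_one (w - 4 * ‖x.1 v‖) = w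
        rw [hx, norm_zero, mul_zero, sub_zero, projIcc_val]
      rw [hG, if_pos, zeroCoord_avoidingIncl, hω]
      change ‖x.1 v‖ ≤ _
      rw [hx, norm_zero]
      linarith [w.2.1]
    · refine Subtype.ext (ContinuousMap.ext fun x => ?_)
      change G ((w, y), x) = z
      rw [hG, h1, h2]
      split_ifs <;> rfl

end Fibration

/-! ### Decomposition of homotopy groups of mapping spaces into cells -/

lemma mem_relCells_iff_or (v : V) : ∀ τ, τ ∈ relCells 𝒦 𝒦₀ ↔
    τ ∈ relCells (𝒦 ⊓ avoiding v) 𝒦₀ ∨ τ ∈ relCells 𝒦 (𝒦₀ ⊔ avoiding v) := by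
  intro τ
  simp only [mem_relCells, LowerSet.mem_inf_iff, LowerSet.mem_sup_iff, mem_avoiding]
  tauto

lemma disjoint_relCells (v : V) :
    Disjoint (relCells (𝒦 ⊓ avoiding v) 𝒦₀) (relCells 𝒦 (𝒦₀ ⊔ avoiding v)) := by
  rw [Finset.disjoint_left]
  intro τ
  simp only [mem_relCells, LowerSet.mem_inf_iff, LowerSet.mem_sup_iff, mem_avoiding]
  tauto

lemma map_section_cellHom {v : V} {τ : Finset V} (h : τ ∈ relCells (𝒦 ⊓ avoiding v) 𝒦₀)
    (b : HomotopyGroup N (CellMaps τ z) (CellMaps.base τ z)) :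
    HomotopyGroup.map (splitFibration 𝒦 𝒦₀ z v).s (splitFibration 𝒦 𝒦₀ z v).s_base
      (cellHom N (𝒦 ⊓ avoiding v) 𝒦₀ z τ b) = cellHom N 𝒦 𝒦₀ z τ b := by
  rw [mem_relCells] at h
  rw [cellHom_eq h.2, cellHom_eq h.2]
  refine HomotopyGroup.map_map _ _ _ _ _ _ _ fun β => Subtype.ext (ContinuousMap.ext fun x => ?_)
  change β.1 (setCoord v 0 x.1) = β.1 x.1
  rw [← β.2.2, ← β.2.2 x.1]
  congr 1
  funext i
  by_cases hi : i ∈ τ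
  · have hv : i ≠ v := fun hv => h.1.2 (hv ▸ hi)
    classical
    rw [restrictTo_of_mem hi, restrictTo_of_mem hi, setCoord, Function.update_of_ne hv]
  · rw [restrictTo_of_notMem hi, restrictTo_of_notMem hi]

lemma map_fibre_cellHom {v : V} {τ : Finset V} (h : τ ∈ relCells 𝒦 (𝒦₀ ⊔ avoiding v))
    (b : HomotopyGroup N (CellMaps τ z) (CellMaps.base τ z)) :
    HomotopyGroup.map (splitFibration 𝒦 𝒦₀ z v).i (splitFibration 𝒦 𝒦₀ z v).i_base
      (cellHom N 𝒦 (𝒦₀ ⊔ avoiding v) z τ b) = cellHom N 𝒦 𝒦₀ z τ b := by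
  rw [mem_relCells] at h
  have h' : τ ∉ 𝒦₀ := fun h' => h.2 (Or.inl h')
  rw [cellHom_eq h.2, cellHom_eq h']
  exact HomotopyGroup.map_map _ _ _ _ _ _ _ fun β => rfl

/-- If `τ` is the only cell of `𝒦` outside `𝒦₀`, the mapping space of the pair is the space of maps
that are supported on the cell. -/
lemma exists_cellHom_inverse {τ : Finset V} (h : relCells 𝒦 𝒦₀ = {τ}) :
    ∃ r : HomotopyGroup N (RelMaps 𝒦 𝒦₀ z) (RelMaps.base 𝒦 𝒦₀ z) →*
        HomotopyGroup N (CellMaps τ z) (CellMaps.base τ z),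
      (∀ g, cellHom N 𝒦 𝒦₀ z τ (r g) = g) ∧ ∀ b, r (cellHom N 𝒦 𝒦₀ z τ b) = b := by
  have hτ : τ ∈ 𝒦 ∧ τ ∉ 𝒦₀ := by
    rw [← mem_relCells, h, Finset.mem_singleton]
  have hall : ∀ σ ∈ 𝒦, σ ≠ τ → σ ∈ 𝒦₀ := by
    intro σ h1 h2
    by_contra h3
    have : σ ∈ relCells 𝒦 𝒦₀ := mem_relCells.2 ⟨h1, h3⟩
    rw [h, Finset.mem_singleton] at this
    exact h2 this
  have hmem : ∀ x, restrictTo τ x ∈ face 𝒦 := fun x =>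
    𝒦.lower (support_restrictTo_subset_left τ x) hτ.1
  let ρ : C(Torus V, face 𝒦) := ⟨fun x => ⟨restrictTo τ x, hmem x⟩,
    (continuous_restrictTo τ).subtype_mk _⟩
  let r : C(RelMaps 𝒦 𝒦₀ z, CellMaps τ z) :=
    ⟨fun φ => ⟨φ.1.comp ρ, fun x ⟨i, hi, hxi⟩ => φ.2 _ (hall _ (hmem x) fun heq => ?_),
      fun x => congrArg φ.1 (Subtype.ext
        (restrictTo_eq_self (support_restrictTo_subset_left τ x)))⟩,
      ((ContinuousMap.continuous_precomp _).comp continuous_subtype_val).subtype_mk _⟩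
  · refine ⟨HomotopyGroup.map r rfl, fun g => ?_, fun b => ?_⟩
    · rw [cellHom_eq hτ.2]
      refine HomotopyGroup.map_map_of_leftInverse _ _ _ _ _ fun φ =>
        Subtype.ext (ContinuousMap.ext fun x => ?_)
      change φ.1 (ρ x.1) = φ.1 x
      by_cases hx : support x.1 = τ
      · exact congrArg φ.1 (Subtype.ext (restrictTo_eq_self hx.subset))
      · have hx0 := hall _ x.2 hx
        rw [φ.2 x hx0]
        exact φ.2 _ (𝒦₀.lower (support_restrictTo_subset τ x.1) hx0)
    · rw [cellHom_eq hτ.2]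
      refine HomotopyGroup.map_map_of_leftInverse _ _ _ _ _ fun β =>
        Subtype.ext (ContinuousMap.ext fun x => ?_)
      exact β.2.2 x
  · have := heq.symm ▸ hi
    rw [mem_support] at this
    exact this ((restrictTo_of_mem hi x).trans hxi)

/-- The homotopy groups of the mapping space of a pair of subcomplexes of a torus are the direct
products of the contributions of the cells: two cells are separated by a coordinate `v`, and the split
fibration of `v` distributes the cells between base and fibre. -/
theorem cellHom_prod_bijective (𝒦 𝒦₀ : LowerSet (Finset V)) (z : Z) :
    (∀ g : HomotopyGroup N (RelMaps 𝒦 𝒦₀ z) (RelMaps.base 𝒦 𝒦₀ z),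
      ∃ b : ∀ τ, HomotopyGroup N (CellMaps τ z) (CellMaps.base τ z),
        g = ∏ τ ∈ relCells 𝒦 𝒦₀, cellHom N 𝒦 𝒦₀ z τ (b τ)) ∧
    ∀ b : ∀ τ, HomotopyGroup N (CellMaps τ z) (CellMaps.base τ z),
      ∏ τ ∈ relCells 𝒦 𝒦₀, cellHom N 𝒦 𝒦₀ z τ (b τ) = 1 → ∀ τ ∈ relCells 𝒦 𝒦₀, b τ = 1 := by
  classical
  induction hn : (relCells 𝒦 𝒦₀).card using Nat.strong_induction_on generalizing 𝒦 𝒦₀ with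
  | _ n ih =>
    subst hn
    by_cases hcard : ∃ τ ∈ relCells 𝒦 𝒦₀, ∃ τ' ∈ relCells 𝒦 𝒦₀, ∃ v, v ∈ τ ∧ v ∉ τ'
    · obtain ⟨τ, hτ, τ', hτ', v, hv, hv'⟩ := hcard
      have hunion : relCells 𝒦 𝒦₀ =
          relCells (𝒦 ⊓ avoiding v) 𝒦₀ ∪ relCells 𝒦 (𝒦₀ ⊔ avoiding v) := by
        ext σ
        rw [Finset.mem_union, ← mem_relCells_iff_or]
      have hlt1 : (relCells (𝒦 ⊓ avoiding v) 𝒦₀).card < (relCells 𝒦 𝒦₀).card := by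
        refine Finset.card_lt_card ⟨hunion ▸ Finset.subset_union_left, fun hsub => ?_⟩
        exact (mem_relCells.1 (hsub hτ)).1.2 hv
      have hlt2 : (relCells 𝒦 (𝒦₀ ⊔ avoiding v)).card < (relCells 𝒦 𝒦₀).card := by
        refine Finset.card_lt_card ⟨hunion ▸ Finset.subset_union_right, fun hsub => ?_⟩
        exact (mem_relCells.1 (hsub hτ')).2 (Or.inr hv')
      obtain ⟨hs1, hi1⟩ := ih _ hlt1 (𝒦 ⊓ avoiding v) 𝒦₀ rfl
      obtain ⟨hs2, hi2⟩ := ih _ hlt2 𝒦 (𝒦₀ ⊔ avoiding v) rfl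
      have hprod : ∀ b₁ b₂ b : ∀ τ, HomotopyGroup N (CellMaps τ z) (CellMaps.base τ z),
          (∀ τ ∈ relCells (𝒦 ⊓ avoiding v) 𝒦₀, b τ = b₁ τ) →
          (∀ τ ∈ relCells 𝒦 (𝒦₀ ⊔ avoiding v), b τ = b₂ τ) →
          ∏ τ ∈ relCells 𝒦 𝒦₀, cellHom N 𝒦 𝒦₀ z τ (b τ) =
            HomotopyGroup.map (splitFibration 𝒦 𝒦₀ z v).s (splitFibration 𝒦 𝒦₀ z v).s_base
              (∏ τ ∈ relCells (𝒦 ⊓ avoiding v) 𝒦₀, cellHom N (𝒦 ⊓ avoiding v) 𝒦₀ z τ (b₁ τ)) *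
            HomotopyGroup.map (splitFibration 𝒦 𝒦₀ z v).i (splitFibration 𝒦 𝒦₀ z v).i_base
              (∏ τ ∈ relCells 𝒦 (𝒦₀ ⊔ avoiding v),
                cellHom N 𝒦 (𝒦₀ ⊔ avoiding v) z τ (b₂ τ)) := by
        intro b₁ b₂ b h1 h2
        rw [hunion, Finset.prod_union (disjoint_relCells v), map_prod, map_prod]
        congr 1
        · refine Finset.prod_congr rfl fun τ hτ => ?_
          rw [map_section_cellHom hτ, h1 τ hτ]
        · refine Finset.prod_congr rfl fun τ hτ => ?_
          rw [map_fibre_cellHom hτ, h2 τ hτ]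
      refine ⟨fun g => ?_, fun b hb => ?_⟩
      · obtain ⟨g₁, g₂, rfl⟩ := (splitFibration 𝒦 𝒦₀ z v).exists_eq_mul g
        obtain ⟨b₁, rfl⟩ := hs1 g₁
        obtain ⟨b₂, rfl⟩ := hs2 g₂
        refine ⟨fun τ => if τ ∈ relCells (𝒦 ⊓ avoiding v) 𝒦₀ then b₁ τ else b₂ τ, ?_⟩
        refine (hprod b₁ b₂ _ (fun τ hτ => if_pos hτ) fun τ hτ => if_neg ?_).symm
        exact Finset.disjoint_right.1 (disjoint_relCells v) hτ
      · rw [hprod b b b (fun _ _ => rfl) fun _ _ => rfl] at hb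
        obtain ⟨hb1, hb2⟩ := (splitFibration 𝒦 𝒦₀ z v).eq_one_of_mul_eq_one hb
        intro σ hσ
        rw [hunion, Finset.mem_union] at hσ
        exact hσ.elim (hi1 b hb1 σ) (hi2 b hb2 σ)
    · push Not at hcard
      have hsub : ∀ τ ∈ relCells 𝒦 𝒦₀, ∀ τ' ∈ relCells 𝒦 𝒦₀, τ = τ' := fun τ h τ' h' =>
        Finset.Subset.antisymm (hcard τ h τ' h') (hcard τ' h' τ h)
      rcases (relCells 𝒦 𝒦₀).eq_empty_or_nonempty with hempty | ⟨τ, hτ⟩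
      · rw [hempty]
        refine ⟨fun g => ⟨fun _ => 1, ?_⟩, fun _ _ τ hτ => absurd hτ (Finset.notMem_empty τ)⟩
        rw [Finset.prod_empty]
        obtain ⟨γ, rfl⟩ := g.exists_mk
        rw [← HomotopyGroup.mk_const]
        congr 1
        ext t x
        refine (γ t).2 x ?_
        by_contra hx
        have : support x.1 ∈ relCells 𝒦 𝒦₀ := mem_relCells.2 ⟨x.2, hx⟩
        rw [hempty] at this
        exact Finset.notMem_empty _ this
      · have hsingle : relCells 𝒦 𝒦₀ = {τ} :=
          Finset.eq_singleton_iff_unique_mem.2 ⟨hτ, fun σ hσ => hsub σ hσ τ hτ⟩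
        obtain ⟨r, hr1, hr2⟩ := exists_cellHom_inverse (N := N) (z := z) hsingle
        rw [hsingle]
        refine ⟨fun g => ⟨Function.update (fun _ => 1) τ (r g), ?_⟩, fun b hb σ hσ => ?_⟩
        · rw [Finset.prod_singleton, Function.update_self, hr1]
        · rw [Finset.mem_singleton] at hσ
          subst hσ
          rw [Finset.prod_singleton] at hb
          rw [← hr2 (b σ), hb, map_one]

end RelMaps

/-! ### Maps out of suspensions and wedges of spheres -/

section Lifts

variable {Z : Type*} [TopologicalSpace Z]

/-- The map out of a wedge of spheres that is given by pointed maps out of the spheres. -/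
def SphereWedge.lift {J : Type u} {d : J → ℕ} (z : Z) (b : ∀ j, C(StdSphere (d j), Z))
    (hb : ∀ j, b j (StdSphere.base (d j)) = z) : C(SphereWedge d, Z) where
  toFun := Quotient.lift (Sum.elim (fun _ => z) fun p => b p.1 p.2) (by
    have key : ∀ w ∈ (insert (Sum.inl PUnit.unit)
        (range fun j => Sum.inr ⟨j, StdSphere.base (d j)⟩) :
          Set (PUnit.{u + 1} ⊕ Σ j, StdSphere (d j))),
        Sum.elim (fun _ => z) (fun p : Σ j, StdSphere (d j) => b p.1 p.2) w = z := by
      rintro w (rfl | ⟨j, rfl⟩)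
      · rfl
      · exact hb j
    rintro w w' (rfl | ⟨h, h'⟩)
    · rfl
    · rw [key w h, key w' h'])
  continuous_toFun := by
    refine Continuous.quotient_lift ?_ _
    exact continuous_const.sumElim (continuous_sigma fun j => (b j).continuous)

lemma SphereWedge.eq_base_or_incl {J : Type u} {d : J → ℕ} (w : SphereWedge d) :
    w = SphereWedge.base ∨ ∃ j s, w = SphereWedge.incl j s := by
  obtain ⟨w, rfl⟩ := Quotient.exists_rep w
  rcases w with ⟨⟩ | ⟨j, s⟩
  · exact Or.inl rfl
  · exact Or.inr ⟨j, s, rfl⟩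

/-- The inclusion of a sphere into a wedge of spheres. -/
def SphereWedge.inclMap {J : Type u} {d : J → ℕ} (j : J) : C(StdSphere (d j), SphereWedge d) :=
  ⟨SphereWedge.incl j, continuous_quotient_mk'.comp
    (continuous_inr.comp (continuous_sigmaMk (σ := fun j => StdSphere (d j))))⟩

lemma SphereWedge.inclMap_base {J : Type u} {d : J → ℕ} (j : J) :
    SphereWedge.inclMap (d := d) j (StdSphere.base (d j)) = SphereWedge.base :=
  Quotient.sound (Or.inr ⟨Or.inr ⟨j, rfl⟩, Or.inl rfl⟩)

variable {ℓ : ℕ} {X : Type u} [TopologicalSpace X] {x₀ : X}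

lemma ReducedSuspension.continuous_mk : Continuous fun p : X × (Fin ℓ → unitInterval) =>
    (ReducedSuspension.mk p.1 p.2 : ReducedSuspension ℓ X x₀) :=
  continuous_quotient_mk'

lemma ReducedSuspension.exists_mk (a : ReducedSuspension ℓ X x₀) :
    ∃ x t, a = ReducedSuspension.mk x t := by
  obtain ⟨⟨x, t⟩, rfl⟩ := Quotient.exists_rep a
  exact ⟨x, t, rfl⟩

lemma ReducedSuspension.mk_eq_mk {x x' : X} {t t' : Fin ℓ → unitInterval}
    (h : x = x₀ ∨ t ∈ Cube.boundary (Fin ℓ)) (h' : x' = x₀ ∨ t' ∈ Cube.boundary (Fin ℓ)) :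
    (ReducedSuspension.mk x t : ReducedSuspension ℓ X x₀) = ReducedSuspension.mk x' t' :=
  Quotient.sound (Or.inr ⟨h, h'⟩)

/-- The map out of a reduced suspension that is given by a map out of the product. -/
def ReducedSuspension.lift (z : Z) (φ : C(X × (Fin ℓ → unitInterval), Z))
    (hφ : ∀ x t, x = x₀ ∨ t ∈ Cube.boundary (Fin ℓ) → φ (x, t) = z) :
    C(ReducedSuspension ℓ X x₀, Z) where
  toFun := Quotient.lift φ (by
    rintro ⟨x, t⟩ ⟨x', t'⟩ (h | ⟨h, h'⟩)
    · rw [h]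
    · rw [hφ x t h, hφ x' t' h'])
  continuous_toFun := φ.continuous.quotient_lift _

end Lifts

/-! ### Concatenation of lists of loops -/

section Concat

variable {N : Type*} [DecidableEq N] {X : Type*} [TopologicalSpace X] {x : X}

/-- The concatenation of a list of `GenLoop`s along a coordinate. -/
def GenLoop.concat (i : N) (l : List (GenLoop N X x)) : GenLoop N X x :=
  l.foldr (GenLoop.transAt i) GenLoop.const

/-- The multiplication of homotopy groups composes in the order opposite to that of `transAt`, which is
irrelevant as they are commutative. -/
lemma HomotopyGroup.mk_concat [Nontrivial N] (i : N) (l : List (GenLoop N X x)) :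
    HomotopyGroup.mk (GenLoop.concat i l) = (l.map HomotopyGroup.mk).prod := by
  induction l with
  | nil => rfl
  | cons p l ih =>
    rw [List.map_cons, List.prod_cons, ← ih, mul_comm, HomotopyGroup.mk_mul_mk i]
    rfl

lemma GenLoop.concat_apply_eq (i : N) (l : List (GenLoop N X x)) (t : N → unitInterval) :
    GenLoop.concat i l t = x ∨ ∃ p ∈ l, ∃ t', GenLoop.concat i l t = p t' := by
  induction l generalizing t with
  | nil => exact Or.inl rfl
  | cons p l ih =>
    simp only [GenLoop.concat, List.foldr_cons, GenLoop.transAt, GenLoop.coe_copy]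
    split_ifs
    · exact Or.inr ⟨p, List.mem_cons_self, _, rfl⟩
    · rcases ih (Function.update t i (Set.projIcc 0 1 zero_le_one (2 * t i - 1))) with
        h | ⟨q, hq, t', h⟩
      · exact Or.inl h
      · exact Or.inr ⟨q, List.mem_cons_of_mem _ hq, t', h⟩

/-- In the concatenation of a list of loops, each loop of the list runs through a slab `[a, b]` of the
cube. -/
lemma GenLoop.exists_slab (i : N) (l₁ : List (GenLoop N X x)) (p : GenLoop N X x)
    (l₂ : List (GenLoop N X x)) :
    ∃ a b : ℝ, 0 ≤ a ∧ a < b ∧ b ≤ 1 ∧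
      (∀ t s : N → unitInterval, (∀ k ≠ i, t k = s k) → (t i : ℝ) = a + (b - a) * s i →
        GenLoop.concat i (l₁ ++ p :: l₂) t = p s) ∧
      ∀ t : N → unitInterval, (t i : ℝ) ≤ a ∨ b ≤ t i →
        GenLoop.concat i (l₁ ++ p :: l₂) t = x ∨
          ∃ q ∈ l₁ ++ l₂, ∃ t', GenLoop.concat i (l₁ ++ p :: l₂) t = q t' := by
  induction l₁ with
  | nil =>
    refine ⟨0, 1 / 2, le_rfl, by norm_num, by norm_num, fun t s h1 h2 => ?_, fun t ht => ?_⟩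
    · have hs := (s i).2
      simp only [GenLoop.concat, List.nil_append, List.foldr_cons, GenLoop.transAt,
        GenLoop.coe_copy]
      rw [if_pos (by rw [h2]; linarith [hs.2])]
      congr 1
      funext k
      by_cases hk : k = i
      · subst hk
        rw [Function.update_self, show 2 * (t k : ℝ) = s k by rw [h2]; ring, projIcc_val]
      · rw [Function.update_of_ne hk, h1 k hk]
    · simp only [GenLoop.concat, List.nil_append, List.foldr_cons, GenLoop.transAt,
        GenLoop.coe_copy]
      by_cases h : (t i : ℝ) ≤ 1 / 2
      · left
        rw [if_pos h]
        refine p.2 _ ⟨i, ?_⟩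
        rw [Function.update_self]
        rcases ht with ht | ht
        · exact Or.inl ((projIcc_eq_left zero_lt_one).2 (by linarith))
        · exact Or.inr ((projIcc_eq_right zero_lt_one).2 (by linarith))
      · rw [if_neg h]
        exact GenLoop.concat_apply_eq i l₂ _
  | cons q l₁ ih =>
    obtain ⟨a, b, h0, hab, hb1, hin, hout⟩ := ih
    refine ⟨(1 + a) / 2, (1 + b) / 2, by linarith, by linarith, by linarith,
      fun t s h1 h2 => ?_, fun t ht => ?_⟩
    · have hs := (s i).2
      have hpos : 0 ≤ (b - a) * s i := mul_nonneg (by linarith) hs.1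
      have hle : (b - a) * s i ≤ b - a := mul_le_of_le_one_right (by linarith) hs.2
      have hval : 2 * (t i : ℝ) - 1 = a + (b - a) * s i := by
        rw [h2]
        ring
      simp only [List.cons_append, GenLoop.concat, List.foldr_cons, GenLoop.transAt,
        GenLoop.coe_copy]
      have hproj : ((projIcc (0 : ℝ) 1 zero_le_one (2 * t i - 1) : unitInterval) : ℝ) =
          a + (b - a) * s i := by
        rw [hval, projIcc_of_mem zero_le_one ⟨by linarith, by linarith⟩]
      by_cases h : (t i : ℝ) ≤ 1 / 2
      · -- At the common end `1/2` of the two halves both loops are at the base point.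
        have hz : a + (b - a) * s i = 0 := by linarith
        have hs0 : (s i : ℝ) = 0 := by
          have : (b - a) * s i = 0 := by linarith
          exact (mul_eq_zero.1 this).resolve_left (by linarith)
        rw [if_pos h, GenLoop.boundary q _ ⟨i, Or.inr ?_⟩, GenLoop.boundary p s ⟨i, Or.inl (Subtype.ext hs0)⟩]
        rw [Function.update_self]
        exact (projIcc_eq_right zero_lt_one).2 (by linarith)
      · rw [if_neg h]
        refine hin _ s (fun k hk => ?_) ?_
        · rw [Function.update_of_ne hk, h1 k hk]
        · rw [Function.update_self, hproj]
    · simp only [List.cons_append, GenLoop.concat, List.foldr_cons, GenLoop.transAt,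
        GenLoop.coe_copy]
      by_cases h : (t i : ℝ) ≤ 1 / 2
      · rw [if_pos h]
        exact Or.inr ⟨q, List.mem_cons_self, _, rfl⟩
      · rw [if_neg h]
        have hmem : 2 * (t i : ℝ) - 1 ∈ Icc (0 : ℝ) 1 := ⟨by linarith, by linarith [(t i).2.2]⟩
        rcases hout (Function.update t i (projIcc 0 1 zero_le_one (2 * t i - 1))) (by
          rw [Function.update_self, projIcc_of_mem zero_le_one hmem]
          rcases ht with ht | ht
          · exact Or.inl (by simp only; linarith)
          · exact Or.inr (by simp only; linarith)) with h' | ⟨r, hr, t', h'⟩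
        · exact Or.inl h'
        · exact Or.inr ⟨r, List.mem_cons_of_mem _ hr, t', h'⟩

end Concat

open Torus

/-! ### Loops of maps supported on a cell -/

section SphereLoop

variable {V : Type u} {τ : Finset V} {m ℓ : ℕ}

/-- The coordinates of a point of the torus that belong to a cell. -/
def cellCoord (hc : τ.card = m) (x : Torus V) : Fin m → UnitAddCircle :=
  fun k => x ((τ.equivFinOfCardEq hc).symm k)

/-- The coordinate torus of a cell. -/
def cellExtend (hc : τ.card = m) (y : Fin m → UnitAddCircle) : Torus V :=
  open Classical in fun i => if h : i ∈ τ then y (τ.equivFinOfCardEq hc ⟨i, h⟩) else 0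

lemma continuous_cellCoord (hc : τ.card = m) : Continuous (cellCoord hc) := by
  unfold cellCoord
  fun_prop

lemma continuous_cellExtend (hc : τ.card = m) : Continuous (cellExtend hc) := by
  refine continuous_pi fun i => ?_
  by_cases h : i ∈ τ
  · simp only [cellExtend, h, dif_pos]
    fun_prop
  · simp only [cellExtend, h, dif_neg, not_false_eq_true]
    fun_prop

lemma cellCoord_cellExtend (hc : τ.card = m) (y : Fin m → UnitAddCircle) :
    cellCoord hc (cellExtend hc y) = y := by
  funext k
  simp [cellCoord, cellExtend]

lemma cellExtend_cellCoord (hc : τ.card = m) (x : Torus V) :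
    cellExtend hc (cellCoord hc x) = restrictTo τ x := by
  funext i
  by_cases h : i ∈ τ
  · simp [cellCoord, cellExtend, h, restrictTo]
  · simp [cellExtend, h, restrictTo]

lemma exists_cellCoord_eq_zero_iff (hc : τ.card = m) (x : Torus V) :
    (∃ k, cellCoord hc x k = 0) ↔ ∃ i ∈ τ, x i = 0 := by
  constructor
  · rintro ⟨k, hk⟩
    exact ⟨_, ((τ.equivFinOfCardEq hc).symm k).2, hk⟩
  · rintro ⟨i, hi, h⟩
    exact ⟨τ.equivFinOfCardEq hc ⟨i, hi⟩, by simpa [cellCoord] using h⟩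

variable {Z : Type u} [TopologicalSpace Z] {z : Z}

lemma continuous_torusToSphere_cellCoord (hc : τ.card = m) :
    Continuous fun q : (Fin ℓ → unitInterval) × Torus V => torusToSphere (cellCoord hc q.2) q.1 := by
  have h : Continuous fun q : (Fin ℓ → unitInterval) × Torus V => (cellCoord hc q.2, q.1) :=
    ((continuous_cellCoord hc).comp continuous_snd).prodMk continuous_fst
  exact (continuous_torusToSphere (m := m) (ℓ := ℓ)).comp h

/-- The map of `I^ℓ × T^V` that collapses the cell to a sphere and applies a map of the sphere. -/
def sphereLoopAux (hc : τ.card = m) (b : C(StdSphere (m + ℓ), Z)) :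
    C((Fin ℓ → unitInterval) × Torus V, Z) :=
  b.comp ⟨fun q => torusToSphere (cellCoord hc q.2) q.1, continuous_torusToSphere_cellCoord hc⟩

lemma sphereLoopAux_apply (hc : τ.card = m) (b : C(StdSphere (m + ℓ), Z))
    (t : Fin ℓ → unitInterval) (x : Torus V) :
    (sphereLoopAux hc b).curry t x = b (torusToSphere (cellCoord hc x) t) := rfl

/-- The loop of maps supported on a cell that a pointed map out of a sphere defines. -/
def sphereLoop (hc : τ.card = m) (b : C(StdSphere (m + ℓ), Z)) (hb : b (StdSphere.base _) = z) :
    GenLoop (Fin ℓ) (CellMaps τ z) (CellMaps.base τ z) :=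
  ⟨⟨fun t => ⟨(sphereLoopAux hc b).curry t, fun x hx => by
        rw [sphereLoopAux_apply,
          torusToSphere_eq_base_iff.2 (Or.inl ((exists_cellCoord_eq_zero_iff hc x).2 hx)), hb],
      fun x => by
        rw [sphereLoopAux_apply, sphereLoopAux_apply, ← cellExtend_cellCoord hc,
          cellCoord_cellExtend]⟩, (sphereLoopAux hc b).curry.2.subtype_mk _⟩,
    fun t ht => Subtype.ext (ContinuousMap.ext fun x => by
      refine (sphereLoopAux_apply hc b t x).trans ?_
      rw [torusToSphere_eq_base_iff.2 (Or.inr ht), hb]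
      rfl)⟩

lemma sphereLoop_apply (hc : τ.card = m) (b : C(StdSphere (m + ℓ), Z))
    (hb : b (StdSphere.base _) = z) (t : Fin ℓ → unitInterval) (x : Torus V) :
    (sphereLoop hc b hb t).1 x = b (torusToSphere (cellCoord hc x) t) := rfl

/-- All loops of maps supported on a cell come from maps out of the sphere. -/
lemma exists_sphereLoop_eq (hc : τ.card = m) (hN : 0 < m + ℓ)
    (γ : GenLoop (Fin ℓ) (CellMaps τ z) (CellMaps.base τ z)) :
    ∃ (b : C(StdSphere (m + ℓ), Z)) (hb : b (StdSphere.base _) = z), sphereLoop hc b hb = γ := by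
  obtain ⟨b, hb, h⟩ := exists_sphere_lift hN (z := z)
    ⟨fun q : (Fin m → UnitAddCircle) × (Fin ℓ → unitInterval) => (γ.1 q.2).1 (cellExtend hc q.1), by
      have := continuous_cellExtend hc
      fun_prop⟩ (fun y t hy => (γ.1 t).2.1 _
        ((exists_cellCoord_eq_zero_iff hc _).1 (by rwa [cellCoord_cellExtend])))
      (fun y t ht => by
        change (γ.1 t).1 _ = z
        rw [γ.2 t ht]
        rfl)
  refine ⟨b, hb, ?_⟩
  ext t x
  rw [sphereLoop_apply, h]
  change (γ t).1 (cellExtend hc (cellCoord hc x)) = _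
  rw [cellExtend_cellCoord, (γ t).2.2]

/-- If two pointed maps out of a sphere define homotopic loops, they are homotopic. -/
lemma exists_homotopy_of_mk_sphereLoop_eq (hc : τ.card = m) (hN : 0 < m + ℓ)
    {b₀ b₁ : C(StdSphere (m + ℓ), Z)} (h₀ : b₀ (StdSphere.base _) = z)
    (h₁ : b₁ (StdSphere.base _) = z)
    (h : HomotopyGroup.mk (sphereLoop hc b₀ h₀) = HomotopyGroup.mk (sphereLoop hc b₁ h₁)) :
    ∃ B : C(StdSphere (m + ℓ), C(unitInterval, Z)), B (StdSphere.base _) = .const _ z ∧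
      (∀ a, B a 0 = b₀ a) ∧ ∀ a, B a 1 = b₁ a := by
  obtain ⟨H, hH0, hH1, hHb⟩ := HomotopyGroup.mk_eq_mk_iff.1 h
  let G : C(((Fin m → UnitAddCircle) × (Fin ℓ → unitInterval)) × unitInterval, Z) :=
    ⟨fun q => (H (q.2, q.1.2)).1 (cellExtend hc q.1.1), by
      have := continuous_cellExtend hc
      fun_prop⟩
  have hG : ∀ y t s, G.curry (y, t) s = (H (s, t)).1 (cellExtend hc y) := fun _ _ _ => rfl
  obtain ⟨B, hB, hBG⟩ := exists_sphere_lift hN (z := .const _ z) G.curry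
    (fun y t hy => by
      ext s
      rw [hG]
      exact (H (s, t)).2.1 _
        ((exists_cellCoord_eq_zero_iff hc _).1 (by rwa [cellCoord_cellExtend])))
    (fun y t ht => by
      ext s
      rw [hG, hHb s t ht]
      rfl)
  refine ⟨B, hB, fun a => ?_, fun a => ?_⟩
  · obtain ⟨y, t, rfl⟩ := torusToSphere_surjective hN a
    rw [hBG, hG, hH0, sphereLoop_apply, cellCoord_cellExtend]
  · obtain ⟨y, t, rfl⟩ := torusToSphere_surjective hN a
    rw [hBG, hG, hH1, sphereLoop_apply, cellCoord_cellExtend]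

end SphereLoop

/-! ### The map from the suspension to the wedge of spheres -/

open Torus

section Suspension

variable {V : Type u} [Fintype V] {𝒦 𝒦₀ : LowerSet (Finset V)} {ℓ : ℕ}
  {Y Z : Type u} [TopologicalSpace Y] [TopologicalSpace Z] {y : Y} {z : Z}

/-- Composition with a pointed map. -/
def RelMaps.postcomp (b : C(Y, Z)) (hb : b y = z) : C(RelMaps 𝒦 𝒦₀ y, RelMaps 𝒦 𝒦₀ z) :=
  ⟨fun φ => ⟨b.comp φ.1, fun x hx => (congrArg b (φ.2 x hx)).trans hb⟩,
    ((ContinuousMap.continuous_postcomp b).comp continuous_subtype_val).subtype_mk _⟩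

lemma RelMaps.postcomp_base (b : C(Y, Z)) (hb : b y = z) :
    RelMaps.postcomp b hb (RelMaps.base 𝒦 𝒦₀ y) = RelMaps.base 𝒦 𝒦₀ z :=
  Subtype.ext (ContinuousMap.ext fun _ => hb)

lemma support_mem_Iic_iff {x : Torus V} : support x ∈ LowerSet.Iic (∅ : Finset V) ↔ x = 0 := by
  rw [LowerSet.mem_Iic_iff, support_subset_iff]
  exact ⟨fun h => funext fun i => h i (Finset.notMem_empty i), fun h i _ => by rw [h]; rfl⟩

/-- The pointed map out of the suspension of a subcomplex that a loop of pointed maps defines. -/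
def suspMap (h₀ : 0 ∈ face 𝒦)
    (γ : GenLoop (Fin ℓ) (RelMaps 𝒦 (.Iic ∅) z) (RelMaps.base 𝒦 (.Iic ∅) z)) :
    C(ReducedSuspension ℓ (face 𝒦) ⟨0, h₀⟩, Z) :=
  ReducedSuspension.lift z ⟨fun q => (γ.1 q.2).1 q.1, by fun_prop⟩ (by
    rintro x t (h | h)
    · exact (γ.1 t).2 x (support_mem_Iic_iff.2 (congrArg Subtype.val h))
    · change (γ.1 t).1 x = z
      rw [γ.2 t h]
      rfl)

lemma suspMap_mk (h₀ : 0 ∈ face 𝒦)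
    (γ : GenLoop (Fin ℓ) (RelMaps 𝒦 (.Iic ∅) z) (RelMaps.base 𝒦 (.Iic ∅) z)) (x : face 𝒦)
    (t : Fin ℓ → unitInterval) :
    suspMap h₀ γ (ReducedSuspension.mk x t) = (γ t).1 x := rfl

lemma suspMap_homotopic (h₀ : 0 ∈ face 𝒦)
    {γ γ' : GenLoop (Fin ℓ) (RelMaps 𝒦 (.Iic ∅) z) (RelMaps.base 𝒦 (.Iic ∅) z)}
    (h : HomotopyGroup.mk γ = HomotopyGroup.mk γ') :
    (suspMap h₀ γ).Homotopic (suspMap h₀ γ') := by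
  obtain ⟨H, hH0, hH1, hHb⟩ := HomotopyGroup.mk_eq_mk_iff.1 h
  let G : C((face 𝒦 × (Fin ℓ → unitInterval)) × unitInterval, Z) :=
    ⟨fun q => (H (q.2, q.1.2)).1 q.1.1, by fun_prop⟩
  have hG : ∀ x t s, G.curry (x, t) s = (H (s, t)).1 x := fun _ _ _ => rfl
  let L : C(ReducedSuspension ℓ (face 𝒦) ⟨0, h₀⟩, C(unitInterval, Z)) :=
    ReducedSuspension.lift (.const _ z) G.curry (by
      rintro x t (h | h) <;> ext s <;> rw [hG]
      · exact (H (s, t)).2 x (support_mem_Iic_iff.2 (congrArg Subtype.val h))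
      · rw [hHb s t h]
        rfl)
  have hL : ∀ x t s, L (ReducedSuspension.mk x t) s = (H (s, t)).1 x := fun _ _ _ => rfl
  refine ⟨⟨⟨fun q => L q.2 q.1, by fun_prop⟩, fun a => ?_, fun a => ?_⟩⟩
  · obtain ⟨x, t, rfl⟩ := a.exists_mk
    refine (hL x t 0).trans ?_
    rw [hH0, suspMap_mk]
  · obtain ⟨x, t, rfl⟩ := a.exists_mk
    refine (hL x t 1).trans ?_
    rw [hH1, suspMap_mk]

/-- The universal loop of maps to the suspension, which corresponds to the identity map. -/
def suspLoop (ℓ : ℕ) (h₀ : 0 ∈ face 𝒦) :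
    GenLoop (Fin ℓ) (RelMaps 𝒦 (.Iic ∅)
      (ReducedSuspension.mk ⟨0, h₀⟩ 0 : ReducedSuspension ℓ (face 𝒦) ⟨0, h₀⟩))
      (RelMaps.base 𝒦 (.Iic ∅) _) :=
  let G : C((Fin ℓ → unitInterval) × face 𝒦, ReducedSuspension ℓ (face 𝒦) ⟨0, h₀⟩) :=
    ⟨fun q => ReducedSuspension.mk q.2 q.1,
      ReducedSuspension.continuous_mk.comp (continuous_snd.prodMk continuous_fst)⟩
  ⟨⟨fun t => ⟨G.curry t, fun _ hx => ReducedSuspension.mk_eq_mk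
      (Or.inl (Subtype.ext (support_mem_Iic_iff.1 hx))) (Or.inl rfl)⟩, G.curry.2.subtype_mk _⟩,
    fun _ ht => Subtype.ext (ContinuousMap.ext fun _ =>
      ReducedSuspension.mk_eq_mk (Or.inr ht) (Or.inl rfl))⟩

end Suspension

/-- An enumeration of the cells of positive dimension of the subcomplex of `𝒦`, where `d` is the
dimension. -/
structure CellIndexing {V : Type u} [Fintype V] (𝒦 : LowerSet (Finset V)) {J : Type u}
    (d : J → ℕ) where
  /-- The set of coordinates of the cell. -/
  cell : J → Finset V
  card_cell : ∀ j, (cell j).card = d j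
  cell_injective : Function.Injective cell
  mem_iff : ∀ σ, σ ∈ relCells 𝒦 (.Iic ∅) ↔ ∃ j, cell j = σ

namespace CellIndexing

variable {V : Type u} [Fintype V] {𝒦 : LowerSet (Finset V)} {J : Type u} {d : J → ℕ}
  (c : CellIndexing 𝒦 d) {ℓ : ℕ} {Z : Type u} [TopologicalSpace Z] {z : Z}

include c

lemma mem_relCells (j : J) : c.cell j ∈ relCells 𝒦 (.Iic ∅) := (c.mem_iff _).2 ⟨j, rfl⟩

lemma notMem (j : J) : c.cell j ∉ LowerSet.Iic (∅ : Finset V) :=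
  (_root_.mem_relCells.1 (c.mem_relCells j)).2

/-- The loop of maps that collapse a cell to its sphere. -/
def cellLoop (ℓ : ℕ) (j : J) :
    GenLoop (Fin ℓ) (RelMaps 𝒦 (.Iic ∅) (SphereWedge.base : SphereWedge fun j => d j + ℓ))
      (RelMaps.base 𝒦 (.Iic ∅) _) :=
  GenLoop.map (CellMaps.res 𝒦 SphereWedge.base (c.notMem j)) rfl
    (sphereLoop (c.card_cell j) (SphereWedge.inclMap (d := fun j => d j + ℓ) j)
      (SphereWedge.inclMap_base j))

lemma cellLoop_apply (j : J) (t : Fin ℓ → unitInterval) (x : face 𝒦) :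
    (c.cellLoop ℓ j t).1 x =
      SphereWedge.incl j (torusToSphere (cellCoord (c.card_cell j) x.1) t) := rfl

variable [Fintype J]

/-- The concatenation of the collapses of all cells. -/
def wedgeLoop (i₀ : Fin ℓ) :
    GenLoop (Fin ℓ) (RelMaps 𝒦 (.Iic ∅) (SphereWedge.base : SphereWedge fun j => d j + ℓ))
      (RelMaps.base 𝒦 (.Iic ∅) _) :=
  GenLoop.concat i₀ (Finset.univ.toList.map (c.cellLoop ℓ))

section HomotopyGroup

variable [Nontrivial (Fin ℓ)]

lemma prod_relCells {M : Type*} [CommMonoid M] (f : Finset V → M) :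
    ∏ τ ∈ relCells 𝒦 (.Iic ∅), f τ = ∏ j, f (c.cell j) := by
  classical
  have : relCells 𝒦 (.Iic ∅) = Finset.univ.image c.cell := by
    ext σ
    simp [c.mem_iff]
  rw [this, Finset.prod_image fun _ _ _ _ h => c.cell_injective h]

lemma exists_eq_prod
    (g : HomotopyGroup (Fin ℓ) (RelMaps 𝒦 (.Iic ∅) z) (RelMaps.base 𝒦 (.Iic ∅) z)) :
    ∃ b : ∀ j, HomotopyGroup (Fin ℓ) (CellMaps (c.cell j) z) (CellMaps.base (c.cell j) z),
      g = ∏ j, cellHom (Fin ℓ) 𝒦 (.Iic ∅) z (c.cell j) (b j) := by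
  obtain ⟨b, rfl⟩ := (cellHom_prod_bijective 𝒦 (.Iic ∅) z).1 g
  exact ⟨fun j => b (c.cell j), c.prod_relCells _⟩

lemma eq_one_of_prod_eq_one
    (b : ∀ j, HomotopyGroup (Fin ℓ) (CellMaps (c.cell j) z) (CellMaps.base (c.cell j) z))
    (hb : ∏ j, cellHom (Fin ℓ) 𝒦 (.Iic ∅) z (c.cell j) (b j) = 1) (j : J) : b j = 1 := by
  have hext : ∀ τ, ∃ y : HomotopyGroup (Fin ℓ) (CellMaps τ z) (CellMaps.base τ z),
      ∀ (j : J) (h : c.cell j = τ), h ▸ b j = y := by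
    intro τ
    by_cases h : ∃ j, c.cell j = τ
    · obtain ⟨j, rfl⟩ := h
      refine ⟨b j, fun j' h => ?_⟩
      obtain rfl := c.cell_injective h
      rfl
    · exact ⟨1, fun j hj => absurd ⟨j, hj⟩ h⟩
  choose b' hb' using hext
  replace hb' : ∀ j, b j = b' (c.cell j) := fun j => hb' _ j rfl
  simp only [hb'] at hb ⊢
  exact (cellHom_prod_bijective 𝒦 (.Iic ∅) z).2 b'
    ((c.prod_relCells fun τ => cellHom (Fin ℓ) 𝒦 (.Iic ∅) z τ (b' τ)).trans hb) _
    (c.mem_relCells j)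

/-- Composition with the map to the wedge multiplies the contributions of the spheres. -/
lemma mk_map_wedgeLoop (i₀ : Fin ℓ) (b : C(SphereWedge fun j => d j + ℓ, Z))
    (hb : b SphereWedge.base = z) :
    HomotopyGroup.mk (GenLoop.map (RelMaps.postcomp b hb) (RelMaps.postcomp_base b hb)
        (c.wedgeLoop i₀)) =
      ∏ j, cellHom (Fin ℓ) 𝒦 (.Iic ∅) z (c.cell j) (HomotopyGroup.mk
        (sphereLoop (c.card_cell j) (b.comp (SphereWedge.inclMap (d := fun j => d j + ℓ) j))
          ((congrArg b (SphereWedge.inclMap_base j)).trans hb))) := by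
  rw [← HomotopyGroup.map_mk, wedgeLoop, HomotopyGroup.mk_concat, map_list_prod, List.map_map,
    List.map_map, Finset.prod_map_toList]
  refine Finset.prod_congr rfl fun j _ => ?_
  rw [cellHom_eq (c.notMem j)]
  rfl

/-- A pointed map out of the wedge is determined up to homotopy by its composition with the map from
the suspension. -/
lemma homotopic_of_mk_eq (i₀ : Fin ℓ) {b₀ b₁ : C(SphereWedge fun j => d j + ℓ, Z)}
    (h₀ : b₀ SphereWedge.base = z) (h₁ : b₁ SphereWedge.base = z)
    (h : HomotopyGroup.mk (GenLoop.map (RelMaps.postcomp b₀ h₀) (RelMaps.postcomp_base b₀ h₀)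
        (c.wedgeLoop i₀)) =
      HomotopyGroup.mk (GenLoop.map (RelMaps.postcomp b₁ h₁) (RelMaps.postcomp_base b₁ h₁)
        (c.wedgeLoop i₀))) : b₀.Homotopic b₁ := by
  rw [mk_map_wedgeLoop, mk_map_wedgeLoop, ← div_eq_one, ← Finset.prod_div_distrib] at h
  simp only [← map_div] at h
  have key := fun j => div_eq_one.1 (c.eq_one_of_prod_eq_one _ h j)
  have hN : ∀ j, 0 < d j + ℓ := fun j => by
    have := i₀.2
    omega
  choose B hB hB0 hB1 using fun j => exists_homotopy_of_mk_sphereLoop_eq _ (hN j) _ _ (key j)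
  let L := SphereWedge.lift _ B hB
  refine ⟨⟨⟨fun q => L q.2 q.1, by fun_prop⟩, fun w => ?_, fun w => ?_⟩⟩
  · change L w 0 = _
    obtain rfl | ⟨j, s, rfl⟩ := w.eq_base_or_incl
    · exact h₀.symm
    · exact hB0 j s
  · change L w 1 = _
    obtain rfl | ⟨j, s, rfl⟩ := w.eq_base_or_incl
    · exact h₁.symm
    · exact hB1 j s

/-- By the Yoneda principle, the concatenation of the collapses is a homotopy equivalence: pointed
maps out of the suspension and out of the wedge are classified by the same products of homotopy
groups. -/
theorem exists_homotopyEquiv (i₀ : Fin ℓ) (h₀ : 0 ∈ face 𝒦) :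
    ∃ F : ContinuousMap.HomotopyEquiv (ReducedSuspension ℓ (face 𝒦) ⟨0, h₀⟩)
      (SphereWedge fun j => d j + ℓ), F.toFun = suspMap h₀ (c.wedgeLoop i₀) := by
  have hN : ∀ j, 0 < d j + ℓ := fun j => by
    have := i₀.2
    omega
  -- The factors of the universal loop are the components of the inverse map `g`.
  obtain ⟨b, hb⟩ := c.exists_eq_prod (HomotopyGroup.mk (suspLoop ℓ h₀))
  choose γ hγ using fun j => (b j).exists_mk
  choose β hβ hβγ using fun j => exists_sphereLoop_eq (c.card_cell j) (hN j) (γ j)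
  let f := suspMap h₀ (c.wedgeLoop i₀)
  let g := SphereWedge.lift _ β hβ
  have hg : g SphereWedge.base = ReducedSuspension.mk ⟨0, h₀⟩ 0 := rfl
  have hf : f (ReducedSuspension.mk ⟨0, h₀⟩ 0) = SphereWedge.base :=
    ((c.wedgeLoop i₀) 0).2 _ (support_mem_Iic_iff.2 rfl)
  have hmk : HomotopyGroup.mk (GenLoop.map (RelMaps.postcomp g hg) (RelMaps.postcomp_base g hg)
      (c.wedgeLoop i₀)) = HomotopyGroup.mk (suspLoop ℓ h₀) := by
    rw [mk_map_wedgeLoop, hb]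
    refine Finset.prod_congr rfl fun j _ => ?_
    rw [hγ j, ← hβγ j]
    rfl
  refine ⟨⟨f, g, ?_, ?_⟩, rfl⟩
  · have h1 : g.comp f = suspMap h₀ (GenLoop.map (RelMaps.postcomp g hg)
        (RelMaps.postcomp_base g hg) (c.wedgeLoop i₀)) := by
      ext a
      obtain ⟨x, t, rfl⟩ := a.exists_mk
      rfl
    have h2 : ContinuousMap.id _ = suspMap h₀ (suspLoop ℓ h₀) := by
      ext a
      obtain ⟨x, t, rfl⟩ := a.exists_mk
      rfl
    rw [h1, h2]
    exact suspMap_homotopic h₀ hmk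
  · refine c.homotopic_of_mk_eq i₀ (b₀ := f.comp g) (b₁ := .id _) ((congrArg f hg).trans hf) rfl ?_
    have := congrArg (HomotopyGroup.map (RelMaps.postcomp f hf) (RelMaps.postcomp_base f hf)) hmk
    rw [HomotopyGroup.map_mk, HomotopyGroup.map_mk] at this
    exact this

end HomotopyGroup

end CellIndexing

/-! ### Values of the map to the wedge -/

open Torus

namespace CellIndexing

variable {V : Type u} [Fintype V] {𝒦 : LowerSet (Finset V)} {J : Type u} {d : J → ℕ}
  (c : CellIndexing 𝒦 d) {ℓ : ℕ}

lemma cellLoop_mem_sub (j : J) (t : Fin ℓ → unitInterval) (x : face 𝒦) {P : J → Prop}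
    (hP : c.cell j ⊆ support x.1 → P j) :
    (c.cellLoop ℓ j t).1 x ∈ SphereWedge.sub (d := fun j => d j + ℓ) P := by
  rw [cellLoop_apply]
  by_cases h : c.cell j ⊆ support x.1
  · exact Or.inr ⟨j, hP h, mem_range_self _⟩
  · left
    rw [torusToSphere_eq_base_iff.2 (Or.inl ((exists_cellCoord_eq_zero_iff (c.card_cell j) _).2
      (exists_mem_eq_zero_of_not_subset h)))]
    exact SphereWedge.inclMap_base j

variable [Fintype J]

lemma wedgeLoop_mem_sub (i₀ : Fin ℓ) (t : Fin ℓ → unitInterval) (x : face 𝒦) {P : J → Prop}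
    (hP : ∀ j, c.cell j ⊆ support x.1 → P j) :
    (c.wedgeLoop i₀ t).1 x ∈ SphereWedge.sub (d := fun j => d j + ℓ) P := by
  rcases GenLoop.concat_apply_eq i₀ (Finset.univ.toList.map (c.cellLoop ℓ)) t with h | ⟨p, hp, t', h⟩
  · left
    rw [wedgeLoop, h]
    rfl
  · obtain ⟨j, -, rfl⟩ := List.mem_map.1 hp
    rw [wedgeLoop, h]
    exact c.cellLoop_mem_sub j t' x (hP j)

/-- The slab of the cube in which the map to the wedge is the collapse of the cell `j`. -/
lemma exists_slab (i₀ : Fin ℓ) (j : J) :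
    ∃ a b : ℝ, 0 ≤ a ∧ a < b ∧ b ≤ 1 ∧
      (∀ t s : Fin ℓ → unitInterval, (∀ k ≠ i₀, t k = s k) → (t i₀ : ℝ) = a + (b - a) * s i₀ →
        c.wedgeLoop i₀ t = c.cellLoop ℓ j s) ∧
      ∀ (t : Fin ℓ → unitInterval) (x : face 𝒦) (P : J → Prop), (t i₀ : ℝ) ≤ a ∨ b ≤ t i₀ →
        (∀ j' ≠ j, c.cell j' ⊆ support x.1 → P j') →
        (c.wedgeLoop i₀ t).1 x ∈ SphereWedge.sub (d := fun j => d j + ℓ) P := by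
  obtain ⟨l₁, l₂, hl⟩ := List.append_of_mem (Finset.mem_toList.2 (Finset.mem_univ j))
  have hnd := Finset.nodup_toList (Finset.univ : Finset J)
  have hw : c.wedgeLoop i₀ = GenLoop.concat i₀
      (l₁.map (c.cellLoop ℓ) ++ c.cellLoop ℓ j :: l₂.map (c.cellLoop ℓ)) := by
    rw [wedgeLoop, hl, List.map_append, List.map_cons]
  rw [hl, List.nodup_middle, List.nodup_cons] at hnd
  obtain ⟨a, b, h0, hab, hb1, hin, hout⟩ := GenLoop.exists_slab i₀
    (l₁.map (c.cellLoop ℓ)) (c.cellLoop ℓ j) (l₂.map (c.cellLoop ℓ))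
  rw [hw]
  refine ⟨a, b, h0, hab, hb1, hin, fun t x P ht hP => ?_⟩
  rcases hout t ht with h | ⟨q, hq, t', h⟩
  · left
    rw [h]
    rfl
  · rw [← List.map_append] at hq
    obtain ⟨j', hj', rfl⟩ := List.mem_map.1 hq
    rw [h]
    exact c.cellLoop_mem_sub j' t' x (hP j' fun heq => hnd.1 (heq ▸ hj'))

/-- The homotopy equivalence, for a subcomplex that is not literally given as `face 𝒦`. -/
lemma exists_homotopyEquiv_of_eq [Nontrivial (Fin ℓ)] (i₀ : Fin ℓ) {S : Set (Torus V)}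
    (hS : S = face 𝒦) (h₀ : 0 ∈ S) :
    ∃ F : ContinuousMap.HomotopyEquiv (ReducedSuspension ℓ S ⟨0, h₀⟩)
      (SphereWedge fun j => d j + ℓ), ∀ (x : S) (t : Fin ℓ → unitInterval),
        F.toFun (ReducedSuspension.mk x t) = (c.wedgeLoop i₀ t).1 ⟨x.1, hS ▸ x.2⟩ := by
  subst hS
  obtain ⟨F, hF⟩ := c.exists_homotopyEquiv i₀ h₀
  refine ⟨F, fun x t => ?_⟩
  rw [hF]
  rfl

end CellIndexing

/-! ### Subcomplexes of the torus -/

namespace Torus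

variable {V : Type u}

lemma charFun_eq_cellExtend {m : ℕ} (τ : Cell V m) (y : Fin m → ℝ) :
    charFun τ y = cellExtend τ.2 fun k => (((y k + 1) / 2 : ℝ) : UnitAddCircle) := rfl

variable [Fintype V]

lemma mem_openCellSet_iff {τ : Finset V} {x : Torus V} : x ∈ openCellSet τ ↔ support x = τ := by
  rw [Finset.ext_iff]
  simp only [mem_support]
  rfl

lemma support_charFun_subset {m : ℕ} (τ : Cell V m) (y : Fin m → ℝ) :
    support (charFun τ y) ⊆ τ.1 :=
  support_subset_iff.2 fun i hi => by simp [charFun, hi]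

lemma image_charFun_closedBall {m : ℕ} (τ : Cell V m) :
    charFun τ '' closedBall 0 1 = {x | support x ⊆ τ.1} := by
  refine Subset.antisymm (image_subset_iff.2 fun y _ => support_charFun_subset τ y) fun x hx => ?_
  refine ⟨torusCoord (cellCoord τ.2 x), mem_closedBall_zero_iff.2 (norm_torusCoord_le _), ?_⟩
  rw [charFun_eq_cellExtend]
  simp only [coe_torusCoord]
  rw [cellExtend_cellCoord, restrictTo_eq_self hx]

/-- The sets of coordinates of the cells of a subcomplex, characterized by the property that the
coordinate torus is contained in the subcomplex. -/
def cellsOf (K : CWComplex.Subcomplex (univ : Set (Torus V))) : LowerSet (Finset V) :=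
  ⟨{σ | ∀ x : Torus V, support x ⊆ σ → x ∈ K}, fun _ _ h hσ x hx => hσ x (hx.trans h)⟩

variable {K : CWComplex.Subcomplex (univ : Set (Torus V))}

lemma mem_cellsOf_of_mem_I {m : ℕ} {τ : Cell V m} (h : τ ∈ K.I m) : τ.1 ∈ cellsOf K := by
  intro x hx
  refine RelCWComplex.Subcomplex.closedCell_subset_of_mem K (i := τ) h ?_
  change x ∈ charFun τ '' closedBall 0 1
  rwa [image_charFun_closedBall]

lemma exists_mem_I {x : Torus V} (hx : x ∈ K) :
    ∃ (m : ℕ) (τ : Cell V m), τ ∈ K.I m ∧ support x = τ.1 := by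
  have hx' : x ∈ (K : Set (Torus V)) := hx
  rw [← CWComplex.Subcomplex.union (C := (univ : Set (Torus V))) (E := K)] at hx'
  simp only [mem_iUnion] at hx'
  obtain ⟨m, ⟨τ, hτ⟩, h⟩ := hx'
  refine ⟨m, τ, hτ, mem_openCellSet_iff.1 ?_⟩
  exact charMap_image_ball τ ▸ h

lemma coe_eq_face_cellsOf : (K : Set (Torus V)) = face (cellsOf K) := by
  ext x
  refine ⟨fun hx => ?_, fun hx => hx x subset_rfl⟩
  obtain ⟨m, τ, hτ, h⟩ := exists_mem_I hx
  rw [mem_face, h]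
  exact mem_cellsOf_of_mem_I hτ

lemma mem_I_of_mem_cellsOf {m : ℕ} {τ : Cell V m} (h : τ.1 ∈ cellsOf K) : τ ∈ K.I m := by
  have hs : support (charFun τ 0) = τ.1 :=
    mem_openCellSet_iff.1 (charFun_mem τ (mem_ball_self one_pos))
  obtain ⟨m', τ', hτ', h'⟩ := exists_mem_I (h (charFun τ 0) hs.subset)
  obtain ⟨τ, rfl⟩ := τ
  obtain ⟨τ', rfl⟩ := τ'
  obtain rfl : τ = τ' := hs.symm.trans h'
  exact hτ'

/-- The enumeration of the cells of positive dimension of a subcomplex. -/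
def posCellIndexing (K : CWComplex.Subcomplex (univ : Set (Torus V))) :
    CellIndexing (cellsOf K) (PosCell.dim (C := (K : Set (Torus V)))) where
  cell i := i.1.2.1.1
  card_cell i := i.1.2.1.2
  cell_injective := by
    rintro ⟨⟨m, ⟨τ, hm⟩, hτ⟩, hi⟩ ⟨⟨m', ⟨τ', hm'⟩, hτ'⟩, hi'⟩ h
    obtain rfl : τ = τ' := h
    subst hm
    subst hm'
    rfl
  mem_iff σ := by
    rw [mem_relCells, LowerSet.mem_Iic_iff]
    constructor
    · rintro ⟨h1, h2⟩
      have hpos : 0 < σ.card := Finset.card_pos.2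
        (Finset.nonempty_iff_ne_empty.2 fun h => h2 (h ▸ le_rfl))
      exact ⟨⟨⟨σ.card, ⟨⟨σ, rfl⟩, mem_I_of_mem_cellsOf h1⟩⟩, hpos⟩, rfl⟩
    · rintro ⟨⟨⟨m, τ, hτ⟩, hi⟩, rfl⟩
      refine ⟨mem_cellsOf_of_mem_I hτ, fun h => ?_⟩
      have h1 := Finset.card_le_card h
      have h2 := τ.2
      simp only [Finset.card_empty] at h1
      simp only at hi
      omega

lemma card_support_le_of_mem_skeleton {m : ℕ} {x : Torus V}
    (hx : x ∈ RelCWComplex.skeleton (K : Set (Torus V)) (m : ℕ∞)) : (support x).card ≤ m := by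
  have hx' : x ∈ (RelCWComplex.skeleton (K : Set (Torus V)) (m : ℕ∞) : Set (Torus V)) := hx
  rw [RelCWComplex.coe_skeletonLT] at hx'
  simp only [empty_union, mem_iUnion, exists_prop] at hx'
  obtain ⟨n, hn, ⟨τ, hτ⟩, h⟩ := hx'
  have hsub : support x ⊆ τ.1 := by
    have h' : x ∈ charFun τ '' closedBall 0 1 := h
    rwa [image_charFun_closedBall] at h'
  have h1 := Finset.card_le_card hsub
  rw [τ.2] at h1
  have hn' : n < m + 1 := by exact_mod_cast hn
  omega

lemma support_charFun_ssubset {m : ℕ} (τ : Cell V m) {y : Fin m → ℝ} (hy : ‖y‖ = 1) :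
    support (charFun τ y) ⊂ τ.1 := by
  refine (support_charFun_subset τ y).ssubset_of_ne fun h => ?_
  obtain ⟨k, hk⟩ := (norm_eq_one_iff_exists hy.le).1 hy
  obtain ⟨i, hi, h0⟩ := (exists_cellCoord_eq_zero_iff τ.2 (charFun τ y)).1
    ⟨k, by rwa [charFun_eq_cellExtend, cellCoord_cellExtend]⟩
  rw [← h, mem_support] at hi
  exact hi h0

/-- The suspensions of a subcomplex of a torus are wedges of spheres, cell by cell. -/
theorem exists_homotopyEquiv_wedge (K : CWComplex.Subcomplex (univ : Set (Torus V))) (h₀ : 0 ∈ K)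
    {ℓ : ℕ} (hℓ : 2 ≤ ℓ) :
    ∃ F : ContinuousMap.HomotopyEquiv (ReducedSuspension ℓ (K : Set (Torus V)) ⟨0, h₀⟩)
        (SphereWedge fun i : PosCell (K : Set (Torus V)) => i.dim + ℓ),
      IsCellularToWedge F.toFun ∧ TakesCellsToSpheres F.toFun := by
  have : Nontrivial (Fin ℓ) := Fin.nontrivial_iff_two_le.2 hℓ
  have i₀ : Fin ℓ := ⟨0, by omega⟩
  let c := posCellIndexing K
  have : Fintype (PosCell (K : Set (Torus V))) :=
    @Fintype.ofFinite _ (Finite.of_injective c.cell c.cell_injective)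
  obtain ⟨F, hF⟩ := c.exists_homotopyEquiv_of_eq (ℓ := ℓ) i₀ coe_eq_face_cellsOf h₀
  refine ⟨F, fun m x t hx => ?_, fun i => ?_⟩
  · rw [hF]
    refine c.wedgeLoop_mem_sub i₀ t _ fun j hj => ?_
    rw [← c.card_cell j]
    exact (Finset.card_le_card hj).trans (card_support_le_of_mem_skeleton hx)
  let τ : Cell V i.dim := i.1.2.1
  have hmem : ∀ y : Fin i.dim → ℝ, charFun τ y ∈ (K : Set (Torus V)) := fun y =>
    mem_cellsOf_of_mem_I i.1.2.2 _ (support_charFun_subset τ y)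
  obtain ⟨a, b, ha, hab, hb, hin, hout⟩ := c.exists_slab (ℓ := ℓ) i₀ i
  -- The homotopy expands the slab of the cell to the whole cube.
  let e : C(unitInterval × unitInterval, unitInterval) :=
    ⟨fun q => projIcc (0 : ℝ) 1 zero_le_one ((1 - q.1) * q.2 + q.1 * (a + (b - a) * q.2)),
      by fun_prop⟩
  have he : ∀ s r : unitInterval, (e (s, r) : ℝ) = (1 - s) * r + s * (a + (b - a) * r) := by
    intro s r
    have h1 : a + (b - a) * r ∈ Icc (0 : ℝ) 1 := by
      have := mul_nonneg (sub_nonneg.2 hab.le) r.2.1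
      have := mul_le_of_le_one_right (sub_nonneg.2 hab.le) r.2.2
      constructor <;> linarith
    have h2 : (1 - (s : ℝ)) * r + s * (a + (b - a) * r) ∈ Icc (0 : ℝ) 1 :=
      (convex_Icc (0 : ℝ) 1) r.2 h1 (sub_nonneg.2 s.2.2) s.2.1 (sub_add_cancel _ _)
    exact congrArg Subtype.val (projIcc_of_mem zero_le_one h2)
  let h : C(SuspDisk i.dim ℓ, StdSphere (i.dim + ℓ)) :=
    ⟨fun p => diskToSphere p.1.1 p.2, (continuous_diskToSphere (m := i.dim) (ℓ := ℓ)).comp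
      ((continuous_subtype_val.comp continuous_fst).prodMk continuous_snd)⟩
  let H : C(unitInterval × SuspDisk i.dim ℓ,
      SphereWedge fun i : PosCell (K : Set (Torus V)) => i.dim + ℓ) :=
    F.toFun.comp ⟨fun q => ReducedSuspension.mk (⟨charFun τ q.2.1.1, hmem _⟩ : (K : Set (Torus V)))
      (Function.update q.2.2 i₀ (e (q.1, q.2.2 i₀))), by
        refine ReducedSuspension.continuous_mk.comp (Continuous.prodMk ?_
          (Continuous.update (by fun_prop) i₀ (by fun_prop)))
        exact ((continuous_charFun τ).comp (continuous_subtype_val.comp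
          (continuous_fst.comp continuous_snd))).subtype_mk _⟩
  have hH : ∀ s p, H (s, p) = (c.wedgeLoop i₀ (Function.update p.2 i₀ (e (s, p.2 i₀)))).1
      ⟨charFun τ p.1.1, coe_eq_face_cellsOf (K := K) ▸ hmem _⟩ := fun s p => hF _ _
  have hdim : ∀ (j : PosCell (K : Set (Torus V))) (y : Fin i.dim → ℝ),
      c.cell j ⊆ support (charFun τ y) → c.cell j ⊆ τ.1 := fun j y hj =>
    hj.trans (support_charFun_subset τ y)
  have hlt : ∀ j : PosCell (K : Set (Torus V)), c.cell j ⊂ τ.1 → j.dim < i.dim := fun j hj => by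
    rw [← c.card_cell j, ← τ.2]
    exact Finset.card_lt_card hj
  have hnorm : ∀ p : SuspDisk i.dim ℓ, ‖p.1.1‖ ≤ 1 := fun p => mem_closedBall_zero_iff.1 p.1.2
  have hbd : ∀ p : SuspDisk i.dim ℓ, h p = StdSphere.base (i.dim + ℓ) ↔
      p ∈ SuspDisk.boundary i.dim ℓ := fun p => by
    refine (diskToSphere_eq_base_iff (hnorm p)).trans ?_
    rw [SuspDisk.boundary, mem_ofPred_eq, mem_sphere_zero_iff_norm]
  have hin' : ∀ p ∉ SuspDisk.boundary i.dim ℓ, ‖p.1.1‖ < 1 ∧ p.2 ∉ Cube.boundary (Fin ℓ) := by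
    intro p hp
    rw [SuspDisk.boundary, mem_ofPred_eq, mem_sphere_zero_iff_norm, not_or] at hp
    exact ⟨lt_of_le_of_ne (hnorm p) hp.1, hp.2⟩
  refine ⟨h, H, fun p hp => (hbd p).2 hp, ⟨fun p hp h' => hp ((hbd p).1 h'),
    fun p hp q hq heq => ?_, fun w hw => ?_⟩, fun p => ?_, fun p => ?_, fun s p => ?_,
    fun s p hp => ?_⟩
  · obtain ⟨h1, h2⟩ := diskToSphere_injective (hin' p hp).1 (hin' q hq).1 (hin' p hp).2
      (hin' q hq).2 heq
    exact Prod.ext (Subtype.ext h1) h2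
  · obtain ⟨y, t, hy, ht, hyt⟩ := exists_diskToSphere hw
    refine ⟨(⟨y, mem_closedBall_zero_iff.2 hy.le⟩, t), fun hp => hw ?_, hyt⟩
    exact hyt.symm.trans ((hbd (⟨y, mem_closedBall_zero_iff.2 hy.le⟩, t)).2 hp)
  · have : Function.update p.2 i₀ (e (0, p.2 i₀)) = p.2 := by
      rw [show e (0, p.2 i₀) = p.2 i₀ from Subtype.ext (by rw [he]; simp), Function.update_eq_self]
    rw [hH, this]
    exact (hF ⟨charFun τ p.1.1, hmem p.1.1⟩ p.2).symm
  · rw [hH, hin _ p.2 (fun k hk => Function.update_of_ne hk _ _)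
      (by rw [Function.update_self, he]; simp), CellIndexing.cellLoop_apply]
    congr 1
    refine Eq.trans ?_ (torusToSphere_coe (hnorm p) p.2)
    exact congrArg (fun x => torusToSphere x p.2) (cellCoord_cellExtend τ.2
      fun k => (((p.1.1 k + 1) / 2 : ℝ) : UnitAddCircle))
  · rw [hH]
    refine c.wedgeLoop_mem_sub i₀ _ _ fun j hj => ?_
    rw [← c.card_cell j, ← τ.2]
    exact Finset.card_le_card (hdim j _ hj)
  · rw [hH]
    rcases hp with hp | ⟨k, hk⟩
    · refine c.wedgeLoop_mem_sub i₀ _ _ fun j hj => hlt j ?_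
      exact lt_of_le_of_lt hj (support_charFun_ssubset τ (mem_sphere_zero_iff_norm.1 hp))
    by_cases hki : k = i₀
    · subst hki
      refine hout _ _ _ ?_ fun j hj hsub => hlt j
        ((hdim j _ hsub).ssubset_of_ne fun heq => hj (c.cell_injective heq))
      rw [Function.update_self, he]
      rcases hk with hk | hk
      · left
        rw [hk]
        have := mul_le_of_le_one_left ha s.2.2
        simpa using this
      · right
        rw [hk]
        have := mul_nonneg (sub_nonneg.2 s.2.2) (sub_nonneg.2 hb)
        simp only [Icc.coe_one]
        linarith
    · left
      have : Function.update p.2 i₀ (e (s, p.2 i₀)) ∈ Cube.boundary (Fin ℓ) :=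
        ⟨k, by rwa [Function.update_of_ne hki]⟩
      rw [GenLoop.boundary _ _ this]
      rfl

/-- A subcomplex of a torus is stably a wedge of spheres. -/
theorem isStablyWedgeOfSpheres (K : CWComplex.Subcomplex (univ : Set (Torus V))) (h₀ : 0 ∈ K) :
    IsStablyWedgeOfSpheres (K : Set (Torus V)) ⟨0, h₀⟩ :=
  let ⟨F, _⟩ := exists_homotopyEquiv_wedge K h₀ le_rfl
  ⟨PosCell (K : Set (Torus V)), PosCell.dim, 2, ⟨F⟩⟩

end Torus

theorem starS_raag {V : Type u} [Fintype V] (G : SimpleGraph V) : StarS (RAAG G) :=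
  have h₀ : (0 : Torus V) ∈ salvetti G := mem_salvetti.2 fun _ _ h => absurd rfl h
  ⟨Torus V, inferInstance, inferInstance, salvetti G, inferInstance, ⟨0, h₀⟩,
    isClassifyingSpace_salvetti G, Torus.isStablyWedgeOfSpheres _ h₀⟩

end

theorem mainTheorem8 :
    (∀ (n : ℕ) (K : CWComplex.Subcomplex (univ : Set (Torus (Fin n)))) (h₀ : 0 ∈ K),
      (∃ ℓ₀ : ℕ, ∀ ℓ ≥ ℓ₀,
        ∃ F : ContinuousMap.HomotopyEquiv (ReducedSuspension ℓ (K : Set (Torus (Fin n))) ⟨0, h₀⟩)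
            (SphereWedge fun i : PosCell (K : Set (Torus (Fin n))) => i.dim + ℓ),
          IsCellularToWedge F.toFun ∧ TakesCellsToSpheres F.toFun) ∧
      IsStablyWedgeOfSpheres (K : Set (Torus (Fin n))) ⟨0, h₀⟩) ∧
    (∀ (V : Type u) [Fintype V] (G : SimpleGraph V),
      IsClassifyingSpace (RAAG G) (salvetti G : Set (Torus V)) ∧ StarS (RAAG G)) := by
  exact ⟨fun n K h₀ => ⟨⟨2, fun ℓ hℓ => Torus.exists_homotopyEquiv_wedge K h₀ hℓ⟩,
    Torus.isStablyWedgeOfSpheres K h₀⟩,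
    fun V _ G => ⟨isClassifyingSpace_salvetti G, starS_raag G⟩⟩
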